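/- Let $n\ge 1$ and let $(M,g_M)$, $(N,g_N)$ be oriented smooth Riemannian manifolds of dimension $n$ (Hausdorff, second countable, without boundary). Let $p\in M$, $q\in N$, $\varepsilon>0$, and let $\varphi:B(p,2\varepsilon)\to\{|y|<2\varepsilon\}\subset\mathbb R^n$ and $\psi:B'(q,2\varepsilon)\to\{|y|<2\varepsilon\}$ be exponential charts, i.e. $\varphi^{-1}=\exp_p\circ A$ and $\psi^{-1}=\exp_q\circ A'$ with linear isometries $A:\mathbb R^n\to T_pM$, $A':\mathbb R^n\to T_qN$; assume that $\varphi$ preserves and $\psi$ reverses the orientation. Put $i_1=\varphi/\varepsilon$, $i_2=\psi/\varepsilon$. Let $$M\sharp N=\big((M\setminus B(p,\varepsilon))\sqcup(N\setminus B'(q,\varepsilon))\big)/\sim$$ with the quotient topology, where $x\sim y$ if $|i_1(x)|=1$ and $i_1(x)=i_2(y)$; let $\pi$ be the projection, $O$ the union of the annuli $B(p,2\varepsilon)\setminus B(p,\varepsilon)$ and $B'(q,2\varepsilon)\setminus B'(q,\varepsilon)$, and let $\Phi$ be defined on $\pi(O)$ by $\Phi([x])=i_1(x)$ on the first annulus and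 $\Phi([x])=i_2(x)/|i_2(x)|^2$ on the second one. Then: 1. $M\sharp N$ is Hausdorff and second countable (and compact if $M$ and $N$ are), and it has a smooth manifold structure for which the inclusions of $M\setminus\bar B(p,\varepsilon)$ and $N\setminus\bar B'(q,\varepsilon)$ are diffeomorphisms onto open subsets and $\Phi$ is a smooth chart from the open set $\pi(O)$ onto $\{1/2<|y|<2\}$. 2. $M\sharp N$ is orientable: the charts of oriented atlases of $M$ and $N$ (restricted to these open subsets), together with $\Phi$, form an oriented atlas. 3. There are smooth functions $\chi_1,\chi_0,\chi_2\ge 0$ on $M\sharp N$ with $\chi_1+\chi_0+\chi_2=1$ and with closed supports contained respectively in the image of $M\setminus\bar B(p,\varepsilon)$, in $\pi(O)$, and in the image of $N\setminus\bar B'(q,\varepsilon)$. For all such functions, with $\delta$ the Euclidean metric, $$g=\chi_1g_M+\chi_0\,\Phi^*\delta+\chi_2g_N$$ is a smooth Riemannian metric on $M\sharp N$; it coincides with $g_M$ on $M\setminus B(p,2\varepsilon)$ and with $g_N$ on $N\setminus B'(q,2\varepsilon)$. If $g_M$, $g_N$ are locally conformally flat and the charts $\varphi$, $\psi$ are conformal,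 then $g$ is locally conformally flat. 4. If $g_M$ and $g_N$ are locally conformally flat (each point lies in a chart in which the metric is a positive function times the Euclidean metric), then $M\sharp N$ has a locally conformally flat Riemannian metric, which can be chosen to coincide with $g_M$ on $M\setminus B(p,2\varepsilon)$ and with $g_N$ on $N\setminus B'(q,2\varepsilon)$. 5. Suppose that $\mathcal A$, $\mathcal B$ are smooth atlases of $M$, $N$ which consist of charts conformal for $g_M$, $g_N$ and whose changes of charts are locally Möbius transformations (compositions of isometries of $\mathbb R^n$ and inversions in spheres). Then $M\sharp N$ has a smooth atlas $\mathcal C$ whose changes of charts are locally Möbius transformations, and a Riemannian metric $g$ for which the charts of $\mathcal C$ are conformal, such that $g$ coincides with $g_M$ on $M\setminus B(p,2\varepsilon)$ and with $g_N$ on $N\setminus B'(q,2\varepsilon)$, and such that the changes of charts between $\mathcal C$ and the charts of $\mathcal A$ (of $\mathcal B$) whose domain does not meet $B(p,2\varepsilon)$ ($B'(q,2\varepsilon)$) are locally Möbius. If moreover the changes of charts between $\mathcal A$ and $\varphi$ and between $\mathcal B$ and $\psi$ are locally Möbius, then the charts of $\mathcal A$ and $\mathcal B$ (restricted to $M\setminus\bar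 B(p,\varepsilon)$, $N\setminus\bar B'(q,\varepsilon)$) together with $\Phi$ form such an atlas of $M\sharp N$ with locally Möbius changes of charts. -/

import Mathlib

open scoped Manifold ContDiff Topology

namespace ConnectedSum

/-- The model space `ℝⁿ` with its Euclidean norm. -/
abbrev E (n : ℕ) : Type := EuclideanSpace ℝ (Fin n)

/-- A smooth Riemannian metric on a smooth `n`-manifold. -/
abbrev RMetric (n : ℕ) (M : Type*) [TopologicalSpace M] [ChartedSpace (E n) M]
    [IsManifold 𝓘(ℝ, E n) ∞ M] :=
  Bundle.ContMDiffRiemannianMetric 𝓘(ℝ, E n) ∞ (E n)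
    (fun x : M => TangentSpace 𝓘(ℝ, E n) x)

/-- The charts of the smooth structure of `M`. -/
abbrev smoothCharts (n : ℕ) (M : Type*) [TopologicalSpace M] [ChartedSpace (E n) M] :
    Set (OpenPartialHomeomorph M (E n)) :=
  IsManifold.maximalAtlas 𝓘(ℝ, E n) ∞ M

section Riemannian

variable {n : ℕ} {M : Type*} [TopologicalSpace M] [ChartedSpace (E n) M]
  [IsManifold 𝓘(ℝ, E n) ∞ M]

/-- The metric read in the chart `e`: the inner product of `a` and `b` at the point of
coordinates `y` (meaningful for `y ∈ e.target`). -/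
noncomputable def coordMetric (g : RMetric n M) (e : OpenPartialHomeomorph M (E n))
    (y a b : E n) : ℝ :=
  g.inner (e.symm y) (mfderiv 𝓘(ℝ, E n) 𝓘(ℝ, E n) e.symm y a)
    (mfderiv 𝓘(ℝ, E n) 𝓘(ℝ, E n) e.symm y b)

/-- The Christoffel symbol of the first kind of `g` in the chart `e`:
`(∂_u g(v,w) + ∂_v g(u,w) - ∂_w g(u,v)) / 2`, that is `g(∇_u v, w)` for constant `u`, `v`, `w`. -/
noncomputable def christoffel (g : RMetric n M) (e : OpenPartialHomeomorph M (E n))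
    (y u v w : E n) : ℝ :=
  (lineDeriv ℝ (fun z => coordMetric g e z v w) y u
    + lineDeriv ℝ (fun z => coordMetric g e z u w) y v
    - lineDeriv ℝ (fun z => coordMetric g e z u v) y w) / 2

/-- `γ` is a geodesic of `g` on the open set of times `s`: it is smooth there and satisfies
`c'' + Γ(c', c') = 0` (with the index lowered by `g`) in every chart, `c` being `γ` in that
chart. -/
def IsGeodesicOn (g : RMetric n M) (γ : ℝ → M) (s : Set ℝ) : Prop :=
  IsOpen s ∧ ContMDiffOn 𝓘(ℝ, ℝ) 𝓘(ℝ, E n) ∞ γ s ∧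
    ∀ t ∈ s, ∀ e ∈ smoothCharts n M, γ t ∈ e.source → ∀ w : E n,
      coordMetric g e (e (γ t)) (deriv (deriv (fun τ => e (γ τ))) t) w
        + christoffel g e (e (γ t)) (deriv (fun τ => e (γ τ)) t)
            (deriv (fun τ => e (γ τ)) t) w = 0

/-- `φ` is an exponential chart of `g` at `p` on the geodesic ball `B(p, r)`: its inverse is
`exp_p ∘ A` on the ball of radius `r` of `ℝⁿ`, where `A : ℝⁿ → T_pM` is a linear isometry
(namely the differential of the inverse of `φ` at `0`), i.e. `t ↦ φ⁻¹(t v)` is the geodesic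
from `p` of initial velocity `A v`. -/
structure IsExpChart (g : RMetric n M) (p : M) (r : ℝ)
    (φ : OpenPartialHomeomorph M (E n)) : Prop where
  mem_smoothCharts : φ ∈ smoothCharts n M
  mem_source : p ∈ φ.source
  map_center : φ p = 0
  target_eq : φ.target = Metric.ball 0 r
  isometry_zero : ∀ a b : E n, coordMetric g φ 0 a b = inner ℝ a b
  geodesic : ∀ v : E n,
    IsGeodesicOn g (fun t : ℝ => φ.symm (t • v)) {t : ℝ | t • v ∈ Metric.ball (0 : E n) r}

/-- The chart `e` is conformal: in it, the metric is a positive multiple of the Euclidean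
metric at each point. -/
def IsConformalChart (g : RMetric n M) (e : OpenPartialHomeomorph M (E n)) : Prop :=
  e ∈ smoothCharts n M ∧
    ∀ y ∈ e.target, ∃ c : ℝ, 0 < c ∧ ∀ a b : E n, coordMetric g e y a b = c * inner ℝ a b

/-- The metric is locally conformally flat. -/
def IsLocallyConformallyFlat (g : RMetric n M) : Prop :=
  ∀ x : M, ∃ e, IsConformalChart g e ∧ x ∈ e.source

end Riemannian

section Mobius

/-- The inversion of `ℝⁿ ∪ {∞}` in the sphere of centre `c` and radius `R`. -/
noncomputable def inversionExt {n : ℕ} (c : E n) (R : ℝ) (z : OnePoint (E n)) :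
    OnePoint (E n) :=
  open Classical in
  z.elim (c : OnePoint (E n))
    (fun x => if x = c then OnePoint.infty else (EuclideanGeometry.inversion c R x : E n))

/-- The Möbius transformations of `ℝⁿ ∪ {∞}`: the compositions of isometries of `ℝⁿ` and
of inversions in spheres. -/
inductive IsMobius {n : ℕ} : (OnePoint (E n) → OnePoint (E n)) → Prop
  | isometry (f : E n ≃ᵢ E n) : IsMobius (OnePoint.map f)
  | inversion (c : E n) (R : ℝ) (hR : 0 < R) : IsMobius (inversionExt c R)
  | comp {f g : OnePoint (E n) → OnePoint (E n)} :
      IsMobius f → IsMobius g → IsMobius (f ∘ g)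

/-- The change of charts from `e` to `e'` is, near each point, a Möbius transformation. -/
def MobiusCompatible {n : ℕ} {M : Type*} [TopologicalSpace M]
    (e e' : OpenPartialHomeomorph M (E n)) : Prop :=
  ∀ y ∈ (e.symm ≫ₕ e').source, ∃ m : OnePoint (E n) → OnePoint (E n), IsMobius m ∧
    ∀ᶠ z : E n in 𝓝 y, m (z : OnePoint (E n)) = (((e.symm ≫ₕ e') z : E n) : OnePoint (E n))

/-- An atlas of the smooth manifold `M` whose changes of charts are Möbius transformations. -/
structure IsMobiusAtlas {n : ℕ} {M : Type*} [TopologicalSpace M] [ChartedSpace (E n) M]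
    (A : Set (OpenPartialHomeomorph M (E n))) : Prop where
  subset : A ⊆ smoothCharts n M
  cover : ∀ x : M, ∃ e ∈ A, x ∈ e.source
  compatible : ∀ e ∈ A, ∀ e' ∈ A, MobiusCompatible e e'

end Mobius

section Orientation

/-- An oriented atlas of the smooth manifold `M`: the changes of charts have positive
Jacobian determinant. -/
structure IsOrientedAtlas {n : ℕ} {M : Type*} [TopologicalSpace M] [ChartedSpace (E n) M]
    (A : Set (OpenPartialHomeomorph M (E n))) : Prop where
  subset : A ⊆ smoothCharts n M
  cover : ∀ x : M, ∃ e ∈ A, x ∈ e.source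
  jacobian_pos : ∀ e ∈ A, ∀ e' ∈ A, ∀ y ∈ (e.symm ≫ₕ e').source,
    0 < (fderiv ℝ (e.symm ≫ₕ e') y).det

/-- The chart `φ` preserves the orientation defined by the oriented atlas `A`. -/
def PreservesOrientation {n : ℕ} {M : Type*} [TopologicalSpace M]
    (A : Set (OpenPartialHomeomorph M (E n))) (φ : OpenPartialHomeomorph M (E n)) : Prop :=
  ∀ e ∈ A, ∀ y ∈ (e.symm ≫ₕ φ).source, 0 < (fderiv ℝ (e.symm ≫ₕ φ) y).det

/-- The chart `φ` reverses the orientation defined by the oriented atlas `A`. -/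
def ReversesOrientation {n : ℕ} {M : Type*} [TopologicalSpace M]
    (A : Set (OpenPartialHomeomorph M (E n))) (φ : OpenPartialHomeomorph M (E n)) : Prop :=
  ∀ e ∈ A, ∀ y ∈ (e.symm ≫ₕ φ).source, (fderiv ℝ (e.symm ≫ₕ φ) y).det < 0

end Orientation

section Sum

variable {n : ℕ} {M N : Type*} [TopologicalSpace M] [TopologicalSpace N]

/-- The open ball `B(p, r)`, for a chart `φ` centred at `p`. -/
def chartBall (φ : OpenPartialHomeomorph M (E n)) (r : ℝ) : Set M :=
  {x | x ∈ φ.source ∧ ‖φ x‖ < r}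

/-- The closed ball of radius `r` about `p`, for a chart `φ` centred at `p`. -/
def chartClosedBall (φ : OpenPartialHomeomorph M (E n)) (r : ℝ) : Set M :=
  {x | x ∈ φ.source ∧ ‖φ x‖ ≤ r}

/-- The disjoint union of `M \ B(p, ε)` and `N \ B(q, ε)`. -/
abbrev PreSum (φ : OpenPartialHomeomorph M (E n)) (ψ : OpenPartialHomeomorph N (E n))
    (ε : ℝ) :=
  {x : M // x ∉ chartBall φ ε} ⊕ {y : N // y ∉ chartBall ψ ε}

/-- A point of the sphere of radius `ε` about `p` is identified with the point of the sphere of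
radius `ε` about `q` that has the same coordinates. -/
def GlueRel (φ : OpenPartialHomeomorph M (E n)) (ψ : OpenPartialHomeomorph N (E n))
    (ε : ℝ) (a b : PreSum φ ψ ε) : Prop :=
  ∃ x y, a = Sum.inl x ∧ b = Sum.inr y ∧ x.1 ∈ φ.source ∧ y.1 ∈ ψ.source ∧
    ‖φ x.1‖ = ε ∧ φ x.1 = ψ y.1

/-- The connected sum `M ♯ N`, as the quotient topological space of the disjoint union by the
equivalence relation generated by the identification of the two boundary spheres. -/
def ConnSum (φ : OpenPartialHomeomorph M (E n)) (ψ : OpenPartialHomeomorph N (E n))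
    (ε : ℝ) :=
  Quot (GlueRel φ ψ ε)

instance (φ : OpenPartialHomeomorph M (E n)) (ψ : OpenPartialHomeomorph N (E n))
    (ε : ℝ) : TopologicalSpace (ConnSum φ ψ ε) :=
  inferInstanceAs (TopologicalSpace (Quot (GlueRel φ ψ ε)))

/-- The projection to the quotient. -/
def proj (φ : OpenPartialHomeomorph M (E n)) (ψ : OpenPartialHomeomorph N (E n)) (ε : ℝ) :
    PreSum φ ψ ε → ConnSum φ ψ ε :=
  Quot.mk _

/-- The two half-open annuli `B(p, 2ε) \ B(p, ε)` and `B(q, 2ε) \ B(q, ε)`. -/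
def annuli (φ : OpenPartialHomeomorph M (E n)) (ψ : OpenPartialHomeomorph N (E n)) (ε : ℝ) :
    Set (PreSum φ ψ ε) :=
  {a | Sum.elim (fun x => x.1 ∈ chartBall φ (2 * ε)) (fun y => y.1 ∈ chartBall ψ (2 * ε)) a}

/-- The gluing map before passing to the quotient. With the rescaled charts `i₁ = φ / ε` and
`i₂ = ψ / ε` it is `i₁` on the first annulus and `i₂ / |i₂|²` on the second one. -/
noncomputable def preGlue (φ : OpenPartialHomeomorph M (E n))
    (ψ : OpenPartialHomeomorph N (E n)) (ε : ℝ) : PreSum φ ψ ε → E n :=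
  Sum.elim (fun x => ε⁻¹ • φ x.1)
    (fun y => (‖ε⁻¹ • ψ y.1‖ ^ 2)⁻¹ • (ε⁻¹ • ψ y.1))

/-- The gluing maps of a connected sum carrying a smooth structure: the two inclusions are
diffeomorphisms onto open subsets, and the gluing map is a smooth chart. -/
structure GluingMaps [ChartedSpace (E n) M] [ChartedSpace (E n) N]
    (φ : OpenPartialHomeomorph M (E n)) (ψ : OpenPartialHomeomorph N (E n)) (ε : ℝ)
    [ChartedSpace (E n) (ConnSum φ ψ ε)] where
  /-- the inclusion of the complement of the closed ball about `p` -/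
  inM : OpenPartialHomeomorph M (ConnSum φ ψ ε)
  inM_source : inM.source = (chartClosedBall φ ε)ᶜ
  inM_apply : ∀ x : {x : M // x ∉ chartBall φ ε}, x.1 ∈ inM.source →
    inM x.1 = proj φ ψ ε (Sum.inl x)
  inM_smooth : ContMDiffOn 𝓘(ℝ, E n) 𝓘(ℝ, E n) ∞ inM inM.source
  inM_symm_smooth : ContMDiffOn 𝓘(ℝ, E n) 𝓘(ℝ, E n) ∞ inM.symm inM.target
  /-- the inclusion of the complement of the closed ball about `q` -/
  inN : OpenPartialHomeomorph N (ConnSum φ ψ ε)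
  inN_source : inN.source = (chartClosedBall ψ ε)ᶜ
  inN_apply : ∀ y : {y : N // y ∉ chartBall ψ ε}, y.1 ∈ inN.source →
    inN y.1 = proj φ ψ ε (Sum.inr y)
  inN_smooth : ContMDiffOn 𝓘(ℝ, E n) 𝓘(ℝ, E n) ∞ inN inN.source
  inN_symm_smooth : ContMDiffOn 𝓘(ℝ, E n) 𝓘(ℝ, E n) ∞ inN.symm inN.target
  /-- the gluing chart `Φ` -/
  glue : OpenPartialHomeomorph (ConnSum φ ψ ε) (E n)
  glue_source : glue.source = proj φ ψ ε '' annuli φ ψ ε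
  glue_apply : ∀ a ∈ annuli φ ψ ε, glue (proj φ ψ ε a) = preGlue φ ψ ε a
  glue_target : glue.target = {y : E n | 1 / 2 < ‖y‖ ∧ ‖y‖ < 2}
  glue_mem : glue ∈ smoothCharts n (ConnSum φ ψ ε)

variable [ChartedSpace (E n) M] [ChartedSpace (E n) N]
  {φ : OpenPartialHomeomorph M (E n)} {ψ : OpenPartialHomeomorph N (E n)} {ε : ℝ}
  [ChartedSpace (E n) (ConnSum φ ψ ε)]

/-- The charts of `M ♯ N` obtained from those of `A` on `M`, those of `B` on `N`, and the
gluing chart. -/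
def gluedAtlas (j : GluingMaps φ ψ ε) (A : Set (OpenPartialHomeomorph M (E n)))
    (B : Set (OpenPartialHomeomorph N (E n))) :
    Set (OpenPartialHomeomorph (ConnSum φ ψ ε) (E n)) :=
  (fun e => j.inM.symm ≫ₕ e) '' A ∪ (fun e => j.inN.symm ≫ₕ e) '' B ∪ {j.glue}

/-- A smooth partition of unity made of a function `χ₁` living on the part of `M`, a function
`χ₀` living on the gluing region, and a function `χ₂` living on the part of `N`. -/
structure IsCutoff (j : GluingMaps φ ψ ε) (χ₁ χ₀ χ₂ : ConnSum φ ψ ε → ℝ) : Prop where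
  smooth₁ : ContMDiff 𝓘(ℝ, E n) 𝓘(ℝ, ℝ) ∞ χ₁
  smooth₀ : ContMDiff 𝓘(ℝ, E n) 𝓘(ℝ, ℝ) ∞ χ₀
  smooth₂ : ContMDiff 𝓘(ℝ, E n) 𝓘(ℝ, ℝ) ∞ χ₂
  nonneg : ∀ z, 0 ≤ χ₁ z ∧ 0 ≤ χ₀ z ∧ 0 ≤ χ₂ z
  sum_eq_one : ∀ z, χ₁ z + χ₀ z + χ₂ z = 1
  support₁ : tsupport χ₁ ⊆ j.inM.target
  support₀ : tsupport χ₀ ⊆ j.glue.source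
  support₂ : tsupport χ₂ ⊆ j.inN.target

variable [IsManifold 𝓘(ℝ, E n) ∞ M] [IsManifold 𝓘(ℝ, E n) ∞ N]
  [IsManifold 𝓘(ℝ, E n) ∞ (ConnSum φ ψ ε)]

/-- `g = χ₁ g_M + χ₀ Φ^*(δ) + χ₂ g_N`, where `δ` is the Euclidean metric, `Φ` the gluing chart,
and `g_M`, `g_N` are transported to `M ♯ N` by the inclusions. -/
def IsGluedMetric (gM : RMetric n M) (gN : RMetric n N) (j : GluingMaps φ ψ ε)
    (χ₁ χ₀ χ₂ : ConnSum φ ψ ε → ℝ) (g : RMetric n (ConnSum φ ψ ε)) : Prop :=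
  ∀ (z : ConnSum φ ψ ε) (v w : TangentSpace 𝓘(ℝ, E n) z),
    g.inner z v w =
      χ₁ z * gM.inner (j.inM.symm z) (mfderiv 𝓘(ℝ, E n) 𝓘(ℝ, E n) j.inM.symm z v)
          (mfderiv 𝓘(ℝ, E n) 𝓘(ℝ, E n) j.inM.symm z w)
      + χ₀ z * inner (E := E n) ℝ (mfderiv 𝓘(ℝ, E n) 𝓘(ℝ, E n) j.glue z v)
          (mfderiv 𝓘(ℝ, E n) 𝓘(ℝ, E n) j.glue z w)
      + χ₂ z * gN.inner (j.inN.symm z) (mfderiv 𝓘(ℝ, E n) 𝓘(ℝ, E n) j.inN.symm z v)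
          (mfderiv 𝓘(ℝ, E n) 𝓘(ℝ, E n) j.inN.symm z w)

/-- `g` coincides with `g_M` and `g_N` outside the domains `B(p, 2ε)` and `B(q, 2ε)` of the
charts used in the gluing. -/
def AgreesOutside (gM : RMetric n M) (gN : RMetric n N) (j : GluingMaps φ ψ ε)
    (g : RMetric n (ConnSum φ ψ ε)) : Prop :=
  (∀ x : M, x ∉ φ.source → ∀ v w : TangentSpace 𝓘(ℝ, E n) x,
    g.inner (j.inM x) (mfderiv 𝓘(ℝ, E n) 𝓘(ℝ, E n) j.inM x v)
      (mfderiv 𝓘(ℝ, E n) 𝓘(ℝ, E n) j.inM x w) = gM.inner x v w) ∧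
  (∀ y : N, y ∉ ψ.source → ∀ v w : TangentSpace 𝓘(ℝ, E n) y,
    g.inner (j.inN y) (mfderiv 𝓘(ℝ, E n) 𝓘(ℝ, E n) j.inN y v)
      (mfderiv 𝓘(ℝ, E n) 𝓘(ℝ, E n) j.inN y w) = gN.inner y v w)

end Sum

end ConnectedSum

/-! The topology of the sum is governed by one function. `height` is the signed distance to the neck
sphere, measured in the coordinates of the two charts. It is continuous because a closed coordinate
ball smaller than the chart is compact, hence closed in the Hausdorff manifold. The sets where it is
positive, negative, or of absolute value less than `ε` are open and cover the sum; `leftIncl`,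
`rightIncl` and `glueChart` identify them with open subsets of `M`, `N` and `ℝⁿ`. The Hausdorff
property and second countability follow. Read on `M`, the gluing chart is `φ / ε` (`outerChart`);
read on `N`, it is `ψ / ε` followed by the inversion in the unit sphere (`innerChart`). Both are
smooth charts, so all changes of charts are smooth.

The inversion has negative Jacobian, which cancels the reversal of orientation by `ψ`
(`isOrientedAtlas_gluedAtlas`). It is also conformal and Möbius. Hence, if `φ` and `ψ` are
conformal, the metrics being averaged are proportional at each point, and their convex combination
stays in the same conformal class (`IsGluedMetric.isConformalChart`).

The harder point is that an exponential chart need not be conformal away from its centre. At the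
centre it is an isometry of tangent spaces, so for a conformal chart `e` around `p` the map `e ∘
φ⁻¹` becomes, after a similarity, a germ `k` tangent to the identity at the origin. Such a germ
extends to a diffeomorphism `K` of `ℝⁿ` that is the identity outside a small ball. Let `S` be a
diffeomorphism that dilates the ball of radius `a` by `s > 1` and is the identity far away. For
large `j`, the map `f = (S ^ j * K)⁻¹` satisfies `s ^ j • k (f y) = y` on the whole ball of radius
`a`, not only near the origin (`exists_isDiffeo_linearizing`).

Transplanted to `M`, this gives a diffeomorphism `F`, the identity near every point outside the
domain of `φ`, such that `φ` is a similarity of `e ∘ F` on the ball of radius `a`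
(`exists_linearizing_diffeo`). For the metric `F^*g_M` the chart `φ` is therefore conformal on that
ball. With `a = 5ε/4`, and with a middle cutoff function supported within `ε/4` of the neck, the
deformed metrics of the two summands glue conformally (`exists_conformal_gluing`). The charts `k ∘
F` on `M`, their analogues on `N`, and the gluing chart restricted to the thin neck form the Möbius
atlas (`exists_isMobiusAtlas`). -/

namespace ConnectedSum

/-! ### Smooth fields of bilinear forms and Riemannian metrics -/

section Forms

variable {n : ℕ} {X M : Type*} [TopologicalSpace X] [ChartedSpace (E n) X]
  [TopologicalSpace M] [ChartedSpace (E n) M]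

/-- A field of bilinear forms on the tangent spaces, all of which are identified with `ℝⁿ`. -/
abbrev FormField (n : ℕ) (X : Type*) := X → E n →L[ℝ] E n →L[ℝ] ℝ

/-- The derivative of a map between `n`-manifolds, as an endomorphism of `ℝⁿ`. -/
noncomputable def tderiv (f : X → M) (x : X) : E n →L[ℝ] E n :=
  mfderiv 𝓘(ℝ, E n) 𝓘(ℝ, E n) f x

/-- The pullback of a field of bilinear forms. -/
noncomputable def pullForm (f : X → M) (G : FormField n M) : FormField n X := fun x =>
  (G (f x)).bilinearComp (tderiv f x) (tderiv f x)

variable [IsManifold 𝓘(ℝ, E n) ∞ X] [IsManifold 𝓘(ℝ, E n) ∞ M]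

/-- The inverse of the trivialization of the tangent bundle at `x₀`. -/
noncomputable def trivSymm (x₀ x : X) : E n →L[ℝ] E n :=
  (trivializationAt (E n) (TangentSpace 𝓘(ℝ, E n)) x₀).symmL ℝ x

/-- The form field in the trivialization at `x₀`. -/
noncomputable def formCoord (G : FormField n X) (x₀ x : X) : E n →L[ℝ] E n →L[ℝ] ℝ :=
  (G x).bilinearComp (trivSymm x₀ x) (trivSymm x₀ x)

/-- Smoothness of a field of bilinear forms at a point. -/
def SmoothFormAt (G : FormField n X) (x₀ : X) : Prop :=
  ContMDiffAt 𝓘(ℝ, E n) 𝓘(ℝ, E n →L[ℝ] E n →L[ℝ] ℝ) ∞ (formCoord G x₀) x₀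

/-- Over the domain of the chart at `x₀`, the bundle coordinates of `G` are `G` with the inverse
trivialization inserted in both arguments. Smoothness of a section thus reduces to smoothness of a
map into a fixed normed space, which is how sums, cutoffs and pullbacks are handled below. -/
theorem smoothFormAt_iff (G : FormField n X) (x₀ : X) :
    SmoothFormAt G x₀ ↔
      ContMDiffAt 𝓘(ℝ, E n) (𝓘(ℝ, E n).prod 𝓘(ℝ, E n →L[ℝ] E n →L[ℝ] ℝ)) ∞
        (fun x => Bundle.TotalSpace.mk' (E n →L[ℝ] E n →L[ℝ] ℝ)
          (E := fun x : X => TangentSpace 𝓘(ℝ, E n) x →L[ℝ] TangentSpace 𝓘(ℝ, E n) x →L[ℝ] ℝ)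
          x (G x)) x₀ := by
  rw [contMDiffAt_hom_bundle]
  have key : (fun x => ContinuousLinearMap.inCoordinates (E n)
      (fun x : X => TangentSpace 𝓘(ℝ, E n) x) (E n →L[ℝ] ℝ)
      (fun x : X => TangentSpace 𝓘(ℝ, E n) x →L[ℝ] ℝ) x₀ x x₀ x (G x)) =ᶠ[𝓝 x₀]
      formCoord G x₀ := by
    filter_upwards [(chartAt (E n) x₀).open_source.mem_nhds (mem_chart_source _ x₀)] with x hx
    have hx' : x ∈ (trivializationAt (E n)
      (fun x : X => TangentSpace 𝓘(ℝ, E n) x) x₀).baseSet := by simpa using hx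
    refine ContinuousLinearMap.ext fun a => ContinuousLinearMap.ext fun b => ?_
    have := inCoordinates_apply_eq₂ (F₁ := E n) (F₂ := E n) (F₃ := ℝ)
      (E₁ := fun x : X => TangentSpace 𝓘(ℝ, E n) x)
      (E₂ := fun x : X => TangentSpace 𝓘(ℝ, E n) x)
      (E₃ := fun _ : X => ℝ) (x₀ := x₀) (x := x) (ϕ := G x) (v := a) (w := b) hx' hx'
      (Set.mem_univ _)
    simp only [Bundle.Trivial.fiberBundle_trivializationAt',
      Bundle.Trivial.linearMapAt_trivialization, LinearMap.id_coe, id_eq,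
      ← Bundle.Trivialization.symmL_apply (R := ℝ) _ hx'] at this
    exact this
  constructor
  · exact fun h => ⟨contMDiffAt_id, h.congr_of_eventuallyEq key⟩
  · exact fun h => h.2.congr_of_eventuallyEq key.symm

theorem SmoothFormAt.congr {G G' : FormField n X} {x₀ : X} (h : SmoothFormAt G x₀)
    (hG : ∀ᶠ x in 𝓝 x₀, G' x = G x) : SmoothFormAt G' x₀ := by
  refine ContMDiffAt.congr_of_eventuallyEq h ?_
  filter_upwards [hG] with x hx
  rw [formCoord, formCoord, hx]

theorem SmoothFormAt.add {G G' : FormField n X} {x₀ : X} (h : SmoothFormAt G x₀)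
    (h' : SmoothFormAt G' x₀) : SmoothFormAt (fun x => G x + G' x) x₀ :=
  (ContMDiffAt.add h h').congr_of_eventuallyEq <| .of_forall fun x => by
    ext a b; simp [formCoord]

theorem SmoothFormAt.smul {G : FormField n X} {χ : X → ℝ} {x₀ : X} (h : SmoothFormAt G x₀)
    (hχ : ContMDiffAt 𝓘(ℝ, E n) 𝓘(ℝ, ℝ) ∞ χ x₀) : SmoothFormAt (fun x => χ x • G x) x₀ := by
  have h' : ContMDiffAt 𝓘(ℝ, E n) 𝓘(ℝ, E n →L[ℝ] E n →L[ℝ] ℝ) ∞ (formCoord G x₀) x₀ := h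
  have h2 : ContMDiffAt 𝓘(ℝ, E n) 𝓘(ℝ, E n →L[ℝ] E n →L[ℝ] ℝ) ∞
      (fun x => χ x • formCoord G x₀ x) x₀ := hχ.smul h'
  refine ContMDiffAt.congr_of_eventuallyEq h2 (.of_forall fun x => ?_)
  ext a b
  simp [formCoord]

theorem smoothFormAt_zero (x₀ : X) : SmoothFormAt (n := n) (fun _ : X => 0) x₀ :=
  (contMDiffAt_const (c := 0)).congr_of_eventuallyEq <| .of_forall fun x => by
    ext a b; simp [formCoord]

/-- A cutoff times a form that is smooth on a neighbourhood of its support is smooth. -/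
theorem SmoothFormAt.cutoff {G : FormField n X} {χ : X → ℝ} {U : Set X}
    (h : ∀ x ∈ U, SmoothFormAt G x) (hχ : ContMDiff 𝓘(ℝ, E n) 𝓘(ℝ, ℝ) ∞ χ)
    (hs : tsupport χ ⊆ U) (x : X) : SmoothFormAt (fun x => χ x • G x) x := by
  by_cases hx : x ∈ tsupport χ
  · exact (h x (hs hx)).smul hχ.contMDiffAt
  · refine (smoothFormAt_zero x).congr ?_
    filter_upwards [(isClosed_tsupport χ).isOpen_compl.mem_nhds hx] with y hy
    ext a b
    simp [image_eq_zero_of_notMem_tsupport hy]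

/-- In finite dimension, smoothness of an operator-valued map can be tested on vectors, and there
only evaluations remain. -/
theorem contDiff_bilinearComp_diag : ContDiff ℝ ∞
    (fun q : (E n →L[ℝ] E n →L[ℝ] ℝ) × (E n →L[ℝ] E n) => q.1.bilinearComp q.2 q.2) := by
  rw [contDiff_clm_apply_iff]
  intro a
  rw [contDiff_clm_apply_iff]
  intro b
  simp only [ContinuousLinearMap.bilinearComp_apply]
  fun_prop

/-- `inTangentCoordinates` is the derivative between two trivializations; the inverse trivialization
of the target cancels the one applied last. -/
theorem trivSymm_inTangentCoordinates {f : X → M} {x₀ x : X}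
    (hfx : f x ∈ (chartAt (E n) (f x₀)).source) :
    trivSymm (f x₀) (f x) ∘L (inTangentCoordinates 𝓘(ℝ, E n) 𝓘(ℝ, E n) id f
      (mfderiv 𝓘(ℝ, E n) 𝓘(ℝ, E n) f) x₀ x) = tderiv f x ∘L trivSymm x₀ x := by
  have hfx' : f x ∈ (trivializationAt (E n)
      (fun x : M => TangentSpace 𝓘(ℝ, E n) x) (f x₀)).baseSet := by simpa using hfx
  refine ContinuousLinearMap.ext fun a => ?_
  exact Bundle.Trivialization.symmL_continuousLinearMapAt _ hfx' _

/-- In coordinates the pullback is a smooth expression in the coordinates of `G` along `f` and in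
the derivative of `f`, both of which are smooth. -/
theorem SmoothFormAt.pullForm {f : X → M} {G : FormField n M} {x₀ : X}
    (hf : ContMDiffAt 𝓘(ℝ, E n) 𝓘(ℝ, E n) ∞ f x₀) (hG : SmoothFormAt G (f x₀)) :
    SmoothFormAt (pullForm f G) x₀ := by
  have h1 := hf.mfderiv_const (m := ∞) (by simp)
  have h2 : ContMDiffAt 𝓘(ℝ, E n) 𝓘(ℝ, E n →L[ℝ] E n →L[ℝ] ℝ) ∞
    (fun x => formCoord G (f x₀) (f x)) x₀ := 
    ContMDiffAt.comp x₀ (g := formCoord G (f x₀)) hG hf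
  have h3 := ContMDiffAt.comp x₀ (contDiff_bilinearComp_diag (n := n)).contMDiff.contMDiffAt
    (h2.prodMk_space h1)
  refine ContMDiffAt.congr_of_eventuallyEq h3 ?_
  filter_upwards [hf.continuousAt.preimage_mem_nhds
      ((chartAt (E n) (f x₀)).open_source.mem_nhds (mem_chart_source _ (f x₀)))] with x hfx
  have key := trivSymm_inTangentCoordinates (n := n) hfx
  refine ContinuousLinearMap.ext fun a => ContinuousLinearMap.ext fun b => ?_
  exact congrArg₂ (fun u v => G (f x) u v) (DFunLike.congr_fun key a).symm
    (DFunLike.congr_fun key b).symm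

theorem smoothFormAt_const (B : E n →L[ℝ] E n →L[ℝ] ℝ) (y : E n) :
    SmoothFormAt (fun _ => B) y := by
  refine ContMDiffAt.congr_of_eventuallyEq (contMDiffAt_const (c := B)) (.of_forall fun x => ?_)
  have : trivSymm y x = ContinuousLinearMap.id ℝ (E n) := by
    simp only [trivSymm]
    exact TangentBundle.symmL_model_space (𝕜 := ℝ) y x
  ext a b
  simp [formCoord, this]

/-- The field of inner products of a Riemannian metric. -/
noncomputable def metricForm (g : RMetric n X) : FormField n X := g.inner

theorem metricForm_symm (g : RMetric n X) (x : X) (v w : E n) :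
    metricForm g x v w = metricForm g x w v := g.symm x v w

theorem metricForm_pos (g : RMetric n X) (x : X) {v : E n} (hv : v ≠ 0) :
    0 < metricForm g x v v := g.pos x v hv

theorem smoothFormAt_metricForm (g : RMetric n X) (x : X) : SmoothFormAt (metricForm g) x :=
  (smoothFormAt_iff _ _).2 g.contMDiff.contMDiffAt

/-- The constant is the minimum of the form on the unit sphere, which is compact; homogeneity does
the rest. -/
theorem exists_forall_mul_sq_norm_le (B : E n →L[ℝ] E n →L[ℝ] ℝ) (hp : ∀ v, v ≠ 0 → 0 < B v v) :
    ∃ c > 0, ∀ v : E n, c * ‖v‖ ^ 2 ≤ B v v := by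
  have hc : Continuous fun v : E n => B v v := by fun_prop
  rcases (Metric.sphere (0 : E n) 1).eq_empty_or_nonempty with he | hne
  -- The sphere is empty only when the space is zero, and then any constant serves.
  · refine ⟨1, one_pos, fun v => ?_⟩
    by_cases hv : v = 0
    · simp [hv]
    · exfalso
      have : (‖v‖⁻¹ • v) ∈ Metric.sphere (0 : E n) 1 := by
        simp [norm_smul, inv_mul_cancel₀ (norm_ne_zero_iff.2 hv)]
      rw [he] at this
      exact this
  · obtain ⟨u, hu, hmin⟩ := (isCompact_sphere (0 : E n) 1).exists_isMinOn hne hc.continuousOn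
    have hu0 : u ≠ 0 := by
      rintro rfl
      simp at hu
    refine ⟨B u u, hp u hu0, fun v => ?_⟩
    by_cases hv : v = 0
    · simp [hv]
    · have hv' := norm_ne_zero_iff.2 hv
      have h1 : (‖v‖⁻¹ • v) ∈ Metric.sphere (0 : E n) 1 := by
        simp [norm_smul, inv_mul_cancel₀ hv']
      have h2 : B u u ≤ B (‖v‖⁻¹ • v) (‖v‖⁻¹ • v) := hmin h1
      simp only [map_smul, smul_apply, smul_eq_mul] at h2
      have hpos : 0 < ‖v‖ ^ 2 := by positivity
      calc B u u * ‖v‖ ^ 2 ≤ (‖v‖⁻¹ * (‖v‖⁻¹ * B v v)) * ‖v‖ ^ 2 := by gcongr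
        _ = B v v := by field_simp

theorem isVonNBounded_of_posDef (B : E n →L[ℝ] E n →L[ℝ] ℝ) (hp : ∀ v, v ≠ 0 → 0 < B v v) :
    Bornology.IsVonNBounded ℝ {v : E n | B v v < 1} := by
  rw [NormedSpace.isVonNBounded_iff]
  obtain ⟨c, hc0, hc⟩ := exists_forall_mul_sq_norm_le B hp
  -- This bound avoids a square root: if `‖v‖ > 1`, then `‖v‖ ≤ ‖v‖ ^ 2 ≤ c⁻¹`.
  refine isBounded_iff_forall_norm_le.2 ⟨max 1 c⁻¹, fun v hv => ?_⟩
  have h1 := hc v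
  have hv : B v v < 1 := hv
  by_cases h : ‖v‖ ≤ 1
  · exact le_max_of_le_left h
  · refine le_max_of_le_right ?_
    have h2 : ‖v‖ ^ 2 ≤ c⁻¹ := by
      rw [← div_eq_inv_mul 1 c |>.trans (mul_one _) , le_div_iff₀ hc0]
      linarith
    nlinarith

/-- A smooth field of symmetric positive definite forms is a Riemannian metric. -/
noncomputable def metricOfForm (G : FormField n X) (hs : ∀ x v w, G x v w = G x w v)
    (hp : ∀ x v, v ≠ 0 → 0 < G x v v) (hG : ∀ x, SmoothFormAt G x) : RMetric n X where
  inner := G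
  symm := hs
  pos := hp
  isVonNBounded x := isVonNBounded_of_posDef (G x) (hp x)
  contMDiff x := (smoothFormAt_iff G x).1 (hG x)

end Forms

/-! ### Changes of charts, derivatives of diffeomorphisms, signs of Jacobians -/

/-- Quantification over the domain of a change of charts, upstairs. -/
theorem forall_mem_transition_source {n : ℕ} {X : Type*} [TopologicalSpace X]
    {e e' : OpenPartialHomeomorph X (E n)}
    {P : E n → Prop} :
    (∀ y ∈ (e.symm ≫ₕ e').source, P y) ↔ ∀ x ∈ e.source, x ∈ e'.source → P (e x) := by
  constructor
  · intro h x hx hx'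
    exact h _ (by simp [e.map_source hx, e.left_inv hx, hx'])
  · intro h y hy
    simp only [OpenPartialHomeomorph.trans_source, OpenPartialHomeomorph.symm_source,
      Set.mem_inter_iff, Set.mem_preimage] at hy
    have := h _ (e.map_target hy.1) hy.2
    rwa [e.right_inv hy.1] at this

section SmoothIso

variable {n : ℕ} {X M Y : Type*} [TopologicalSpace X] [ChartedSpace (E n) X]
  [TopologicalSpace M] [ChartedSpace (E n) M] [TopologicalSpace Y] [ChartedSpace (E n) Y]

/-- A partial homeomorphism that is a diffeomorphism between open subsets. -/
structure SmoothIso (f : OpenPartialHomeomorph X M) : Prop where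
  smooth : ContMDiffOn 𝓘(ℝ, E n) 𝓘(ℝ, E n) ∞ f f.source
  smooth_symm : ContMDiffOn 𝓘(ℝ, E n) 𝓘(ℝ, E n) ∞ f.symm f.target

theorem SmoothIso.symm {f : OpenPartialHomeomorph X M} (hf : SmoothIso (n := n) f) :
    SmoothIso (n := n) f.symm := ⟨hf.2, hf.1⟩

theorem SmoothIso.trans {f : OpenPartialHomeomorph X M} {h : OpenPartialHomeomorph M Y}
    (hf : SmoothIso (n := n) f) (hh : SmoothIso (n := n) h) : SmoothIso (n := n) (f ≫ₕ h) where
  smooth := hh.smooth.comp' hf.smooth |>.mono (by simp)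
  smooth_symm := hf.smooth_symm.comp' hh.smooth_symm |>.mono (by simp)

theorem SmoothIso.contMDiffAt {f : OpenPartialHomeomorph X M} (hf : SmoothIso (n := n) f) {x : X}
    (hx : x ∈ f.source) : ContMDiffAt 𝓘(ℝ, E n) 𝓘(ℝ, E n) ∞ f x :=
  hf.smooth.contMDiffAt (f.open_source.mem_nhds hx)

theorem SmoothIso.mdifferentiableAt {f : OpenPartialHomeomorph X M} (hf : SmoothIso (n := n) f)
    {x : X} (hx : x ∈ f.source) : MDifferentiableAt 𝓘(ℝ, E n) 𝓘(ℝ, E n) f x :=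
  (hf.contMDiffAt hx).mdifferentiableAt (by simp)

theorem SmoothIso.restr {f : OpenPartialHomeomorph X M} (hf : SmoothIso (n := n) f) (s : Set X) :
    SmoothIso (n := n) (f.restr s) where
  smooth := hf.smooth.mono (by
    rw [f.restr_source]; exact Set.inter_subset_left)
  smooth_symm := hf.smooth_symm.mono (by
    rw [OpenPartialHomeomorph.restr_target]; exact Set.inter_subset_left)

theorem mem_smoothCharts_iff [IsManifold 𝓘(ℝ, E n) ∞ X] {e : OpenPartialHomeomorph X (E n)} :
    e ∈ smoothCharts n X ↔ SmoothIso (n := n) e := by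
  rw [IsManifold.mem_maximalAtlas_iff_contMDiffOn]
  exact ⟨fun h => ⟨h.1, h.2⟩, fun h => ⟨h.1, h.2⟩⟩

theorem tderiv_comp {f : X → M} {h : M → Y} {x : X}
    (hh : MDifferentiableAt 𝓘(ℝ, E n) 𝓘(ℝ, E n) h (f x))
    (hf : MDifferentiableAt 𝓘(ℝ, E n) 𝓘(ℝ, E n) f x) :
    tderiv (n := n) (fun x => h (f x)) x = tderiv h (f x) ∘L tderiv f x :=
  mfderiv_comp x hh hf

theorem tderiv_congr {f h : X → M} {x : X} (hfh : f =ᶠ[𝓝 x] h) :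
    tderiv (n := n) f x = tderiv h x :=
  hfh.mfderiv_eq

theorem tderiv_eq_fderiv (f : E n → E n) (y : E n) : tderiv f y = fderiv ℝ f y :=
  mfderiv_eq_fderiv

theorem tderiv_id (x : X) : tderiv (n := n) (fun x : X => x) x = ContinuousLinearMap.id ℝ (E n) :=
  mfderiv_id

theorem SmoothIso.tderiv_symm_comp {f : OpenPartialHomeomorph X M} (hf : SmoothIso (n := n) f)
    {x : X} (hx : x ∈ f.source) :
    tderiv f.symm (f x) ∘L tderiv f x = ContinuousLinearMap.id ℝ (E n) := by
  rw [← tderiv_comp (hf.symm.mdifferentiableAt (f.map_source hx)) (hf.mdifferentiableAt hx),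
    ← tderiv_id x]
  refine tderiv_congr ?_
  filter_upwards [f.open_source.mem_nhds hx] with y hy using f.left_inv hy

theorem SmoothIso.tderiv_comp_symm {f : OpenPartialHomeomorph X M} (hf : SmoothIso (n := n) f)
    {x : X} (hx : x ∈ f.source) :
    tderiv f x ∘L tderiv f.symm (f x) = ContinuousLinearMap.id ℝ (E n) := by
  have := hf.symm.tderiv_symm_comp (f.map_source hx)
  simpa [f.left_inv hx] using this

theorem SmoothIso.tderiv_symm_apply {f : OpenPartialHomeomorph X M} (hf : SmoothIso (n := n) f)
    {x : X} (hx : x ∈ f.source) (v : E n) : tderiv f.symm (f x) (tderiv f x v) = v :=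
  DFunLike.congr_fun (hf.tderiv_symm_comp hx) v

theorem SmoothIso.tderiv_apply_symm {f : OpenPartialHomeomorph X M} (hf : SmoothIso (n := n) f)
    {x : X} (hx : x ∈ f.source) (v : E n) : tderiv f x (tderiv f.symm (f x) v) = v :=
  DFunLike.congr_fun (hf.tderiv_comp_symm hx) v

theorem SmoothIso.tderiv_ne_zero {f : OpenPartialHomeomorph X M} (hf : SmoothIso (n := n) f)
    {x : X} (hx : x ∈ f.source) {v : E n} (hv : v ≠ 0) : tderiv f x v ≠ 0 := fun h =>
  hv (by rw [← hf.tderiv_symm_apply hx v, h, map_zero])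

theorem det_comp (A B : E n →L[ℝ] E n) : (A ∘L B).det = A.det * B.det := by
  simp only [ContinuousLinearMap.det, ContinuousLinearMap.toLinearMap_comp]
  exact LinearMap.det_comp _ _

theorem SmoothIso.det_symm_mul {f : OpenPartialHomeomorph X M} (hf : SmoothIso (n := n) f)
    {x : X} (hx : x ∈ f.source) : 
    (tderiv (n := n) f.symm (f x)).det * (tderiv (n := n) f x).det = 1 := by
  rw [← det_comp, hf.tderiv_symm_comp hx]
  simp [ContinuousLinearMap.det]

theorem SmoothIso.det_ne_zero {f : OpenPartialHomeomorph X M} (hf : SmoothIso (n := n) f)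
    {x : X} (hx : x ∈ f.source) : (tderiv (n := n) f x).det ≠ 0 :=
  right_ne_zero_of_mul_eq_one (hf.det_symm_mul hx)

/-- The sign of the Jacobian of a change of charts. -/
theorem det_fderiv_transition {e e' : OpenPartialHomeomorph X (E n)} (he : SmoothIso (n := n) e)
    (he' : SmoothIso (n := n) e') {x : X} (hx : x ∈ e.source) (hx' : x ∈ e'.source) :
    (fderiv ℝ (e.symm ≫ₕ e') (e x)).det * (tderiv (n := n) e x).det ^ 2 =
      (tderiv (n := n) e x).det * (tderiv (n := n) e' x).det := by
  have h1 : tderiv (n := n) (e.symm ≫ₕ e') (e x) = tderiv e' x ∘L tderiv e.symm (e x) := by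
    have := tderiv_comp (n := n) (f := e.symm) (h := e') (x := e x)
      (he'.mdifferentiableAt (by rwa [e.left_inv hx]))
      (he.symm.mdifferentiableAt (e.map_source hx))
    rw [e.left_inv hx] at this
    exact this
  rw [← tderiv_eq_fderiv, h1, det_comp, sq]
  have := he.det_symm_mul hx
  linear_combination ((tderiv (n := n) e x).det * (tderiv (n := n) e' x).det) * this

/-- The Jacobian, multiplied by the positive square of `det (de)`, is the product of the Jacobians
of the two charts. The resulting condition lives at a point of the manifold and is symmetric in the
charts. -/
theorem det_fderiv_transition_pos_iff {e e' : OpenPartialHomeomorph X (E n)}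
    (he : SmoothIso (n := n) e) (he' : SmoothIso (n := n) e') {x : X} (hx : x ∈ e.source)
    (hx' : x ∈ e'.source) : 0 < (fderiv ℝ (e.symm ≫ₕ e') (e x)).det ↔
      0 < (tderiv (n := n) e x).det * (tderiv (n := n) e' x).det := by
  rw [← det_fderiv_transition he he' hx hx',
    mul_pos_iff_of_pos_right (by have := he.det_ne_zero hx; positivity)]

theorem det_fderiv_transition_neg_iff {e e' : OpenPartialHomeomorph X (E n)}
    (he : SmoothIso (n := n) e) (he' : SmoothIso (n := n) e') {x : X} (hx : x ∈ e.source)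
    (hx' : x ∈ e'.source) : (fderiv ℝ (e.symm ≫ₕ e') (e x)).det < 0 ↔
      (tderiv (n := n) e x).det * (tderiv (n := n) e' x).det < 0 := by
  have h := pow_pos (abs_pos.2 (he.det_ne_zero hx)) 2
  rw [sq_abs] at h
  rw [← det_fderiv_transition he he' hx hx', mul_neg_iff]
  constructor
  · exact fun h' => .inr ⟨h', h⟩
  · rintro (h' | h')
    · exact absurd h'.2 h.not_gt
    · exact h'.1

end SmoothIso

/-! ### Conformality at a point of the manifold -/

section Conformal

variable {n : ℕ} {X M : Type*} [TopologicalSpace X] [ChartedSpace (E n) X]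
  [TopologicalSpace M] [ChartedSpace (E n) M]

/-- The form `G` at `x` is a positive multiple of the Euclidean form read in the chart `e`. -/
def ConformalAt (G : FormField n X) (e : X → E n) (x : X) : Prop :=
  ∃ c : ℝ, 0 < c ∧ ∀ v w : E n, G x v w = c * inner ℝ (tderiv e x v) (tderiv e x w)

/-- The derivatives of the chart and of its inverse cancel, so conformality can be stated at points
of the manifold. Transport along maps is then only the chain rule. -/
theorem isConformalChart_iff [IsManifold 𝓘(ℝ, E n) ∞ X] {g : RMetric n X}
    {e : OpenPartialHomeomorph X (E n)} :
    IsConformalChart g e ↔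
      SmoothIso (n := n) e ∧ ∀ x ∈ e.source, ConformalAt (metricForm g) e x := by
  unfold IsConformalChart
  rw [mem_smoothCharts_iff]
  refine and_congr_right fun he => ?_
  constructor
  · intro h x hx
    obtain ⟨c, hc, hcc⟩ := h (e x) (e.map_source hx)
    refine ⟨c, hc, fun v w => ?_⟩
    rw [← hcc]
    change _ = metricForm g (e.symm (e x)) (tderiv e.symm (e x) (tderiv e x v))
      (tderiv e.symm (e x) (tderiv e x w))
    rw [he.tderiv_symm_apply hx, he.tderiv_symm_apply hx, e.left_inv hx]
  · intro h y hy
    obtain ⟨c, hc, hcc⟩ := h (e.symm y) (e.map_target hy)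
    refine ⟨c, hc, fun v w => ?_⟩
    have h1 : ∀ v, tderiv e (e.symm y) (tderiv e.symm y v) = v := fun v =>
      he.symm.tderiv_symm_apply hy v
    have := hcc (tderiv e.symm y v) (tderiv e.symm y w)
    rw [h1, h1] at this
    exact this

theorem ConformalAt.congr {G : FormField n X} {e e' : X → E n} {x : X} (h : ConformalAt G e x)
    (he : e' =ᶠ[𝓝 x] e) : ConformalAt G e' x := by
  obtain ⟨c, hc, h⟩ := h
  exact ⟨c, hc, by rw [tderiv_congr he]; exact h⟩

/-- The map `T` between open sets of `ℝⁿ` is conformal at `y`. -/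
def ConformalMapAt (T : E n → E n) (y : E n) : Prop :=
  ∃ c : ℝ, 0 < c ∧ ∀ a b : E n, inner ℝ (fderiv ℝ T y a) (fderiv ℝ T y b) = c * inner ℝ a b

theorem ConformalAt.comp {G : FormField n X} {e : X → E n} {T : E n → E n} {x : X}
    (h : ConformalAt G e x) (hT : ConformalMapAt T (e x))
    (hTd : DifferentiableAt ℝ T (e x)) (he : MDifferentiableAt 𝓘(ℝ, E n) 𝓘(ℝ, E n) e x) :
    ConformalAt G (fun x => T (e x)) x := by
  obtain ⟨c, hc, h⟩ := h
  obtain ⟨d, hd, hT⟩ := hT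
  refine ⟨c / d, by positivity, fun v w => ?_⟩
  rw [tderiv_comp hTd.mdifferentiableAt he, tderiv_eq_fderiv]
  simp only [ContinuousLinearMap.comp_apply]
  rw [hT, h]
  field_simp

theorem conformalAt_pullForm {G : FormField n M} {f : X → M} {e : M → E n} {x : X}
    (he : MDifferentiableAt 𝓘(ℝ, E n) 𝓘(ℝ, E n) e (f x))
    (hf : MDifferentiableAt 𝓘(ℝ, E n) 𝓘(ℝ, E n) f x) (h : ConformalAt G e (f x)) :
    ConformalAt (pullForm f G) (fun x => e (f x)) x := by
  obtain ⟨c, hc, h⟩ := h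
  refine ⟨c, hc, fun v w => ?_⟩
  rw [tderiv_comp he hf]
  simp [pullForm, h]

end Conformal

/-! ### Möbius equivalence of germs of charts -/

section MobiusAt

variable {n : ℕ} {X : Type*} [TopologicalSpace X]

/-- Near `x`, the map `e'` is the composition of `e` and a Möbius transformation. -/
def MobiusAt (e e' : X → E n) (x : X) : Prop :=
  ∃ m : OnePoint (E n) → OnePoint (E n), IsMobius m ∧
    ∀ᶠ z in 𝓝 x, m (e z : OnePoint (E n)) = (e' z : OnePoint (E n))

/-- The chart `e` matches neighbourhoods of `x` with neighbourhoods of `e x`. Upstairs, Möbius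
compatibility is an equivalence relation between germs at one point, so it can be composed without
tracking domains. -/
theorem mobiusCompatible_iff {e e' : OpenPartialHomeomorph X (E n)} :
    MobiusCompatible e e' ↔ ∀ x ∈ e.source, x ∈ e'.source → MobiusAt e e' x := by
  unfold MobiusCompatible
  rw [forall_mem_transition_source]
  refine forall₂_congr fun x hx => forall_congr' fun hx' => exists_congr fun m =>
    and_congr_right fun _ => ?_
  constructor
  · intro h
    filter_upwards [(e.continuousAt hx).eventually h, e.open_source.mem_nhds hx] with z hz hzs
    rw [hz]
    simp [e.left_inv hzs]
  · intro h
    have h1 : Filter.Tendsto e.symm (𝓝 (e x)) (𝓝 x) := by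
      have := e.continuousAt_symm (e.map_source hx)
      rwa [ContinuousAt, e.left_inv hx] at this
    filter_upwards [h1.eventually h, e.open_target.mem_nhds (e.map_source hx)] with z hz hzt
    rw [e.right_inv hzt] at hz
    simpa using hz

theorem isMobius_id : IsMobius (id : OnePoint (E n) → OnePoint (E n)) := by
  have := IsMobius.isometry (IsometryEquiv.refl (E n))
  convert this
  ext z
  induction z using OnePoint.rec <;> rfl

theorem inversionExt_coe (c : E n) (R : ℝ) (x : E n) (hx : x ≠ c) :
    inversionExt c R (x : OnePoint (E n)) = (EuclideanGeometry.inversion c R x : E n) := by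
  simp only [inversionExt, OnePoint.elim_some, if_neg hx]

theorem inversionExt_coe_self (c : E n) (R : ℝ) :
    inversionExt c R (c : OnePoint (E n)) = OnePoint.infty := by
  simp only [inversionExt, OnePoint.elim_some, if_true]

theorem inversionExt_infty (c : E n) (R : ℝ) :
    inversionExt c R OnePoint.infty = (c : OnePoint (E n)) := rfl

theorem inversionExt_inversionExt (c : E n) {R : ℝ} (hR : 0 < R) (z : OnePoint (E n)) :
    inversionExt c R (inversionExt c R z) = z := by
  induction z using OnePoint.rec with
  | infty => rw [inversionExt_infty, inversionExt_coe_self]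
  | coe x =>
    by_cases hx : x = c
    · rw [hx, inversionExt_coe_self, inversionExt_infty]
    · rw [inversionExt_coe c R x hx, inversionExt_coe,
        EuclideanGeometry.inversion_inversion c hR.ne']
      rwa [Ne, EuclideanGeometry.inversion_eq_center hR.ne']

/-- Isometries have isometries as inverses and inversions are involutions. A left inverse is all
that the symmetry of `MobiusAt` requires. -/
theorem IsMobius.exists_leftInverse {m : OnePoint (E n) → OnePoint (E n)} (hm : IsMobius m) :
    ∃ m', IsMobius m' ∧ ∀ z, m' (m z) = z := by
  induction hm with
  | isometry f =>
    refine ⟨_, IsMobius.isometry f.symm, fun z => ?_⟩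
    induction z using OnePoint.rec with
    | infty => rfl
    | coe x => simp
  | inversion c R hR => exact ⟨_, IsMobius.inversion c R hR, inversionExt_inversionExt c hR⟩
  | comp _ _ ihf ihg =>
    obtain ⟨f', hf', hf⟩ := ihf
    obtain ⟨g', hg', hg⟩ := ihg
    exact ⟨g' ∘ f', hg'.comp hf', fun z => by simp [hf, hg]⟩

theorem MobiusAt.refl (e : X → E n) (x : X) : MobiusAt e e x :=
  ⟨id, isMobius_id, .of_forall fun _ => rfl⟩

theorem MobiusAt.symm {e e' : X → E n} {x : X} (h : MobiusAt e e' x) : MobiusAt e' e x := by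
  obtain ⟨m, hm, h⟩ := h
  obtain ⟨m', hm', h'⟩ := hm.exists_leftInverse
  refine ⟨m', hm', ?_⟩
  filter_upwards [h] with z hz
  rw [← hz, h']

theorem MobiusAt.trans {e e' e'' : X → E n} {x : X} (h : MobiusAt e e' x)
    (h' : MobiusAt e' e'' x) : MobiusAt e e'' x := by
  obtain ⟨m, hm, h⟩ := h
  obtain ⟨m', hm', h'⟩ := h'
  refine ⟨m' ∘ m, hm'.comp hm, ?_⟩
  filter_upwards [h, h'] with z hz hz'
  rw [Function.comp_apply, hz, hz']

theorem MobiusAt.congr {e e₁ e' e₁' : X → E n} {x : X} (h : MobiusAt e e' x)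
    (h₁ : e₁ =ᶠ[𝓝 x] e) (h₁' : e₁' =ᶠ[𝓝 x] e') : MobiusAt e₁ e₁' x := by
  obtain ⟨m, hm, h⟩ := h
  refine ⟨m, hm, ?_⟩
  filter_upwards [h, h₁, h₁'] with z hz h1 h2
  rw [h1, h2, hz]

theorem MobiusAt.comp {Y : Type*} [TopologicalSpace Y] {e e' : Y → E n} {f : X → Y} {x : X}
    (h : MobiusAt e e' (f x)) (hf : ContinuousAt f x) :
    MobiusAt (fun z => e (f z)) (fun z => e' (f z)) x := by
  obtain ⟨m, hm, h⟩ := h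
  exact ⟨m, hm, hf.eventually h⟩

theorem inversion_zero_apply (R : ℝ) (y : E n) :
    EuclideanGeometry.inversion 0 R y = (R / ‖y‖) ^ 2 • y := by
  simp [EuclideanGeometry.inversion]

/-- The inversion of radius `1` followed by the concentric one of radius `√c` is the homothety of
ratio `c`; the origin passes through the point at infinity and comes back. -/
theorem isMobius_smul {c : ℝ} (hc : 0 < c) :
    ∃ m : OnePoint (E n) → OnePoint (E n), IsMobius m ∧
      ∀ y : E n, m y = ((c • y : E n) : OnePoint (E n)) := by
  refine ⟨_, (IsMobius.inversion 0 (√c) (by positivity)).comp (.inversion 0 1 one_pos),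
    fun y => ?_⟩
  rw [Function.comp_apply]
  by_cases hy : y = 0
  · rw [hy, inversionExt_coe_self, inversionExt_infty, smul_zero]
  · rw [inversionExt_coe _ _ _ hy, inversionExt_coe]
    · have h : ‖y‖ ≠ 0 := norm_ne_zero_iff.2 hy
      rw [inversion_zero_apply, inversion_zero_apply, smul_smul, norm_smul, Real.norm_of_nonneg
        (by positivity)]
      congr 2
      field_simp
      rw [Real.sq_sqrt hc.le]
    · rwa [Ne, EuclideanGeometry.inversion_eq_center one_ne_zero]

end MobiusAt

/-! ### Similarities and the unit inversion -/

section Similarity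

variable {n : ℕ}

/-- The similarity of `ℝⁿ` of ratio `c` and linear part `c A` that maps `y₀` to the origin. -/
noncomputable def simMap (c : ℝ) (A : E n ≃ₗᵢ[ℝ] E n) (y₀ : E n) (y : E n) : E n := c • A (y - y₀)

theorem mobiusAt_simMap {c : ℝ} (hc : 0 < c) (A : E n ≃ₗᵢ[ℝ] E n) (y₀ y : E n) :
    MobiusAt id (simMap c A y₀) y := by
  obtain ⟨m, hm, h⟩ := isMobius_smul (n := n) hc
  refine ⟨m ∘ OnePoint.map ((IsometryEquiv.subRight y₀).trans A.toIsometryEquiv),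
    hm.comp (.isometry _), .of_forall fun z => ?_⟩
  simp [h, simMap]

theorem contDiff_simMap (c : ℝ) (A : E n ≃ₗᵢ[ℝ] E n) (y₀ : E n) :
    ContDiff ℝ ∞ (simMap c A y₀) :=
  (A.contDiff.comp (contDiff_id.sub contDiff_const)).const_smul c

theorem conformalMapAt_simMap {c : ℝ} (hc : 0 < c) (A : E n ≃ₗᵢ[ℝ] E n) (y₀ y : E n) :
    ConformalMapAt (simMap c A y₀) y := by
  have h : HasFDerivAt (simMap c A y₀) (c • (A : E n →L[ℝ] E n)) y := by
    have h1 : HasFDerivAt (fun y => A (y - y₀)) ((A : E n →L[ℝ] E n) ∘L .id ℝ (E n)) y :=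
      (A : E n →L[ℝ] E n).hasFDerivAt.comp y ((hasFDerivAt_id y).sub_const y₀)
    exact h1.const_smul c
  refine ⟨c ^ 2, by positivity, fun a b => ?_⟩
  rw [h.fderiv]
  simp [inner_smul_left, inner_smul_right]
  ring

end Similarity

section Inversion

variable {n : ℕ}

/-- The homothety of ratio `c`. -/
noncomputable def scaleIso (n : ℕ) (c : ℝ) (hc : c ≠ 0) : OpenPartialHomeomorph (E n) (E n) :=
  (Homeomorph.smulOfNeZero c hc).toOpenPartialHomeomorph

theorem smoothIso_scaleIso (c : ℝ) (hc : c ≠ 0) : SmoothIso (n := n) (scaleIso n c hc) where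
  smooth := by
    refine ContMDiff.contMDiffOn (ContDiff.contMDiff ?_)
    exact contDiff_const_smul c
  smooth_symm := by
    refine ContMDiff.contMDiffOn (ContDiff.contMDiff ?_)
    exact contDiff_const_smul c⁻¹

/-- The inversion in the unit sphere. -/
noncomputable def invIso (n : ℕ) : OpenPartialHomeomorph (E n) (E n) where
  toFun := EuclideanGeometry.inversion 0 1
  invFun := EuclideanGeometry.inversion 0 1
  source := {0}ᶜ
  target := {0}ᶜ
  map_source' y hy := by
    simpa [EuclideanGeometry.inversion_eq_center one_ne_zero] using hy
  map_target' y hy := by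
    simpa [EuclideanGeometry.inversion_eq_center one_ne_zero] using hy
  left_inv' y _ := EuclideanGeometry.inversion_inversion 0 one_ne_zero y
  right_inv' y _ := EuclideanGeometry.inversion_inversion 0 one_ne_zero y
  open_source := isOpen_compl_singleton
  open_target := isOpen_compl_singleton
  continuousOn_toFun := ContinuousOn.inversion continuousOn_const continuousOn_const
    continuousOn_id (fun _ h => h)
  continuousOn_invFun := ContinuousOn.inversion continuousOn_const continuousOn_const
    continuousOn_id (fun _ h => h)

theorem invIso_apply (y : E n) : invIso n y = (‖y‖ ^ 2)⁻¹ • y := by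
  change EuclideanGeometry.inversion 0 1 y = _
  rw [inversion_zero_apply]
  simp

theorem contDiffOn_inversion :
    ContDiffOn ℝ ∞ (EuclideanGeometry.inversion (0 : E n) 1) {0}ᶜ :=
  ContDiffOn.inversion contDiffOn_const contDiffOn_const contDiffOn_id (fun _ h => h)

theorem smoothIso_invIso : SmoothIso (n := n) (invIso n) where
  smooth := contDiffOn_inversion.contMDiffOn
  smooth_symm := contDiffOn_inversion.contMDiffOn

theorem differentiableAt_invIso {y : E n} (hy : y ≠ 0) : DifferentiableAt ℝ (invIso n) y :=
  (EuclideanGeometry.hasFDerivAt_inversion (R := 1) hy).differentiableAt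

/-- The derivative at `y` is `‖y‖⁻²` times the reflection in the hyperplane orthogonal to `y`. -/
theorem conformalMapAt_invIso {y : E n} (hy : y ≠ 0) : ConformalMapAt (invIso n) y := by
  have h := EuclideanGeometry.hasFDerivAt_inversion (R := 1) hy
  have hy' : ‖y‖ ≠ 0 := norm_ne_zero_iff.2 hy
  refine ⟨((1 / dist y 0) ^ 2) ^ 2, by rw [dist_zero_right]; positivity, fun a b => ?_⟩
  have h' : fderiv ℝ (invIso n) y = _ := h.fderiv
  rw [h']
  simp [inner_smul_left, inner_smul_right]
  ring

/-- A hyperplane reflection has determinant `-1` and the scaling factor is positive. This sign is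
why `ψ` has to reverse the orientation. -/
theorem det_fderiv_invIso {y : E n} (hy : y ≠ 0) : (fderiv ℝ (invIso n) y).det < 0 := by
  have h := EuclideanGeometry.hasFDerivAt_inversion (R := 1) hy
  have hy' : ‖y‖ ≠ 0 := norm_ne_zero_iff.2 hy
  have h' : fderiv ℝ (invIso n) y = _ := h.fderiv
  have hd : LinearMap.det ((ℝ ∙ (y - 0))ᗮ.reflection.toLinearMap) = -1 := by
    rw [Submodule.det_reflection, Submodule.orthogonal_orthogonal, sub_zero,
      finrank_span_singleton hy, pow_one]
  rw [h', ContinuousLinearMap.det, ContinuousLinearMap.toLinearMap_smul, LinearMap.det_smul]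
  have : 0 < ((1 / dist y 0) ^ 2) ^ Module.finrank ℝ (E n) := by
    rw [dist_zero_right]; positivity
  have h2 := mul_neg_of_pos_of_neg this (show (-1 : ℝ) < 0 by norm_num)
  rw [← hd] at h2
  exact h2

theorem mobiusAt_invIso {y : E n} (hy : y ≠ 0) : MobiusAt id (invIso n) y := by
  refine ⟨_, .inversion 0 1 one_pos, ?_⟩
  filter_upwards [isOpen_compl_singleton.mem_nhds hy] with z hz
  exact inversionExt_coe 0 1 z hz

end Inversion

/-! ### The distance to the centre of a chart, extended to the whole manifold -/

section ChartNorm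

variable {n : ℕ} {M : Type*} [TopologicalSpace M]

/-- The norm of the coordinates in the chart `φ`, extended by the constant `r`. -/
noncomputable def chartNorm (φ : OpenPartialHomeomorph M (E n)) (r : ℝ) (x : M) : ℝ :=
  open Classical in if x ∈ φ.source then ‖φ x‖ else r

variable {φ : OpenPartialHomeomorph M (E n)} {r : ℝ}

theorem chartNorm_of_mem {x : M} (hx : x ∈ φ.source) : chartNorm φ r x = ‖φ x‖ := if_pos hx

theorem chartNorm_of_notMem {x : M} (hx : x ∉ φ.source) : chartNorm φ r x = r := if_neg hx

theorem norm_chart_lt (hφ : φ.target = Metric.ball 0 r) {x : M} (hx : x ∈ φ.source) :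
    ‖φ x‖ < r := by
  have := φ.map_source hx
  rwa [hφ, mem_ball_zero_iff] at this

theorem chartNorm_le (hφ : φ.target = Metric.ball 0 r) (x : M) : chartNorm φ r x ≤ r := by
  by_cases hx : x ∈ φ.source
  · rw [chartNorm_of_mem hx]; exact (norm_chart_lt hφ hx).le
  · rw [chartNorm_of_notMem hx]

theorem chartNorm_lt_iff {s : ℝ} (hs : s ≤ r) (x : M) :
    chartNorm φ r x < s ↔ x ∈ chartBall φ s := by
  by_cases hx : x ∈ φ.source
  · simp [chartNorm_of_mem hx, chartBall, hx]
  · simp [chartNorm_of_notMem hx, chartBall, hx, hs]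

theorem chartNorm_le_iff {s : ℝ} (hs : s < r) (x : M) :
    chartNorm φ r x ≤ s ↔ x ∈ chartClosedBall φ s := by
  by_cases hx : x ∈ φ.source
  · simp [chartNorm_of_mem hx, chartClosedBall, hx]
  · simp [chartNorm_of_notMem hx, chartClosedBall, hx, hs]

theorem chartBall_eq_source (hφ : φ.target = Metric.ball 0 r) : chartBall φ r = φ.source := by
  ext x
  exact ⟨fun h => h.1, fun h => ⟨h, norm_chart_lt hφ h⟩⟩

theorem isOpen_chartBall (φ : OpenPartialHomeomorph M (E n)) (s : ℝ) :
    IsOpen (chartBall φ s) := by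
  have : chartBall φ s = φ.source ∩ φ ⁻¹' (Metric.ball 0 s) := by
    ext x; simp [chartBall]
  rw [this]
  exact φ.isOpen_inter_preimage Metric.isOpen_ball

/-- The ball is the image of a compact ball of `ℝⁿ`, hence compact, hence closed in the Hausdorff
space `M`. So points outside the chart cannot be limits of points of smaller balls. -/
theorem isClosed_chartClosedBall [T2Space M] (hφ : φ.target = Metric.ball 0 r) {s : ℝ}
    (hs : s < r) : IsClosed (chartClosedBall φ s) := by
  have h : Metric.closedBall (0 : E n) s ⊆ φ.target := by
    rw [hφ]; exact Metric.closedBall_subset_ball hs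
  have : chartClosedBall φ s = φ.symm '' Metric.closedBall 0 s := by
    ext x
    constructor
    · exact fun hx => ⟨φ x, by simpa using hx.2, φ.left_inv hx.1⟩
    · rintro ⟨y, hy, rfl⟩
      refine ⟨φ.map_target (h hy), ?_⟩
      rw [φ.right_inv (h hy)]
      simpa using hy
  rw [this]
  exact ((isCompact_closedBall 0 s).image_of_continuousOn
    (φ.continuousOn_symm.mono h)).isClosed

/-- At a point outside the chart the value `r` is the maximum, which bounds nearby values from
above; closedness of the balls of radius `s < r` bounds them from below. -/
theorem continuous_chartNorm [T2Space M] (hφ : φ.target = Metric.ball 0 r) :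
    Continuous (chartNorm φ r) := by
  rw [continuous_iff_continuousAt]
  intro x
  by_cases hx : x ∈ φ.source
  · refine (φ.continuousAt hx).norm.congr ?_
    filter_upwards [φ.open_source.mem_nhds hx] with y hy
    rw [chartNorm_of_mem hy]
  · rw [ContinuousAt, chartNorm_of_notMem hx]
    refine tendsto_order.2 ⟨fun s hs => ?_, fun s hs => ?_⟩
    · filter_upwards [(isClosed_chartClosedBall hφ hs).isOpen_compl.mem_nhds
        (fun h : x ∈ chartClosedBall φ s => hx h.1)] with y hy
      rw [← not_le, chartNorm_le_iff hs]
      exact hy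
    · exact .of_forall fun y => (chartNorm_le hφ y).trans_lt hs

end ChartNorm

section InvIso

variable {n : ℕ}

theorem norm_invIso (y : E n) : ‖invIso n y‖ = ‖y‖⁻¹ := by
  by_cases hy : y = 0
  · simp [invIso_apply, hy]
  have := norm_ne_zero_iff.2 hy
  rw [invIso_apply, norm_smul, Real.norm_of_nonneg (by positivity)]
  field_simp

theorem invIso_invIso (y : E n) : invIso n (invIso n y) = y :=
  EuclideanGeometry.inversion_inversion 0 one_ne_zero y

theorem invIso_of_norm_eq_one {y : E n} (hy : ‖y‖ = 1) : invIso n y = y := by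
  simp [invIso_apply, hy]

theorem inv_norm_lt_two {y : E n} (hy : 1 / 2 < ‖y‖) : ‖invIso n y‖ < 2 := by
  rw [norm_invIso, inv_lt_comm₀ (by linarith) two_pos]
  linarith

theorem one_le_inv_norm {y : E n} (hy : 1 / 2 < ‖y‖) (hy1 : ‖y‖ ≤ 1) : 1 ≤ ‖invIso n y‖ := by
  rw [norm_invIso]
  exact (one_le_inv₀ (by linarith)).2 hy1

end InvIso

/-! ### The quotient topology, the height function and the three open pieces -/

section Topology

variable {n : ℕ} {M N : Type*} [TopologicalSpace M] [TopologicalSpace N]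
  {φ : OpenPartialHomeomorph M (E n)} {ψ : OpenPartialHomeomorph N (E n)} {ε : ℝ}

/-- Identified points have rescaled coordinates on the unit sphere, which the inversion fixes
pointwise. -/
theorem preGlue_eq_of_glueRel {a b : PreSum φ ψ ε} (hε : 0 < ε) (h : GlueRel φ ψ ε a b) :
    preGlue φ ψ ε a = preGlue φ ψ ε b := by
  obtain ⟨x, y, rfl, rfl, -, -, hx, hxy⟩ := h
  have : ‖ε⁻¹ • ψ y.1‖ = 1 := by
    rw [← hxy, norm_smul, hx, Real.norm_of_nonneg (by positivity), inv_mul_cancel₀ hε.ne']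
  simp only [preGlue, Sum.elim_inl, Sum.elim_inr, this, hxy]
  simp

/-- The gluing map on `M ♯ N`. -/
noncomputable def glueFun (φ : OpenPartialHomeomorph M (E n)) (ψ : OpenPartialHomeomorph N (E n))
    (hε : 0 < ε) : ConnSum φ ψ ε → E n :=
  Quot.lift (preGlue φ ψ ε) fun _ _ => preGlue_eq_of_glueRel hε

/-- A left inverse of the inclusion of the part of `M`. -/
noncomputable def toLeft (φ : OpenPartialHomeomorph M (E n)) (ψ : OpenPartialHomeomorph N (E n))
    (ε : ℝ) : ConnSum φ ψ ε → M :=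
  -- The value on the second summand matters only on the neck sphere, where it has to be the
  -- identified point of `M`.
  Quot.lift (Sum.elim Subtype.val fun y => φ.symm (ψ y.1)) <| by
    rintro _ _ ⟨x, y, rfl, rfl, hx, -, -, hxy⟩
    simp [← hxy, φ.left_inv hx]

/-- A left inverse of the inclusion of the part of `N`. -/
noncomputable def toRight (φ : OpenPartialHomeomorph M (E n)) (ψ : OpenPartialHomeomorph N (E n))
    (ε : ℝ) : ConnSum φ ψ ε → N :=
  Quot.lift (Sum.elim (fun x => ψ.symm (φ x.1)) Subtype.val) <| by
    rintro _ _ ⟨x, y, rfl, rfl, -, hy, -, hxy⟩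
    simp [hxy, ψ.left_inv hy]

/-- The signed distance to the neck, before passing to the quotient. -/
noncomputable def preHeight (φ : OpenPartialHomeomorph M (E n))
    (ψ : OpenPartialHomeomorph N (E n)) (ε : ℝ) : PreSum φ ψ ε → ℝ :=
  Sum.elim (fun x => chartNorm φ (2 * ε) x.1 - ε) (fun y => ε - chartNorm ψ (2 * ε) y.1)

/-- The signed distance to the neck in the coordinates used in the gluing. -/
noncomputable def height (φ : OpenPartialHomeomorph M (E n)) (ψ : OpenPartialHomeomorph N (E n))
    (ε : ℝ) : ConnSum φ ψ ε → ℝ :=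
  Quot.lift (preHeight φ ψ ε) <| by
    rintro _ _ ⟨x, y, rfl, rfl, hx, hy, h, hxy⟩
    simp [preHeight, chartNorm_of_mem hx, chartNorm_of_mem hy, ← hxy, h]

theorem continuous_proj : Continuous (proj φ ψ ε) := continuous_quot_mk

theorem isQuotientMap_proj : Topology.IsQuotientMap (proj φ ψ ε) := isQuotientMap_quot_mk

theorem proj_surjective : Function.Surjective (proj φ ψ ε) := Quot.mk_surjective

theorem continuous_height [T2Space M] [T2Space N] (hφ : φ.target = Metric.ball 0 (2 * ε))
    (hψ : ψ.target = Metric.ball 0 (2 * ε)) : Continuous (height φ ψ ε) := by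
  refine continuous_quot_lift _ ?_
  exact (((continuous_chartNorm hφ).comp continuous_subtype_val).sub continuous_const).sumElim
    (continuous_const.sub ((continuous_chartNorm hψ).comp continuous_subtype_val))

theorem le_chartNorm_iff (hε : 0 < ε) {x : M} :
    ε ≤ chartNorm φ (2 * ε) x ↔ x ∉ chartBall φ ε := by
  rw [← chartNorm_lt_iff (by linarith : ε ≤ 2 * ε), not_lt]

theorem height_inl_nonneg (hε : 0 < ε) (x : {x : M // x ∉ chartBall φ ε}) :
    0 ≤ height φ ψ ε (proj φ ψ ε (Sum.inl x)) :=
  sub_nonneg.2 ((le_chartNorm_iff hε).2 x.2)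

theorem height_inr_nonpos (hε : 0 < ε) (y : {y : N // y ∉ chartBall ψ ε}) :
    height φ ψ ε (proj φ ψ ε (Sum.inr y)) ≤ 0 :=
  sub_nonpos.2 ((le_chartNorm_iff hε).2 y.2)

theorem height_inl_pos_iff (hε : 0 < ε) (x : {x : M // x ∉ chartBall φ ε}) :
    0 < height φ ψ ε (proj φ ψ ε (Sum.inl x)) ↔ x.1 ∉ chartClosedBall φ ε := by
  rw [← chartNorm_le_iff (by linarith : ε < 2 * ε), not_le]
  exact sub_pos

theorem height_inr_neg_iff (hε : 0 < ε) (y : {y : N // y ∉ chartBall ψ ε}) :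
    height φ ψ ε (proj φ ψ ε (Sum.inr y)) < 0 ↔ y.1 ∉ chartClosedBall ψ ε := by
  rw [← chartNorm_le_iff (by linarith : ε < 2 * ε), not_le]
  exact sub_neg

theorem abs_preHeight_lt_iff (hε : 0 < ε) (a : PreSum φ ψ ε) :
    |preHeight φ ψ ε a| < ε ↔ a ∈ annuli φ ψ ε := by
  rcases a with x | y
  · have h := (le_chartNorm_iff hε).2 x.2
    change |chartNorm φ (2 * ε) x.1 - ε| < ε ↔ x.1 ∈ chartBall φ (2 * ε)
    rw [abs_of_nonneg (by linarith), ← chartNorm_lt_iff le_rfl]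
    constructor <;> intro <;> linarith
  · have h := (le_chartNorm_iff hε).2 y.2
    change |ε - chartNorm ψ (2 * ε) y.1| < ε ↔ y.1 ∈ chartBall ψ (2 * ε)
    rw [abs_of_nonpos (by linarith), ← chartNorm_lt_iff le_rfl]
    constructor <;> intro <;> linarith

theorem setOf_abs_height_lt (hε : 0 < ε) :
    {z | |height φ ψ ε z| < ε} = proj φ ψ ε '' annuli φ ψ ε := by
  ext z
  obtain ⟨a, rfl⟩ := proj_surjective z
  constructor
  · exact fun h => ⟨a, (abs_preHeight_lt_iff hε a).1 h, rfl⟩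
  · rintro ⟨b, hb, h⟩
    rw [← h]
    exact (abs_preHeight_lt_iff hε b).2 hb

theorem glueFun_inl (hε : 0 < ε) (x : {x : M // x ∉ chartBall φ ε}) :
    glueFun φ ψ hε (proj φ ψ ε (Sum.inl x)) = ε⁻¹ • φ x.1 := rfl

theorem glueFun_inr (hε : 0 < ε) (y : {y : N // y ∉ chartBall ψ ε}) :
    glueFun φ ψ hε (proj φ ψ ε (Sum.inr y)) = invIso n (ε⁻¹ • ψ y.1) :=
  (invIso_apply _).symm

theorem mem_cover (hε : 0 < ε) (z : ConnSum φ ψ ε) :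
    0 < height φ ψ ε z ∨ height φ ψ ε z < 0 ∨ |height φ ψ ε z| < ε := by
  rcases lt_trichotomy (height φ ψ ε z) 0 with h | h | h
  · exact .inr (.inl h)
  · exact .inr (.inr (by rwa [h, abs_zero]))
  · exact .inl h

theorem norm_inv_smul_chart (hε : 0 < ε) {x : M} (hx : x ∉ chartBall φ ε)
    (hx' : x ∈ chartBall φ (2 * ε)) : 1 ≤ ‖ε⁻¹ • φ x‖ ∧ ‖ε⁻¹ • φ x‖ < 2 := by
  rw [norm_smul, Real.norm_of_nonneg (by positivity), ← div_eq_inv_mul, le_div_iff₀ hε,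
    div_lt_iff₀ hε, one_mul]
  exact ⟨not_lt.1 fun h => hx ⟨hx'.1, h⟩, hx'.2⟩

/-- Over an open subset of the quotient, continuity can be tested before passing to the quotient, on
each summand separately. On the second one the rescaled coordinates have norm at least `1`, away
from the pole of the inversion. -/
theorem continuousOn_glueFun [T2Space M] [T2Space N] (hε : 0 < ε)
    (hφ : φ.target = Metric.ball 0 (2 * ε)) (hψ : ψ.target = Metric.ball 0 (2 * ε)) :
    ContinuousOn (glueFun φ ψ hε) {z | |height φ ψ ε z| < ε} := by
  rw [isQuotientMap_proj.continuousOn_isOpen_iff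
      (isOpen_lt (continuous_height hφ hψ).abs continuous_const)]
  rintro (x | y) ha
  · have hx := (abs_preHeight_lt_iff hε _).1 ha
    refine ContinuousAt.continuousWithinAt ?_
    rw [← Topology.IsOpenEmbedding.inl.continuousAt_iff]
    have h1 : ContinuousAt (fun x : {x : M // x ∉ chartBall φ ε} => ε⁻¹ • φ x.1) x :=
      (ContinuousAt.comp (f := Subtype.val) (φ.continuousAt hx.1)
        continuous_subtype_val.continuousAt).const_smul ε⁻¹
    exact h1
  · have hy := (abs_preHeight_lt_iff hε _).1 ha
    refine ContinuousAt.continuousWithinAt ?_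
    rw [← Topology.IsOpenEmbedding.inr.continuousAt_iff]
    have h1 : ContinuousAt (fun x : {x : N // x ∉ chartBall ψ ε} => ε⁻¹ • ψ x.1) y :=
      (ContinuousAt.comp (f := Subtype.val) (ψ.continuousAt hy.1)
        continuous_subtype_val.continuousAt).const_smul ε⁻¹
    have h2 : ε⁻¹ • ψ y.1 ∈ (invIso n).source := by
      have := (norm_inv_smul_chart hε y.2 hy).1
      change _ ∉ _
      intro h
      rw [Set.mem_singleton_iff] at h
      rw [h, norm_zero] at this
      linarith
    refine (ContinuousAt.comp (f := fun x : {x : N // x ∉ chartBall ψ ε} => ε⁻¹ • ψ x.1)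
      ((invIso n).continuousAt h2) h1).congr (.of_forall fun x => ?_)
    exact invIso_apply _

/-- The inclusion of the part of `M`, extended by an arbitrary constant. -/
noncomputable def fromLeft (φ : OpenPartialHomeomorph M (E n)) (ψ : OpenPartialHomeomorph N (E n))
    (ε : ℝ) [Nonempty (ConnSum φ ψ ε)] (x : M) : ConnSum φ ψ ε :=
  open Classical in
  if h : x ∉ chartBall φ ε then proj φ ψ ε (Sum.inl ⟨x, h⟩) else Classical.arbitrary _

/-- The inclusion of the part of `N`, extended by an arbitrary constant. -/
noncomputable def fromRight (φ : OpenPartialHomeomorph M (E n))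
    (ψ : OpenPartialHomeomorph N (E n)) (ε : ℝ) [Nonempty (ConnSum φ ψ ε)] (y : N) :
    ConnSum φ ψ ε :=
  open Classical in
  if h : y ∉ chartBall ψ ε then proj φ ψ ε (Sum.inr ⟨y, h⟩) else Classical.arbitrary _

variable [Nonempty (ConnSum φ ψ ε)]

theorem fromLeft_of_notMem {x : M} (h : x ∉ chartBall φ ε) :
    fromLeft φ ψ ε x = proj φ ψ ε (Sum.inl ⟨x, h⟩) := dif_pos h

theorem fromRight_of_notMem {y : N} (h : y ∉ chartBall ψ ε) :
    fromRight φ ψ ε y = proj φ ψ ε (Sum.inr ⟨y, h⟩) := dif_pos h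

theorem continuousOn_fromLeft : ContinuousOn (fromLeft φ ψ ε) (chartBall φ ε)ᶜ := by
  rw [continuousOn_iff_continuous_domRestrict]
  have : Continuous fun x : ((chartBall φ ε)ᶜ : Set M) =>
      proj φ ψ ε (Sum.inl ⟨x.1, x.2⟩) :=
    continuous_proj.comp (continuous_inl.comp (by fun_prop))
  refine this.congr fun x => ?_
  exact (fromLeft_of_notMem x.2).symm

theorem continuousOn_fromRight : ContinuousOn (fromRight φ ψ ε) (chartBall ψ ε)ᶜ := by
  rw [continuousOn_iff_continuous_domRestrict]
  have : Continuous fun x : ((chartBall ψ ε)ᶜ : Set N) =>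
      proj φ ψ ε (Sum.inr ⟨x.1, x.2⟩) :=
    continuous_proj.comp (continuous_inr.comp (by fun_prop))
  refine this.congr fun x => ?_
  exact (fromRight_of_notMem x.2).symm

theorem notMem_chartBall_of_notMem_closed {x : M} (h : x ∉ chartClosedBall φ ε) :
    x ∉ chartBall φ ε := fun h' => h ⟨h'.1, h'.2.le⟩

/-- The inclusion of the part of `M` as a partial homeomorphism. -/
noncomputable def leftIncl [T2Space M] [T2Space N] (hε : 0 < ε)
    (hφ : φ.target = Metric.ball 0 (2 * ε)) (hψ : ψ.target = Metric.ball 0 (2 * ε)) :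
    OpenPartialHomeomorph M (ConnSum φ ψ ε) where
  toFun := fromLeft φ ψ ε
  invFun := toLeft φ ψ ε
  source := (chartClosedBall φ ε)ᶜ
  target := {z | 0 < height φ ψ ε z}
  map_source' x hx := by
    rw [fromLeft_of_notMem (notMem_chartBall_of_notMem_closed hx)]
    exact (height_inl_pos_iff hε _).2 hx
  map_target' z hz := by
    obtain ⟨x | y, rfl⟩ := proj_surjective z
    · exact (height_inl_pos_iff hε _).1 hz
    · exact absurd hz (height_inr_nonpos hε y).not_gt
  left_inv' x hx := by
    rw [fromLeft_of_notMem (notMem_chartBall_of_notMem_closed hx)]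
    rfl
  right_inv' z hz := by
    obtain ⟨x | y, rfl⟩ := proj_surjective z
    · exact fromLeft_of_notMem x.2
    · exact absurd hz (height_inr_nonpos hε y).not_gt
  open_source := (isClosed_chartClosedBall hφ (by linarith)).isOpen_compl
  open_target := isOpen_lt continuous_const (continuous_height hφ hψ)
  continuousOn_toFun := continuousOn_fromLeft.mono fun _ h => notMem_chartBall_of_notMem_closed h
  continuousOn_invFun := by
    rw [isQuotientMap_proj.continuousOn_isOpen_iff
      (isOpen_lt continuous_const (continuous_height hφ hψ))]
    rintro (x | y) ha
    · refine ContinuousAt.continuousWithinAt ?_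
      rw [← Topology.IsOpenEmbedding.inl.continuousAt_iff]
      exact continuous_subtype_val.continuousAt
    · exact absurd ha (height_inr_nonpos hε y).not_gt

/-- The inclusion of the part of `N` as a partial homeomorphism. -/
noncomputable def rightIncl [T2Space M] [T2Space N] (hε : 0 < ε)
    (hφ : φ.target = Metric.ball 0 (2 * ε)) (hψ : ψ.target = Metric.ball 0 (2 * ε)) :
    OpenPartialHomeomorph N (ConnSum φ ψ ε) where
  toFun := fromRight φ ψ ε
  invFun := toRight φ ψ ε
  source := (chartClosedBall ψ ε)ᶜ
  target := {z | height φ ψ ε z < 0}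
  map_source' x hx := by
    rw [fromRight_of_notMem (notMem_chartBall_of_notMem_closed hx)]
    exact (height_inr_neg_iff hε _).2 hx
  map_target' z hz := by
    obtain ⟨x | y, rfl⟩ := proj_surjective z
    · exact absurd hz (height_inl_nonneg hε x).not_gt
    · exact (height_inr_neg_iff hε _).1 hz
  left_inv' x hx := by
    rw [fromRight_of_notMem (notMem_chartBall_of_notMem_closed hx)]
    rfl
  right_inv' z hz := by
    obtain ⟨x | y, rfl⟩ := proj_surjective z
    · exact absurd hz (height_inl_nonneg hε x).not_gt
    · exact fromRight_of_notMem y.2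
  open_source := (isClosed_chartClosedBall hψ (by linarith)).isOpen_compl
  open_target := isOpen_lt (continuous_height hφ hψ) continuous_const
  continuousOn_toFun := continuousOn_fromRight.mono fun _ h => notMem_chartBall_of_notMem_closed h
  continuousOn_invFun := by
    rw [isQuotientMap_proj.continuousOn_isOpen_iff
      (isOpen_lt (continuous_height hφ hψ) continuous_const)]
    rintro (x | y) ha
    · exact absurd ha (height_inl_nonneg hε x).not_gt
    · refine ContinuousAt.continuousWithinAt ?_
      rw [← Topology.IsOpenEmbedding.inr.continuousAt_iff]
      exact continuous_subtype_val.continuousAt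

/-- The inverse of the gluing chart. -/
noncomputable def glueInv (φ : OpenPartialHomeomorph M (E n)) (ψ : OpenPartialHomeomorph N (E n))
    (ε : ℝ) [Nonempty (ConnSum φ ψ ε)] (y : E n) : ConnSum φ ψ ε :=
  open Classical in
  if 1 ≤ ‖y‖ then fromLeft φ ψ ε (φ.symm (ε • y)) else fromRight φ ψ ε (ψ.symm (ε • invIso n y))

theorem smul_mem_target (hε : 0 < ε) (hφ : φ.target = Metric.ball 0 (2 * ε)) {y : E n}
    (hy : ‖y‖ < 2) : ε • y ∈ φ.target := by
  rw [hφ, mem_ball_zero_iff, norm_smul, Real.norm_of_nonneg hε.le]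
  nlinarith

theorem symm_smul_notMem_chartBall (hε : 0 < ε) (hφ : φ.target = Metric.ball 0 (2 * ε)) {y : E n}
    (hy : ‖y‖ < 2) (hy1 : 1 ≤ ‖y‖) : φ.symm (ε • y) ∉ chartBall φ ε := by
  rintro ⟨-, h⟩
  rw [φ.right_inv (smul_mem_target hε hφ hy), norm_smul, Real.norm_of_nonneg hε.le] at h
  nlinarith

theorem glueInv_of_one_le (hε : 0 < ε) (hφ : φ.target = Metric.ball 0 (2 * ε)) {y : E n}
    (hy : ‖y‖ < 2) (hy1 : 1 ≤ ‖y‖) : glueInv φ ψ ε y =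
      proj φ ψ ε (Sum.inl ⟨φ.symm (ε • y), symm_smul_notMem_chartBall hε hφ hy hy1⟩) := by
  rw [glueInv, if_pos hy1, fromLeft_of_notMem]

/-- This is the gluing relation itself; it makes the two branches of `glueInv` match on the unit
sphere. -/
theorem fromLeft_eq_fromRight (hε : 0 < ε) (hφ : φ.target = Metric.ball 0 (2 * ε))
    (hψ : ψ.target = Metric.ball 0 (2 * ε)) {y : E n} (hy : ‖y‖ = 1) :
    fromLeft φ ψ ε (φ.symm (ε • y)) = fromRight φ ψ ε (ψ.symm (ε • y)) := by
  have h2 : ‖y‖ < 2 := by rw [hy]; norm_num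
  rw [fromLeft_of_notMem (symm_smul_notMem_chartBall hε hφ h2 hy.ge),
    fromRight_of_notMem (symm_smul_notMem_chartBall hε hψ h2 hy.ge)]
  refine Quot.sound ⟨_, _, rfl, rfl, φ.map_target (smul_mem_target hε hφ h2),
    ψ.map_target (smul_mem_target hε hψ h2), ?_, ?_⟩
  · rw [φ.right_inv (smul_mem_target hε hφ h2), norm_smul, hy, Real.norm_of_nonneg hε.le, mul_one]
  · rw [φ.right_inv (smul_mem_target hε hφ h2), ψ.right_inv (smul_mem_target hε hψ h2)]

theorem glueInv_of_le_one (hε : 0 < ε) (hφ : φ.target = Metric.ball 0 (2 * ε))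
    (hψ : ψ.target = Metric.ball 0 (2 * ε)) {y : E n} (hy : 1 / 2 < ‖y‖) (hy1 : ‖y‖ ≤ 1) :
    glueInv φ ψ ε y = proj φ ψ ε (Sum.inr ⟨ψ.symm (ε • invIso n y),
      symm_smul_notMem_chartBall hε hψ (inv_norm_lt_two hy) (one_le_inv_norm hy hy1)⟩) := by
  rw [← fromRight_of_notMem, glueInv]
  split_ifs with h
  · have h1 : ‖y‖ = 1 := le_antisymm hy1 h
    rw [invIso_of_norm_eq_one h1, fromLeft_eq_fromRight hε hφ hψ h1]
  · rfl

/-- The branches are continuous on the relatively closed pieces `1 ≤ ‖y‖` and `‖y‖ ≤ 1` of the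
annulus and agree on the sphere between them, so they paste. -/
theorem continuousOn_glueInv (hε : 0 < ε)
    (hφ : φ.target = Metric.ball 0 (2 * ε)) (hψ : ψ.target = Metric.ball 0 (2 * ε)) :
    ContinuousOn (glueInv φ ψ ε) {y : E n | 1 / 2 < ‖y‖ ∧ ‖y‖ < 2} := by
  refine ContinuousOn.if ?_ ?_ ?_
  · rintro y ⟨-, hy⟩
    have h1 : 1 = ‖y‖ := frontier_le_subset_eq continuous_const continuous_norm hy
    rw [invIso_of_norm_eq_one h1.symm, fromLeft_eq_fromRight hε hφ hψ h1.symm]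
  · rw [(isClosed_le continuous_const continuous_norm).closure_eq]
    refine continuousOn_fromLeft.comp (φ.continuousOn_symm.comp
      (continuous_const_smul ε).continuousOn ?_) ?_
    · exact fun y hy => smul_mem_target hε hφ hy.1.2
    · exact fun y hy => symm_smul_notMem_chartBall hε hφ hy.1.2 hy.2
  · have hc : closure {y : E n | ¬ 1 ≤ ‖y‖} ⊆ {y | ‖y‖ ≤ 1} :=
      closure_minimal (fun y hy => (not_le.1 hy).le) (isClosed_le continuous_norm continuous_const)
    refine continuousOn_fromRight.comp (ψ.continuousOn_symm.comp
      (((invIso n).continuousOn.mono ?_).const_smul ε) ?_) ?_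
    · rintro y ⟨hy, -⟩ h
      rw [Set.mem_singleton_iff] at h
      rw [h] at hy
      have := hy.1
      rw [norm_zero] at this
      linarith
    · exact fun y hy => smul_mem_target hε hψ (inv_norm_lt_two hy.1.1)
    · exact fun y hy => symm_smul_notMem_chartBall hε hψ (inv_norm_lt_two hy.1.1)
        (one_le_inv_norm hy.1.1 (hc hy.2))

/-- The gluing chart. -/
noncomputable def glueChart [T2Space M] [T2Space N] (hε : 0 < ε)
    (hφ : φ.target = Metric.ball 0 (2 * ε)) (hψ : ψ.target = Metric.ball 0 (2 * ε)) :
    OpenPartialHomeomorph (ConnSum φ ψ ε) (E n) where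
  toFun := glueFun φ ψ hε
  invFun := glueInv φ ψ ε
  source := {z | |height φ ψ ε z| < ε}
  target := {y : E n | 1 / 2 < ‖y‖ ∧ ‖y‖ < 2}
  map_source' z hz := by
    obtain ⟨x | y, rfl⟩ := proj_surjective z
    · have h := norm_inv_smul_chart hε x.2 ((abs_preHeight_lt_iff hε _).1 hz)
      rw [glueFun_inl]
      exact ⟨by linarith [h.1], h.2⟩
    · have h := norm_inv_smul_chart hε y.2 ((abs_preHeight_lt_iff hε _).1 hz)
      rw [glueFun_inr]
      change 1 / 2 < ‖invIso n (ε⁻¹ • ψ y.1)‖ ∧ ‖invIso n (ε⁻¹ • ψ y.1)‖ < 2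
      refine ⟨?_, inv_norm_lt_two (by linarith)⟩
      rw [norm_invIso, one_div]
      exact (inv_lt_inv₀ (by norm_num) (by linarith)).2 h.2
  map_target' y hy := by
    rcases le_total 1 ‖y‖ with h | h
    · rw [glueInv_of_one_le hε hφ hy.2 h]
      refine (abs_preHeight_lt_iff hε (Sum.inl _)).2 ?_
      change φ.symm (ε • y) ∈ chartBall φ (2 * ε)
      rw [chartBall_eq_source hφ]
      exact φ.map_target (smul_mem_target hε hφ hy.2)
    · rw [glueInv_of_le_one hε hφ hψ hy.1 h]
      refine (abs_preHeight_lt_iff hε (Sum.inr _)).2 ?_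
      change ψ.symm (ε • invIso n y) ∈ chartBall ψ (2 * ε)
      rw [chartBall_eq_source hψ]
      exact ψ.map_target (smul_mem_target hε hψ (inv_norm_lt_two hy.1))
  left_inv' z hz := by
    obtain ⟨x | y, rfl⟩ := proj_surjective z
    · have h0 : x.1 ∈ chartBall φ (2 * ε) := (abs_preHeight_lt_iff hε _).1 hz
      have h := norm_inv_smul_chart hε x.2 h0
      rw [glueFun_inl, glueInv_of_one_le hε hφ h.2 h.1]
      congr 3
      rw [smul_inv_smul₀ hε.ne', φ.left_inv h0.1]
    · have h0 : y.1 ∈ chartBall ψ (2 * ε) := (abs_preHeight_lt_iff hε _).1 hz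
      have h := norm_inv_smul_chart hε y.2 h0
      rw [glueFun_inr, glueInv_of_le_one hε hφ hψ]
      · congr 3
        rw [invIso_invIso, smul_inv_smul₀ hε.ne', ψ.left_inv h0.1]
      · rw [norm_invIso, one_div]
        exact (inv_lt_inv₀ (by norm_num) (by linarith)).2 h.2
      · rw [norm_invIso]
        exact inv_le_one_of_one_le₀ h.1
  right_inv' y hy := by
    rcases le_total 1 ‖y‖ with h | h
    · rw [glueInv_of_one_le hε hφ hy.2 h, glueFun_inl, φ.right_inv (smul_mem_target hε hφ hy.2),
        inv_smul_smul₀ hε.ne']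
    · rw [glueInv_of_le_one hε hφ hψ hy.1 h, glueFun_inr,
        ψ.right_inv (smul_mem_target hε hψ (inv_norm_lt_two hy.1)), inv_smul_smul₀ hε.ne',
        invIso_invIso]
  open_source := isOpen_lt (continuous_height hφ hψ).abs continuous_const
  open_target := (isOpen_lt continuous_const continuous_norm).inter
    (isOpen_lt continuous_norm continuous_const)
  continuousOn_toFun := continuousOn_glueFun hε hφ hψ
  continuousOn_invFun := continuousOn_glueInv hε hφ hψ

theorem exists_separation_of_mem_source {X Y : Type*} [TopologicalSpace X]
    [TopologicalSpace Y] [T2Space Y] (e : OpenPartialHomeomorph X Y) {z w : X}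
    (hz : z ∈ e.source) (hw : w ∈ e.source) (h : z ≠ w) :
    ∃ u v, IsOpen u ∧ IsOpen v ∧ z ∈ u ∧ w ∈ v ∧ Disjoint u v := by
  obtain ⟨u, v, hu, hv, hzu, hwv, huv⟩ := t2_separation (e.injOn.ne hz hw h)
  refine ⟨_, _, e.isOpen_inter_preimage hu, e.isOpen_inter_preimage hv, ⟨hz, hzu⟩, ⟨hw, hwv⟩, ?_⟩
  exact (huv.preimage e).mono Set.inter_subset_right Set.inter_subset_right

/-- Points of different heights are separated by the continuous function `height`. Points of equal
height lie in a common one of the three open pieces, each homeomorphic to a subset of a Hausdorff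
space. -/
theorem t2Space_connSum [T2Space M] [T2Space N] (hε : 0 < ε)
    (hφ : φ.target = Metric.ball 0 (2 * ε)) (hψ : ψ.target = Metric.ball 0 (2 * ε)) :
    T2Space (ConnSum φ ψ ε) := by
  refine ⟨fun z w hzw => ?_⟩
  by_cases h : height φ ψ ε z = height φ ψ ε w
  · rcases mem_cover hε z with hz | hz | hz
    · exact exists_separation_of_mem_source (leftIncl hε hφ hψ).symm
        (z := z) (w := w) hz (h ▸ hz : 0 < height φ ψ ε w) hzw
    · exact exists_separation_of_mem_source (rightIncl hε hφ hψ).symm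
        (z := z) (w := w) hz (h ▸ hz : height φ ψ ε w < 0) hzw
    · exact exists_separation_of_mem_source (glueChart hε hφ hψ)
        (z := z) (w := w) hz (h ▸ hz : |height φ ψ ε w| < ε) hzw
  · obtain ⟨u, v, hu, hv, hzu, hwv, huv⟩ := t2_separation h
    exact ⟨_, _, hu.preimage (continuous_height hφ hψ), hv.preimage (continuous_height hφ hψ),
      hzu, hwv, huv.preimage _⟩

theorem secondCountableTopology_chart_source {X Y : Type*} [TopologicalSpace X]
    [TopologicalSpace Y] [SecondCountableTopology Y] (e : OpenPartialHomeomorph X Y) :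
    SecondCountableTopology e.source :=
  e.toHomeomorphSourceTarget.secondCountableTopology

/-- The three open pieces are second countable, being homeomorphic to subsets of `M`, `N` and `ℝⁿ`.
-/
theorem secondCountableTopology_connSum [T2Space M] [T2Space N] [SecondCountableTopology M]
    [SecondCountableTopology N] (hε : 0 < ε)
    (hφ : φ.target = Metric.ball 0 (2 * ε)) (hψ : ψ.target = Metric.ball 0 (2 * ε)) :
    SecondCountableTopology (ConnSum φ ψ ε) := by
  let U : Fin 3 → Set (ConnSum φ ψ ε) := ![(leftIncl hε hφ hψ).symm.source,
    (rightIncl hε hφ hψ).symm.source, (glueChart hε hφ hψ).source]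
  have hU : ∀ i, SecondCountableTopology (U i) := by
    intro i
    fin_cases i
    · exact secondCountableTopology_chart_source (leftIncl hε hφ hψ).symm
    · exact secondCountableTopology_chart_source (rightIncl hε hφ hψ).symm
    · exact secondCountableTopology_chart_source (glueChart hε hφ hψ)
  refine TopologicalSpace.secondCountableTopology_of_countable_cover (U := U) ?_ ?_
  · intro i
    fin_cases i
    · exact (leftIncl hε hφ hψ).symm.open_source
    · exact (rightIncl hε hφ hψ).symm.open_source
    · exact (glueChart hε hφ hψ).open_source
  · refine Set.eq_univ_of_forall fun z => Set.mem_iUnion.2 ?_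
    rcases mem_cover hε z with hz | hz | hz
    · exact ⟨0, hz⟩
    · exact ⟨1, hz⟩
    · exact ⟨2, hz⟩

end Topology

section Compact

variable {n : ℕ} {M N : Type*} [TopologicalSpace M] [TopologicalSpace N]
  {φ : OpenPartialHomeomorph M (E n)} {ψ : OpenPartialHomeomorph N (E n)} {ε : ℝ}

theorem compactSpace_connSum [CompactSpace M] [CompactSpace N] :
    CompactSpace (ConnSum φ ψ ε) := by
  have h1 : CompactSpace {x : M // x ∉ chartBall φ ε} :=
    isCompact_iff_compactSpace.1 (isOpen_chartBall φ ε).isClosed_compl.isCompact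
  have h2 : CompactSpace {y : N // y ∉ chartBall ψ ε} :=
    isCompact_iff_compactSpace.1 (isOpen_chartBall ψ ε).isClosed_compl.isCompact
  exact Quot.compactSpace

/-- The neck sphere is nonempty in positive dimension. A point of the sum is needed as a default
value, to make the inclusions total functions. -/
theorem nonempty_connSum (hn : 0 < n) (hε : 0 < ε) (hφ : φ.target = Metric.ball 0 (2 * ε)) :
    Nonempty (ConnSum φ ψ ε) := by
  have : Nonempty (Fin n) := ⟨⟨0, hn⟩⟩
  obtain ⟨y, hy⟩ := (NormedSpace.sphere_nonempty (x := (0 : E n)) (r := 1)).2 zero_le_one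
  rw [mem_sphere_zero_iff_norm] at hy
  exact ⟨proj φ ψ ε (Sum.inl ⟨φ.symm (ε • y),
    symm_smul_notMem_chartBall hε hφ (by rw [hy]; norm_num) hy.ge⟩)⟩

end Compact

/-! ### The smooth structure of the connected sum -/

section Transition

variable {n : ℕ} {X M : Type*} [TopologicalSpace X] [TopologicalSpace M] [ChartedSpace (E n) M]
  [IsManifold 𝓘(ℝ, E n) ∞ M]

/-- The change of charts from `e` to `e'` is smooth. -/
def SmoothTransition (e e' : OpenPartialHomeomorph X (E n)) : Prop :=
  ContDiffOn ℝ ∞ (e.symm ≫ₕ e') (e.symm ≫ₕ e').source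

theorem contDiffAt_transition {e e' : OpenPartialHomeomorph M (E n)} (he : e ∈ smoothCharts n M)
    (he' : e' ∈ smoothCharts n M) {x : M} (hx : x ∈ e.source) (hx' : x ∈ e'.source) :
    ContDiffAt ℝ ∞ (fun y => e' (e.symm y)) (e x) := by
  rw [← contMDiffAt_iff_contDiffAt]
  refine ContMDiffAt.comp (e x) ?_ ((mem_smoothCharts_iff.1 he).symm.contMDiffAt (e.map_source hx))
  rw [e.left_inv hx]
  exact (mem_smoothCharts_iff.1 he').contMDiffAt hx'

theorem smoothTransition_iff {e e' : OpenPartialHomeomorph X (E n)} :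
    SmoothTransition e e' ↔ ∀ x ∈ e.source, x ∈ e'.source →
      ContDiffAt ℝ ∞ (fun y => e' (e.symm y)) (e x) := by
  rw [← forall_mem_transition_source (P := fun z => ContDiffAt ℝ ∞ (fun y => e' (e.symm y)) z)]
  refine forall₂_congr fun y hy => ?_
  exact contDiffWithinAt_iff_contDiffAt ((e.symm ≫ₕ e').open_source.mem_nhds hy)

/-- Near `e x`, the change of charts upstairs between `e` and `e'` is read through `i`. -/
theorem contDiffAt_transition_of_eventuallyEq {i : OpenPartialHomeomorph M X}
    {e e' : OpenPartialHomeomorph X (E n)} {f f' : OpenPartialHomeomorph M (E n)}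
    (hf : f ∈ smoothCharts n M) (hf' : f' ∈ smoothCharts n M) {x : M} (hi : x ∈ i.source)
    (hx : x ∈ f.source) (hx' : x ∈ f'.source) (he : i x ∈ e.source)
    (hef : ∀ᶠ z in 𝓝 x, e (i z) = f z) (hef' : ∀ᶠ z in 𝓝 x, e' (i z) = f' z) :
    ContDiffAt ℝ ∞ (fun y => e' (e.symm y)) (e (i x)) := by
  rw [hef.self_of_nhds]
  refine (contDiffAt_transition hf hf' hx hx').congr_of_eventuallyEq ?_
  have h1 : Filter.Tendsto f.symm (𝓝 (f x)) (𝓝 x) := by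
    have := f.continuousAt_symm (f.map_source hx)
    rwa [ContinuousAt, f.left_inv hx] at this
  have h2 : ∀ᶠ z in 𝓝 x, i z ∈ e.source :=
    (i.continuousAt hi).preimage_mem_nhds (e.open_source.mem_nhds he)
  filter_upwards [h1.eventually (hef.and (hef'.and h2)), f.open_target.mem_nhds (f.map_source hx)]
    with y hy hyt
  obtain ⟨h3, h4, h5⟩ := hy
  rw [f.right_inv hyt] at h3
  rw [← h4, ← e.left_inv h5, h3]

end Transition

section Structure

variable {n : ℕ} {M N : Type*} [TopologicalSpace M] [TopologicalSpace N]

/-- The rescaled chart `φ / ε`. -/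
noncomputable def outerChart (φ : OpenPartialHomeomorph M (E n)) {ε : ℝ} (hε : 0 < ε) :
    OpenPartialHomeomorph M (E n) :=
  φ ≫ₕ scaleIso n ε⁻¹ (inv_ne_zero hε.ne')

/-- The inverted rescaled chart `(ψ / ε) / |ψ / ε|²`. -/
noncomputable def innerChart (ψ : OpenPartialHomeomorph N (E n)) {ε : ℝ} (hε : 0 < ε) :
    OpenPartialHomeomorph N (E n) :=
  outerChart ψ hε ≫ₕ invIso n

theorem outerChart_apply (φ : OpenPartialHomeomorph M (E n)) {ε : ℝ} (hε : 0 < ε) (x : M) :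
    outerChart φ hε x = ε⁻¹ • φ x := rfl

theorem outerChart_source (φ : OpenPartialHomeomorph M (E n)) {ε : ℝ} (hε : 0 < ε) :
    (outerChart φ hε).source = φ.source := by
  simp [outerChart, scaleIso]

theorem innerChart_apply (ψ : OpenPartialHomeomorph N (E n)) {ε : ℝ} (hε : 0 < ε) (y : N) :
    innerChart ψ hε y = invIso n (ε⁻¹ • ψ y) := rfl

theorem mem_innerChart_source (ψ : OpenPartialHomeomorph N (E n)) {ε : ℝ} (hε : 0 < ε) {y : N} :
    y ∈ (innerChart ψ hε).source ↔ y ∈ ψ.source ∧ ψ y ≠ 0 := by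
  rw [innerChart, OpenPartialHomeomorph.trans_source, outerChart_source, Set.mem_inter_iff,
    Set.mem_preimage, outerChart_apply]
  refine and_congr_right fun _ => ?_
  change ¬ (ε⁻¹ • ψ y = 0) ↔ _
  rw [smul_eq_zero, not_or]
  exact ⟨fun h => h.2, fun h => ⟨inv_ne_zero hε.ne', h⟩⟩

theorem ne_zero_of_notMem_chartBall {ψ : OpenPartialHomeomorph N (E n)} {ε : ℝ} (hε : 0 < ε)
    {y : N} (hy : y ∉ chartBall ψ ε) (hy' : y ∈ ψ.source) : ψ y ≠ 0 := fun h =>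
  hy ⟨hy', by rwa [h, norm_zero]⟩

variable [ChartedSpace (E n) M]

theorem smoothIso_outerChart {φ : OpenPartialHomeomorph M (E n)} {ε : ℝ} (hε : 0 < ε)
    (hφ : SmoothIso (n := n) φ) : SmoothIso (n := n) (outerChart φ hε) :=
  hφ.trans (smoothIso_scaleIso _ _)

theorem smoothIso_innerChart {φ : OpenPartialHomeomorph M (E n)} {ε : ℝ} (hε : 0 < ε)
    (hφ : SmoothIso (n := n) φ) : SmoothIso (n := n) (innerChart φ hε) :=
  (smoothIso_outerChart hε hφ).trans smoothIso_invIso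

variable [ChartedSpace (E n) N]
  {φ : OpenPartialHomeomorph M (E n)} {ψ : OpenPartialHomeomorph N (E n)} {ε : ℝ}
  [Nonempty (ConnSum φ ψ ε)] [T2Space M] [T2Space N]

/-- The smooth atlas of the connected sum. -/
noncomputable abbrev connSumChartedSpace (hε : 0 < ε) (hφ : φ.target = Metric.ball 0 (2 * ε))
    (hψ : ψ.target = Metric.ball 0 (2 * ε)) : ChartedSpace (E n) (ConnSum φ ψ ε) where
  atlas := (fun e => (leftIncl hε hφ hψ).symm ≫ₕ e) '' atlas (E n) M ∪
    (fun e => (rightIncl hε hφ hψ).symm ≫ₕ e) '' atlas (E n) N ∪ {glueChart hε hφ hψ}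
  chartAt z := open Classical in
    if 0 < height φ ψ ε z then (leftIncl hε hφ hψ).symm ≫ₕ chartAt (E n) (toLeft φ ψ ε z)
    else if height φ ψ ε z < 0 then
      (rightIncl hε hφ hψ).symm ≫ₕ chartAt (E n) (toRight φ ψ ε z)
    else glueChart hε hφ hψ
  mem_chart_source z := by
    split_ifs with h1 h2
    · exact ⟨h1, mem_chart_source (E n) _⟩
    · exact ⟨h2, mem_chart_source (E n) _⟩
    · have : height φ ψ ε z = 0 := by linarith
      change |height φ ψ ε z| < ε
      rwa [this, abs_zero]
  chart_mem_atlas z := by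
    split_ifs with h1 h2
    · exact .inl (.inl ⟨_, chart_mem_atlas (E n) _, rfl⟩)
    · exact .inl (.inr ⟨_, chart_mem_atlas (E n) _, rfl⟩)
    · exact .inr rfl

end Structure

section Overlap

variable {n : ℕ} {M N : Type*} [TopologicalSpace M] [TopologicalSpace N]
  {φ : OpenPartialHomeomorph M (E n)} {ψ : OpenPartialHomeomorph N (E n)} {ε : ℝ}
  [Nonempty (ConnSum φ ψ ε)] [T2Space M] [T2Space N]

theorem glueChart_leftIncl (hε : 0 < ε) (hφ : φ.target = Metric.ball 0 (2 * ε))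
    (hψ : ψ.target = Metric.ball 0 (2 * ε)) {x : M} (hx : x ∈ (leftIncl (ψ := ψ) hε hφ hψ).source) :
    glueChart hε hφ hψ (leftIncl hε hφ hψ x) = outerChart φ hε x := by
  change glueFun φ ψ hε (fromLeft φ ψ ε x) = _
  rw [fromLeft_of_notMem (notMem_chartBall_of_notMem_closed hx), glueFun_inl, outerChart_apply]

theorem glueChart_rightIncl (hε : 0 < ε) (hφ : φ.target = Metric.ball 0 (2 * ε))
    (hψ : ψ.target = Metric.ball 0 (2 * ε)) {y : N}
    (hy : y ∈ (rightIncl (φ := φ) hε hφ hψ).source) :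
    glueChart hε hφ hψ (rightIncl hε hφ hψ y) = innerChart ψ hε y := by
  change glueFun φ ψ hε (fromRight φ ψ ε y) = _
  rw [fromRight_of_notMem (notMem_chartBall_of_notMem_closed hy), glueFun_inr, innerChart_apply]

theorem leftIncl_mem_glueChart_source (hε : 0 < ε) (hφ : φ.target = Metric.ball 0 (2 * ε))
    (hψ : ψ.target = Metric.ball 0 (2 * ε)) {x : M} (hx : x ∈ (leftIncl (ψ := ψ) hε hφ hψ).source) :
    leftIncl hε hφ hψ x ∈ (glueChart hε hφ hψ).source ↔ x ∈ φ.source := by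
  change |height φ ψ ε (fromLeft φ ψ ε x)| < ε ↔ _
  rw [fromLeft_of_notMem (notMem_chartBall_of_notMem_closed hx), ← chartBall_eq_source hφ]
  exact abs_preHeight_lt_iff hε (Sum.inl _)

theorem rightIncl_mem_glueChart_source (hε : 0 < ε) (hφ : φ.target = Metric.ball 0 (2 * ε))
    (hψ : ψ.target = Metric.ball 0 (2 * ε)) {y : N}
    (hy : y ∈ (rightIncl (φ := φ) hε hφ hψ).source) :
    rightIncl hε hφ hψ y ∈ (glueChart hε hφ hψ).source ↔ y ∈ ψ.source := by
  change |height φ ψ ε (fromRight φ ψ ε y)| < ε ↔ _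
  rw [fromRight_of_notMem (notMem_chartBall_of_notMem_closed hy), ← chartBall_eq_source hψ]
  exact abs_preHeight_lt_iff hε (Sum.inr _)

theorem disjoint_left_right (hε : 0 < ε) (hφ : φ.target = Metric.ball 0 (2 * ε))
    (hψ : ψ.target = Metric.ball 0 (2 * ε)) (e : OpenPartialHomeomorph M (E n))
    (f : OpenPartialHomeomorph N (E n)) :
    Disjoint ((leftIncl hε hφ hψ).symm ≫ₕ e).source ((rightIncl hε hφ hψ).symm ≫ₕ f).source := by
  rw [Set.disjoint_left]
  intro z hz hz'
  have h1 : 0 < height φ ψ ε z := hz.1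
  have h2 : height φ ψ ε z < 0 := hz'.1
  linarith

end Overlap

section Generic

variable {n : ℕ} {X M : Type*} [TopologicalSpace X] [TopologicalSpace M]
  {i : OpenPartialHomeomorph M X}

theorem exists_of_mem_symm_trans_source {e : OpenPartialHomeomorph M (E n)} {z : X}
    (hz : z ∈ (i.symm ≫ₕ e).source) : ∃ x, x ∈ i.source ∧ x ∈ e.source ∧ i x = z := by
  rw [OpenPartialHomeomorph.trans_source] at hz
  exact ⟨i.symm z, i.map_target hz.1, hz.2, i.right_inv hz.1⟩

theorem symm_trans_apply {e : OpenPartialHomeomorph M (E n)} {x : M} (hx : x ∈ i.source) :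
    (i.symm ≫ₕ e) (i x) = e x := by
  simp [i.left_inv hx]

theorem symm_trans_eventuallyEq {e : OpenPartialHomeomorph M (E n)} {x : M} (hx : x ∈ i.source) :
    ∀ᶠ z in 𝓝 x, (i.symm ≫ₕ e) (i z) = e z := by
  filter_upwards [i.open_source.mem_nhds hx] with z hz using symm_trans_apply hz

theorem mem_symm_trans_source {e : OpenPartialHomeomorph M (E n)} {x : M} (hx : x ∈ i.source) :
    i x ∈ (i.symm ≫ₕ e).source ↔ x ∈ e.source := by
  simp [i.left_inv hx, i.map_source hx]

/-- The chart `k` upstairs is read as the chart `f` through `i`. -/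
def ReadsAs (i : OpenPartialHomeomorph M X) (k : OpenPartialHomeomorph X (E n))
    (f : OpenPartialHomeomorph M (E n)) : Prop :=
  ∀ x ∈ i.source, i x ∈ k.source → x ∈ f.source ∧ k (i x) = f x

theorem ReadsAs.eventuallyEq {k : OpenPartialHomeomorph X (E n)}
    {f : OpenPartialHomeomorph M (E n)} (h : ReadsAs i k f) {x : M} (hx : x ∈ i.source)
    (hk : i x ∈ k.source) : ∀ᶠ z in 𝓝 x, k (i z) = f z := by
  filter_upwards [i.open_source.mem_nhds hx,
    (i.continuousAt hx).preimage_mem_nhds (k.open_source.mem_nhds hk)] with z hz hzk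
  exact (h z hz hzk).2

variable [ChartedSpace (E n) M] [IsManifold 𝓘(ℝ, E n) ∞ M]

theorem smoothTransition_symm_trans {e e' : OpenPartialHomeomorph M (E n)}
    (he : e ∈ smoothCharts n M) (he' : e' ∈ smoothCharts n M) :
    SmoothTransition (i.symm ≫ₕ e) (i.symm ≫ₕ e') := by
  rw [smoothTransition_iff]
  intro z hz hz'
  obtain ⟨x, hi, hx, rfl⟩ := exists_of_mem_symm_trans_source hz
  exact contDiffAt_transition_of_eventuallyEq he he' hi hx ((mem_symm_trans_source hi).1 hz') hz
    (symm_trans_eventuallyEq hi) (symm_trans_eventuallyEq hi)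

theorem ReadsAs.smoothTransition_left {k : OpenPartialHomeomorph X (E n)}
    {f e : OpenPartialHomeomorph M (E n)} (h : ReadsAs i k f) (hf : f ∈ smoothCharts n M)
    (he : e ∈ smoothCharts n M) : SmoothTransition (i.symm ≫ₕ e) k := by
  rw [smoothTransition_iff]
  intro z hz hz'
  obtain ⟨x, hi, hx, rfl⟩ := exists_of_mem_symm_trans_source hz
  exact contDiffAt_transition_of_eventuallyEq he hf hi hx (h x hi hz').1 hz
    (symm_trans_eventuallyEq hi) (h.eventuallyEq hi hz')

theorem ReadsAs.smoothTransition_right {k : OpenPartialHomeomorph X (E n)}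
    {f e : OpenPartialHomeomorph M (E n)} (h : ReadsAs i k f) (hf : f ∈ smoothCharts n M)
    (he : e ∈ smoothCharts n M) : SmoothTransition k (i.symm ≫ₕ e) := by
  rw [smoothTransition_iff]
  intro z hz' hz
  obtain ⟨x, hi, hx, rfl⟩ := exists_of_mem_symm_trans_source hz
  exact contDiffAt_transition_of_eventuallyEq hf he hi (h x hi hz').1 hx hz'
    (h.eventuallyEq hi hz') (symm_trans_eventuallyEq hi)

/-- If the charts of `M` are transported to charts of `X` by `i`, then `i` is smooth. -/
theorem smoothIso_of_symm_trans_mem [ChartedSpace (E n) X] [IsManifold 𝓘(ℝ, E n) ∞ X]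
    (h : ∀ e ∈ atlas (E n) M, i.symm ≫ₕ e ∈ smoothCharts n X) : SmoothIso (n := n) i where
  smooth := by
    intro x hx
    have he := mem_smoothCharts_iff.1 (h _ (chart_mem_atlas (E n) x))
    have hc := mem_smoothCharts_iff.1 (IsManifold.chart_mem_maximalAtlas (I := 𝓘(ℝ, E n))
      (n := ∞) x)
    set e := chartAt (E n) x with hedef
    have hxe : x ∈ e.source := mem_chart_source _ x
    have h1 := he.symm.contMDiffAt ((i.symm ≫ₕ e).map_source ((mem_symm_trans_source hx).2 hxe))
    rw [symm_trans_apply hx] at h1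
    -- Near `x`, the map `i` is `e` followed by the inverse of the transported chart.
    refine (ContMDiffAt.congr_of_eventuallyEq (h1.comp x (hc.contMDiffAt hxe))
      ?_).contMDiffWithinAt
    filter_upwards [i.open_source.mem_nhds hx, e.open_source.mem_nhds hxe] with z hz hze
    simp [e.left_inv hze]
  smooth_symm := by
    intro z hz
    obtain ⟨x, hx, rfl⟩ : ∃ x ∈ i.source, i x = z := ⟨i.symm z, i.map_target hz, i.right_inv hz⟩
    have he := mem_smoothCharts_iff.1 (h _ (chart_mem_atlas (E n) x))
    have hc := mem_smoothCharts_iff.1 (IsManifold.chart_mem_maximalAtlas (I := 𝓘(ℝ, E n))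
      (n := ∞) x)
    set e := chartAt (E n) x with hedef
    have hxe : x ∈ e.source := mem_chart_source _ x
    have hs := (mem_symm_trans_source (i := i) (e := e) hx).2 hxe
    have h1 := hc.symm.contMDiffAt (e.map_source hxe)
    rw [← symm_trans_apply (i := i) hx] at h1
    refine (ContMDiffAt.congr_of_eventuallyEq (h1.comp (i x) (he.contMDiffAt hs))
      ?_).contMDiffWithinAt
    filter_upwards [(i.symm ≫ₕ e).open_source.mem_nhds hs] with w hw
    rw [OpenPartialHomeomorph.trans_source] at hw
    simp [e.left_inv hw.2]

end Generic

section Overlap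

variable {n : ℕ} {M N : Type*} [TopologicalSpace M] [TopologicalSpace N]
  {φ : OpenPartialHomeomorph M (E n)} {ψ : OpenPartialHomeomorph N (E n)} {ε : ℝ}
  [Nonempty (ConnSum φ ψ ε)] [T2Space M] [T2Space N]

theorem readsAs_leftIncl (hε : 0 < ε) (hφ : φ.target = Metric.ball 0 (2 * ε))
    (hψ : ψ.target = Metric.ball 0 (2 * ε)) :
    ReadsAs (leftIncl hε hφ hψ) (glueChart hε hφ hψ) (outerChart φ hε) := fun _ hx hk =>
  ⟨by rwa [outerChart_source, ← leftIncl_mem_glueChart_source hε hφ hψ hx],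
    glueChart_leftIncl hε hφ hψ hx⟩

theorem readsAs_rightIncl (hε : 0 < ε) (hφ : φ.target = Metric.ball 0 (2 * ε))
    (hψ : ψ.target = Metric.ball 0 (2 * ε)) :
    ReadsAs (rightIncl hε hφ hψ) (glueChart hε hφ hψ) (innerChart ψ hε) := fun y hy hk => by
  rw [rightIncl_mem_glueChart_source hε hφ hψ hy] at hk
  exact ⟨(mem_innerChart_source ψ hε).2
    ⟨hk, ne_zero_of_notMem_chartBall hε (notMem_chartBall_of_notMem_closed hy) hk⟩,
    glueChart_rightIncl hε hφ hψ hy⟩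

end Overlap

theorem smoothTransition_of_disjoint {n : ℕ} {X : Type*} [TopologicalSpace X]
    {e e' : OpenPartialHomeomorph X (E n)} (h : Disjoint e.source e'.source) :
    SmoothTransition e e' :=
  smoothTransition_iff.2 fun _ hx hx' => (Set.disjoint_left.1 h hx hx').elim

section Existence

variable {n : ℕ} {M N : Type*} [TopologicalSpace M] [TopologicalSpace N]
  [ChartedSpace (E n) M] [IsManifold 𝓘(ℝ, E n) ∞ M]
  [ChartedSpace (E n) N] [IsManifold 𝓘(ℝ, E n) ∞ N]
  {φ : OpenPartialHomeomorph M (E n)} {ψ : OpenPartialHomeomorph N (E n)} {ε : ℝ}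
  [Nonempty (ConnSum φ ψ ε)] [T2Space M] [T2Space N]

/-- Charts coming from `M` and from `N` have disjoint domains. Every other change of distinct kinds
of charts can be read on a single summand, where the gluing chart is `outerChart φ` or `innerChart
ψ`, a smooth chart of that summand. -/
theorem isManifold_connSum (hε : 0 < ε) (hφ : φ.target = Metric.ball 0 (2 * ε))
    (hψ : ψ.target = Metric.ball 0 (2 * ε)) (hφs : φ ∈ smoothCharts n M)
    (hψs : ψ ∈ smoothCharts n N) :
    letI := connSumChartedSpace hε hφ hψ
    IsManifold 𝓘(ℝ, E n) ∞ (ConnSum φ ψ ε) := by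
  let _ := connSumChartedSpace hε hφ hψ
  have hφ' : outerChart φ hε ∈ smoothCharts n M :=
    mem_smoothCharts_iff.2 (smoothIso_outerChart hε (mem_smoothCharts_iff.1 hφs))
  have hψ' : innerChart ψ hε ∈ smoothCharts n N :=
    mem_smoothCharts_iff.2 (smoothIso_innerChart hε (mem_smoothCharts_iff.1 hψs))
  have hA : ∀ e ∈ atlas (E n) M, e ∈ smoothCharts n M := fun e he =>
    IsManifold.subset_maximalAtlas he
  have hB : ∀ e ∈ atlas (E n) N, e ∈ smoothCharts n N := fun e he =>
    IsManifold.subset_maximalAtlas he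
  have hL := readsAs_leftIncl (ψ := ψ) hε hφ hψ
  have hR := readsAs_rightIncl (φ := φ) hε hφ hψ
  refine isManifold_of_contDiffOn _ _ _ fun e e' he he' => ?_
  suffices h : SmoothTransition e e' by
    simpa [SmoothTransition] using h
  rcases he with (⟨e, he, rfl⟩ | ⟨e, he, rfl⟩) | rfl <;>
    rcases he' with (⟨e', he', rfl⟩ | ⟨e', he', rfl⟩) | rfl
  · exact smoothTransition_symm_trans (hA _ he) (hA _ he')
  · exact smoothTransition_of_disjoint (disjoint_left_right hε hφ hψ _ _)
  · exact hL.smoothTransition_left hφ' (hA _ he)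
  · exact smoothTransition_of_disjoint (disjoint_left_right hε hφ hψ _ _).symm
  · exact smoothTransition_symm_trans (hB _ he) (hB _ he')
  · exact hR.smoothTransition_left hψ' (hB _ he)
  · exact hL.smoothTransition_right hφ' (hA _ he')
  · exact hR.smoothTransition_right hψ' (hB _ he')
  · refine smoothTransition_iff.2 fun x hx _ => ?_
    refine contDiffAt_id.congr_of_eventuallyEq ?_
    filter_upwards [(glueChart hε hφ hψ).open_target.mem_nhds
      ((glueChart hε hφ hψ).map_source hx)] with y hy using (glueChart hε hφ hψ).right_inv hy

theorem exists_gluingMaps (hε : 0 < ε) (hφ : φ.target = Metric.ball 0 (2 * ε))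
    (hψ : ψ.target = Metric.ball 0 (2 * ε)) (hφs : φ ∈ smoothCharts n M)
    (hψs : ψ ∈ smoothCharts n N) :
    ∃ (_ : ChartedSpace (E n) (ConnSum φ ψ ε))
      (_ : IsManifold 𝓘(ℝ, E n) ∞ (ConnSum φ ψ ε)), Nonempty (GluingMaps φ ψ ε) := by
  let _ := connSumChartedSpace hε hφ hψ
  have hm : IsManifold 𝓘(ℝ, E n) ∞ (ConnSum φ ψ ε) := isManifold_connSum hε hφ hψ hφs hψs
  have hL : SmoothIso (n := n) (leftIncl (φ := φ) (ψ := ψ) hε hφ hψ) :=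
    smoothIso_of_symm_trans_mem fun e he =>
      IsManifold.subset_maximalAtlas (.inl (.inl ⟨e, he, rfl⟩))
  have hR : SmoothIso (n := n) (rightIncl (φ := φ) (ψ := ψ) hε hφ hψ) :=
    smoothIso_of_symm_trans_mem fun e he =>
      IsManifold.subset_maximalAtlas (.inl (.inr ⟨e, he, rfl⟩))
  exact ⟨_, hm, ⟨{
    inM := leftIncl hε hφ hψ
    inM_source := rfl
    inM_apply := fun x _ => fromLeft_of_notMem x.2
    inM_smooth := hL.smooth
    inM_symm_smooth := hL.smooth_symm
    inN := rightIncl hε hφ hψ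
    inN_source := rfl
    inN_apply := fun y _ => fromRight_of_notMem y.2
    inN_smooth := hR.smooth
    inN_symm_smooth := hR.smooth_symm
    glue := glueChart hε hφ hψ
    glue_source := setOf_abs_height_lt hε
    glue_apply := fun a _ => rfl
    glue_target := rfl
    glue_mem := IsManifold.subset_maximalAtlas (.inr rfl) }⟩⟩

end Existence

/-! ### Linearizing a germ by a diffeomorphism of `ℝⁿ` that is the identity far away -/

section EuclideanDiffeo

variable {n : ℕ}

/-- A permutation of `ℝⁿ` that is a diffeomorphism. -/
structure IsDiffeo (f : Equiv.Perm (E n)) : Prop where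
  smooth : ContDiff ℝ ∞ f
  smooth_symm : ContDiff ℝ ∞ f.symm

theorem IsDiffeo.symm {f : Equiv.Perm (E n)} (hf : IsDiffeo f) : IsDiffeo f.symm := ⟨hf.2, hf.1⟩

theorem IsDiffeo.mul {f h : Equiv.Perm (E n)} (hf : IsDiffeo f) (hh : IsDiffeo h) :
    IsDiffeo (f * h) := ⟨hf.1.comp hh.1, hh.2.comp hf.2⟩

theorem isDiffeo_one : IsDiffeo (1 : Equiv.Perm (E n)) := ⟨contDiff_id, contDiff_id⟩

theorem IsDiffeo.pow {f : Equiv.Perm (E n)} (hf : IsDiffeo f) (j : ℕ) : IsDiffeo (f ^ j) := by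
  induction j with
  | zero => exact isDiffeo_one
  | succ j ih => rw [pow_succ]; exact ih.mul hf

/-- A small Lipschitz perturbation of the identity is a diffeomorphism. -/
theorem exists_isDiffeo_id_add {u : E n → E n} (hu : ContDiff ℝ ∞ u)
    (hl : LipschitzWith (1 / 2) u) : ∃ f : Equiv.Perm (E n), IsDiffeo f ∧ ∀ x, f x = x + u x := by
  -- The Lipschitz constant `1 / 2` is less than `1`, the inverse of the norm of the inverse of the
  -- identity; this makes `x + u x` a global homeomorphism.
  have happ : ApproximatesLinearOn (fun x => x + u x)
      ((ContinuousLinearEquiv.refl ℝ (E n) : E n ≃L[ℝ] E n) : E n →L[ℝ] E n) Set.univ (1 / 2) := by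
    intro x _ y _
    have h := hl.dist_le_mul x y
    rw [dist_eq_norm, dist_eq_norm] at h
    change ‖x + u x - (y + u y) - (x - y)‖ ≤ _
    rwa [show x + u x - (y + u y) - (x - y) = u x - u y by abel]
  have hc : Subsingleton (E n) ∨ (1 / 2 : NNReal) <
      ‖((ContinuousLinearEquiv.refl ℝ (E n)).symm : E n →L[ℝ] E n)‖₊⁻¹ := by
    rcases subsingleton_or_nontrivial (E n) with h | h
    · exact .inl h
    · right
      have : ‖((ContinuousLinearEquiv.refl ℝ (E n)).symm : E n →L[ℝ] E n)‖₊ = 1 :=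
        NNReal.eq ContinuousLinearMap.norm_id
      rw [this, inv_one]
      exact NNReal.half_lt_self one_ne_zero
  have hs : ContDiff ℝ ∞ (fun x => x + u x) := contDiff_id.add hu
  refine ⟨(happ.toHomeomorph _ hc).toEquiv, ⟨hs, ?_⟩, fun x => rfl⟩
  rw [contDiff_iff_contDiffAt]
  intro y
  set H := (happ.toHomeomorph _ hc).toOpenPartialHomeomorph
  set x := H.symm y
  -- By the Neumann series `1 + du` is then invertible, and the inverse function theorem gives
  -- smoothness of the inverse.
  have hdu : ‖-fderiv ℝ u x‖ < 1 := by
    rw [norm_neg]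
    refine (norm_fderiv_le_of_lipschitz ℝ hl).trans_lt ?_
    norm_num
  have hd : HasFDerivAt H
      ((ContinuousLinearEquiv.unitsEquiv ℝ (E n) (Units.oneSub _ hdu) : E n ≃L[ℝ] E n) :
        E n →L[ℝ] E n) x := by
    have h1 : HasFDerivAt (fun x => x + u x) (ContinuousLinearMap.id ℝ (E n) + fderiv ℝ u x) x :=
      (hasFDerivAt_id x).add ((hu.differentiable (by simp)) x).hasFDerivAt
    have h2 : ((ContinuousLinearEquiv.unitsEquiv ℝ (E n) (Units.oneSub _ hdu) : E n ≃L[ℝ] E n) :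
        E n →L[ℝ] E n) = ContinuousLinearMap.id ℝ (E n) + fderiv ℝ u x := by
      ext1 v
      change (1 - -fderiv ℝ u x) v = _
      simp
    rw [h2]
    exact h1
  exact H.contDiffAt_symm (Set.mem_univ y) hd hs.contDiffAt

/-- A diffeomorphism that is a dilation near the origin and the identity far away. -/
theorem exists_isDiffeo_dilation {a b : ℝ} (ha : 0 < a) (hab : a < b) :
    ∃ s : ℝ, 1 < s ∧ ∃ f : Equiv.Perm (E n), IsDiffeo f ∧ (∀ x, ‖x‖ ≤ a → f x = s • x) ∧
      ∀ x, b ≤ ‖x‖ → f x = x := by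
  let η : ContDiffBump (0 : E n) := ⟨a, b, ha, hab⟩
  have hu : ContDiff ℝ ∞ (fun x : E n => η x • x) := η.contDiff.smul contDiff_id
  have hs : HasCompactSupport (fun x : E n => η x • x) := η.hasCompactSupport.smul_right
  obtain ⟨C, hC⟩ := ContDiff.lipschitzWith_of_hasCompactSupport hs hu (by simp)
  -- The perturbation `t • η x • x` is Lipschitz with constant `t * C ≤ 1 / 2`; the `+ 1` covers `C
  -- = 0`. The resulting ratio `1 + t` may be close to `1`, which is why powers of this map are
  -- taken later.
  set t : ℝ := 1 / (2 * (C + 1)) with ht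
  have hC0 : (0 : ℝ) ≤ C := C.2
  have ht0 : 0 < t := by positivity
  have hl : LipschitzWith (1 / 2) (fun x : E n => t • η x • x) := by
    refine LipschitzWith.of_dist_le_mul fun x y => ?_
    have h := hC.dist_le_mul x y
    rw [dist_smul₀, Real.norm_of_nonneg ht0.le]
    have h1 : t * C ≤ 1 / 2 := by
      rw [ht, div_mul_eq_mul_div, div_le_div_iff₀ (by positivity) two_pos]
      linarith
    have h2 := mul_le_mul_of_nonneg_right h1 (dist_nonneg (x := x) (y := y))
    have h3 := mul_le_mul_of_nonneg_left h ht0.le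
    rw [← mul_assoc] at h3
    push_cast
    exact h3.trans h2
  obtain ⟨f, hf, hfx⟩ := exists_isDiffeo_id_add (hu.const_smul t) hl
  refine ⟨1 + t, by linarith, f, hf, fun x hx => ?_, fun x hx => ?_⟩
  · rw [hfx, η.one_of_mem_closedBall (by simpa using hx), one_smul, add_smul, one_smul]
  · rw [hfx, η.zero_of_le_dist (by simpa using hx), zero_smul, smul_zero, add_zero]

/-- Since `s > 1`, the bound on the last iterate keeps all the earlier ones in the ball where `f` is
the dilation. -/
theorem pow_apply_of_smul {f : Equiv.Perm (E n)} {a s : ℝ} (hs : 1 < s)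
    (hf : ∀ x, ‖x‖ ≤ a → f x = s • x) (j : ℕ) {x : E n} (hx : s ^ j * ‖x‖ ≤ a) :
    (f ^ j) x = s ^ j • x := by
  induction j with
  | zero => simp
  | succ j ih =>
    have h0 : 0 ≤ s ^ j * ‖x‖ := by positivity
    have h1 : s ^ j * ‖x‖ ≤ a := by
      refine le_trans ?_ hx
      rw [pow_succ, mul_right_comm]
      exact le_mul_of_one_le_right h0 hs.le
    rw [pow_succ', Equiv.Perm.mul_apply, ih h1, hf, smul_smul, pow_succ']
    rwa [norm_smul, Real.norm_of_nonneg (by positivity)]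

theorem pow_apply_of_fixed {f : Equiv.Perm (E n)} {x : E n} (hf : f x = x) (j : ℕ) :
    (f ^ j) x = x := by
  induction j with
  | zero => rfl
  | succ j ih => rw [pow_succ, Equiv.Perm.mul_apply, hf, ih]

/-- A germ at the origin that is tangent to the identity extends to a diffeomorphism of `ℝⁿ` with
small support. -/
theorem exists_isDiffeo_extending_germ {k : E n → E n} {U : Set (E n)} (hU : IsOpen U)
    (h0 : (0 : E n) ∈ U) (hk : ContDiffOn ℝ ∞ k U) (hk0 : k 0 = 0)
    (hdk : fderiv ℝ k 0 = ContinuousLinearMap.id ℝ (E n)) {R : ℝ} (hR : 0 < R) :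
    ∃ r > (0 : ℝ), ∃ f : Equiv.Perm (E n), IsDiffeo f ∧ (∀ x, ‖x‖ ≤ r → f x = k x) ∧
      ∀ x, R ≤ ‖x‖ → f x = x := by
  let η : ContDiffBump (0 : E n) := ⟨1 / 2, 1, by norm_num, by norm_num⟩
  obtain ⟨C, hC⟩ := ContDiff.lipschitzWith_of_hasCompactSupport η.hasCompactSupport
    (η.contDiff (n := ⊤)) (by simp)
  have hC0 : (0 : ℝ) ≤ C := C.2
  -- With `k - id` Lipschitz of constant `δ` on the ball of radius `r`, the cutoff `η (x / r)`
  -- contributes `(C / r) * (δ * r)` and the factor `k x - x` contributes `δ`. The sum `δ * (C + 1)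
  -- = 1 / 2` does not depend on `r`.
  set δ : NNReal := 1 / (2 * (C + 1)) with hδ
  have hδ0 : 0 < δ := by positivity
  have hkat : ContDiffAt ℝ ∞ k 0 := hk.contDiffAt (hU.mem_nhds h0)
  -- A strict derivative equal to zero makes `k - id` Lipschitz with arbitrarily small constant near
  -- the origin.
  have hstr : HasStrictFDerivAt (fun x => k x - x) (0 : E n →L[ℝ] E n) 0 := by
    have := (hkat.hasStrictFDerivAt (by simp)).sub (hasStrictFDerivAt_id (0 : E n))
    rwa [hdk, sub_self] at this
  obtain ⟨V, hV, hVl⟩ := hstr.exists_lipschitzOnWith_of_nnnorm_lt δ (by simpa using hδ0)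
  obtain ⟨r₁, hr₁, hball⟩ := Metric.mem_nhds_iff.1 (Filter.inter_mem hV (hU.mem_nhds h0))
  set r : ℝ := min (r₁ / 2) R with hr
  have hr0 : 0 < r := by positivity
  have hrr : ∀ x : E n, ‖x‖ ≤ r → x ∈ V ∧ x ∈ U := fun x hx =>
    hball (by
      rw [mem_ball_zero_iff]
      exact hx.trans_lt ((min_le_left _ _).trans_lt (by linarith)))
  set u : E n → E n := fun x => η (r⁻¹ • x) • (k x - x) with hu
  have hηz : ∀ x : E n, r ≤ ‖x‖ → η (r⁻¹ • x) = 0 := fun x hx => η.zero_of_le_dist (by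
    rw [dist_zero_right, norm_smul, Real.norm_of_nonneg (by positivity), ← div_eq_inv_mul]
    exact (one_le_div hr0).2 hx)
  have hus : ContDiff ℝ ∞ u := by
    rw [contDiff_iff_contDiffAt]
    intro x
    have hηs : ContDiff ℝ ∞ fun x : E n => η (r⁻¹ • x) :=
      η.contDiff.comp (contDiff_const_smul r⁻¹)
    by_cases hx : ‖x‖ ≤ r
    · exact hηs.contDiffAt.smul
        ((hk.contDiffAt (hU.mem_nhds (hrr x hx).2)).sub contDiffAt_id)
    · refine (contDiffAt_const (c := (0 : E n))).congr_of_eventuallyEq ?_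
      filter_upwards [(isOpen_lt continuous_const continuous_norm).mem_nhds (not_le.1 hx)]
        with y hy
      rw [hu]
      simp only
      rw [hηz y (le_of_lt hy), zero_smul]
  have hw : ∀ x : E n, ‖x‖ ≤ r → ‖k x - x‖ ≤ δ * r := by
    intro x hx
    have h := hVl.dist_le_mul x (hrr x hx).1 0 (hrr 0 (by simpa using hr0.le)).1
    simp only [hk0, sub_zero, dist_zero_right] at h
    exact h.trans (by gcongr)
  have hη1 : ∀ x y : E n, |η (r⁻¹ • x) - η (r⁻¹ • y)| ≤ C / r * dist x y := by
    intro x y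
    have h := hC.dist_le_mul (r⁻¹ • x) (r⁻¹ • y)
    rw [dist_smul₀, Real.norm_of_nonneg (by positivity), Real.dist_eq] at h
    rw [div_eq_mul_inv, mul_assoc]
    exact h
  -- Only one point needs to lie in the ball: in the splitting below, `k y - y` is multiplied by `η
  -- (y / r)`, which vanishes when `y` is outside.
  have key : ∀ x y : E n, ‖x‖ ≤ r → dist (u x) (u y) ≤ 1 / 2 * dist x y := by
    intro x y hx
    have hsplit : u x - u y = (η (r⁻¹ • x) - η (r⁻¹ • y)) • (k x - x) +
        η (r⁻¹ • y) • ((k x - x) - (k y - y)) := by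
      simp only [hu]; module
    have h1 : ‖(η (r⁻¹ • x) - η (r⁻¹ • y)) • (k x - x)‖ ≤ C / r * dist x y * (δ * r) := by
      rw [norm_smul, Real.norm_eq_abs]
      exact mul_le_mul (hη1 x y) (hw x hx) (norm_nonneg _) (by positivity)
    have h2 : ‖η (r⁻¹ • y) • ((k x - x) - (k y - y))‖ ≤ δ * dist x y := by
      by_cases hy : ‖y‖ ≤ r
      · rw [norm_smul, Real.norm_of_nonneg η.nonneg]
        have h3 := hVl.dist_le_mul x (hrr x hx).1 y (hrr y hy).1
        rw [dist_eq_norm] at h3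
        calc _ ≤ 1 * ‖(k x - x) - (k y - y)‖ := by gcongr; exact η.le_one
          _ ≤ _ := by rw [one_mul]; exact h3
      · rw [hηz y (not_le.1 hy).le, zero_smul, norm_zero]
        positivity
    rw [dist_eq_norm (u x), hsplit]
    refine (norm_add_le _ _).trans ((add_le_add h1 h2).trans (le_of_eq ?_))
    have hδ' : (δ : ℝ) = 1 / (2 * (C + 1)) := by rw [hδ]; push_cast; rfl
    rw [hδ']
    have : (C : ℝ) + 1 ≠ 0 := by positivity
    field_simp
  have hl : LipschitzWith (1 / 2) u := by
    refine LipschitzWith.of_dist_le_mul fun x y => ?_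
    push_cast
    by_cases hx : ‖x‖ ≤ r
    · exact key x y hx
    · by_cases hy : ‖y‖ ≤ r
      · rw [dist_comm, dist_comm x y]; exact key y x hy
      · have : u x = u y := by
          simp only [hu, hηz x (not_le.1 hx).le, hηz y (not_le.1 hy).le, zero_smul]
        rw [this, dist_self]
        positivity
  obtain ⟨f, hf, hfx⟩ := exists_isDiffeo_id_add hus hl
  refine ⟨r / 2, by positivity, f, hf, fun x hx => ?_, fun x hx => ?_⟩
  · have : η (r⁻¹ • x) = 1 := η.one_of_mem_closedBall (by
      rw [mem_closedBall_zero_iff, norm_smul, Real.norm_of_nonneg (by positivity),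
        ← div_eq_inv_mul, div_le_iff₀ hr0]
      change ‖x‖ ≤ 1 / 2 * r
      linarith)
    rw [hfx]
    simp [hu, this]
  · rw [hfx]
    simp [hu, hηz x ((min_le_right _ _).trans hx)]

/-- A diffeomorphism, equal to the identity outside a ball of radius `b`, whose inverse followed
by the germ `k` is a homothety on the ball of radius `a < b`. -/
theorem exists_isDiffeo_linearizing {k : E n → E n} {U : Set (E n)} (hU : IsOpen U)
    (h0 : (0 : E n) ∈ U) (hk : ContDiffOn ℝ ∞ k U) (hk0 : k 0 = 0)
    (hdk : fderiv ℝ k 0 = ContinuousLinearMap.id ℝ (E n)) {a b : ℝ} (ha : 0 < a) (hab : a < b) :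
    ∃ c > (0 : ℝ), ∃ f : Equiv.Perm (E n), IsDiffeo f ∧ (∀ x, b ≤ ‖x‖ → f x = x) ∧
      ∀ y, ‖y‖ < a → f y ∈ U ∧ y = c • k (f y) := by
  obtain ⟨s, hs, S, hS, hSa, hSb⟩ := exists_isDiffeo_dilation (n := n) ha hab
  obtain ⟨r, hr, K, hK, hKr, hKb⟩ := exists_isDiffeo_extending_germ hU h0 hk hk0 hdk
    (ha.trans hab)
  have hK0 : K.symm 0 = 0 := by
    rw [Equiv.symm_apply_eq, hKr 0 (by simpa using hr.le), hk0]
  have hnb : U ∩ Metric.ball 0 r ∈ 𝓝 (K.symm 0) := by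
    rw [hK0]
    exact Filter.inter_mem (hU.mem_nhds h0) (Metric.ball_mem_nhds 0 hr)
  obtain ⟨d, hd, hball⟩ := Metric.mem_nhds_iff.1
    (hK.smooth_symm.continuous.continuousAt.preimage_mem_nhds hnb)
  -- The inverse of `S ^ j * K` shrinks the ball of radius `a` by `s ^ j` and then applies `K⁻¹`.
  -- The power is large enough for the shrunk ball to have radius less than `d`, so that `K⁻¹` maps
  -- it to where `K` equals `k`.
  obtain ⟨j, hj⟩ := pow_unbounded_of_one_lt (a / d) hs
  have hsj : 0 < s ^ j := by positivity
  refine ⟨s ^ j, hsj, ((S ^ j) * K).symm, ((hS.pow j).mul hK).symm, fun x hx => ?_,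
    fun y hy => ?_⟩
  · rw [Equiv.symm_apply_eq, Equiv.Perm.mul_apply, hKb x hx, pow_apply_of_fixed (hSb x hx)]
  · have h1 : (S ^ j).symm y = (s ^ j)⁻¹ • y := by
      rw [Equiv.symm_apply_eq, pow_apply_of_smul hs hSa, smul_inv_smul₀ hsj.ne']
      rw [norm_smul, Real.norm_of_nonneg (by positivity), mul_inv_cancel_left₀ hsj.ne']
      exact hy.le
    have h2 : ((S ^ j) * K).symm y = K.symm ((s ^ j)⁻¹ • y) := by
      rw [← h1]; rfl
    have h3 : (s ^ j)⁻¹ • y ∈ Metric.ball (0 : E n) d := by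
      rw [mem_ball_zero_iff, norm_smul, Real.norm_of_nonneg (by positivity), ← div_eq_inv_mul,
        div_lt_iff₀ hsj]
      rw [div_lt_iff₀ hd] at hj
      linarith
    have h4 := hball h3
    rw [h2]
    refine ⟨h4.1, ?_⟩
    rw [← hKr _ (le_of_lt (by simpa using h4.2)), Equiv.apply_symm_apply, smul_inv_smul₀ hsj.ne']

end EuclideanDiffeo

/-! ### Transplanting the linearization to a manifold -/

section Extension

variable {n : ℕ} {M : Type*} [TopologicalSpace M] {φ : OpenPartialHomeomorph M (E n)}

/-- The extension to `M` by the identity of a map of `ℝⁿ` read in the chart `φ`. -/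
noncomputable def extendMap (φ : OpenPartialHomeomorph M (E n)) (f : E n → E n) (x : M) : M :=
  open Classical in if x ∈ φ.source then φ.symm (f (φ x)) else x

theorem extendMap_of_mem {f : E n → E n} {x : M} (hx : x ∈ φ.source) :
    extendMap φ f x = φ.symm (f (φ x)) := if_pos hx

theorem extendMap_of_notMem {f : E n → E n} {x : M} (hx : x ∉ φ.source) :
    extendMap φ f x = x := if_neg hx

theorem extendMap_of_fixed {f : E n → E n} {x : M} (hx : f (φ x) = φ x) :
    extendMap φ f x = x := by
  by_cases h : x ∈ φ.source
  · rw [extendMap_of_mem h, hx, φ.left_inv h]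
  · exact extendMap_of_notMem h

/-- If `f x` left the ball it would be a fixed point of `f`, and injectivity would force `f x = x`.
-/
theorem mapsTo_ball_of_fixed {f : Equiv.Perm (E n)} {b r : ℝ} (hbr : b ≤ r)
    (hf : ∀ x, b ≤ ‖x‖ → f x = x) {x : E n} (hx : x ∈ Metric.ball (0 : E n) r) :
    f x ∈ Metric.ball (0 : E n) r := by
  rw [mem_ball_zero_iff] at hx ⊢
  by_contra h
  rw [not_lt] at h
  have := f.injective (hf _ (hbr.trans h))
  rw [this] at h
  exact hx.not_ge h

theorem symm_fixed {f : Equiv.Perm (E n)} {b : ℝ} (hf : ∀ x, b ≤ ‖x‖ → f x = x) (x : E n)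
    (hx : b ≤ ‖x‖) : f.symm x = x := by
  rw [Equiv.symm_apply_eq, hf x hx]

theorem extendMap_symm_extendMap {f : Equiv.Perm (E n)} {b r : ℝ} (hbr : b ≤ r)
    (hφ : φ.target = Metric.ball 0 r) (hf : ∀ x, b ≤ ‖x‖ → f x = x) (x : M) :
    extendMap φ f.symm (extendMap φ f x) = x := by
  by_cases h : x ∈ φ.source
  · have h1 : f (φ x) ∈ φ.target := by
      rw [hφ]; exact mapsTo_ball_of_fixed hbr hf (hφ ▸ φ.map_source h)
    rw [extendMap_of_mem h, extendMap_of_mem (φ.map_target h1), φ.right_inv h1,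
      Equiv.symm_apply_apply, φ.left_inv h]
  · rw [extendMap_of_notMem h, extendMap_of_notMem h]

variable [T2Space M]

/-- The coordinate ball of radius `b` is closed in `M`, and the extended map is the identity off it.
This makes the extension smooth across the boundary of the chart. -/
theorem extendMap_eventuallyEq {f : E n → E n} {b r : ℝ} (hbr : b < r)
    (hφ : φ.target = Metric.ball 0 r) (hf : ∀ x, b ≤ ‖x‖ → f x = x) {x : M}
    (hx : x ∉ φ.source) : extendMap φ f =ᶠ[𝓝 x] id := by
  filter_upwards [(isClosed_chartClosedBall hφ hbr).isOpen_compl.mem_nhds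
    (fun h : x ∈ chartClosedBall φ b => hx h.1)] with y hy
  by_cases h : y ∈ φ.source
  · exact extendMap_of_fixed (hf _ (not_le.1 fun h' => hy ⟨h, h'⟩).le)
  · exact extendMap_of_notMem h

variable [ChartedSpace (E n) M]

theorem contMDiff_extendMap {f : Equiv.Perm (E n)} (hfs : ContDiff ℝ ∞ f) {b r : ℝ} (hbr : b < r)
    (hφs : SmoothIso (n := n) φ) (hφ : φ.target = Metric.ball 0 r)
    (hf : ∀ x, b ≤ ‖x‖ → f x = x) :
    ContMDiff 𝓘(ℝ, E n) 𝓘(ℝ, E n) ∞ (extendMap φ f) := by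
  intro x
  by_cases hx : x ∈ φ.source
  · have h1 : f (φ x) ∈ φ.target := by
      rw [hφ]; exact mapsTo_ball_of_fixed hbr.le hf (hφ ▸ φ.map_source hx)
    have h2 : ContMDiffAt 𝓘(ℝ, E n) 𝓘(ℝ, E n) ∞ (fun y => φ.symm (f (φ y))) x :=
      ContMDiffAt.comp x (g := φ.symm) (f := fun y => f (φ y)) (hφs.symm.contMDiffAt h1)
        (ContMDiffAt.comp x (g := f) hfs.contMDiff.contMDiffAt (hφs.contMDiffAt hx))
    refine h2.congr_of_eventuallyEq ?_
    filter_upwards [φ.open_source.mem_nhds hx] with y hy using extendMap_of_mem hy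
  · exact contMDiffAt_id.congr_of_eventuallyEq (extendMap_eventuallyEq hbr hφ hf hx)

/-- The extension by the identity of a diffeomorphism with support in a small ball. -/
noncomputable def extendDiffeo (φ : OpenPartialHomeomorph M (E n)) {f : Equiv.Perm (E n)}
    (hfs : IsDiffeo f) {b r : ℝ} (hbr : b < r) (hφs : SmoothIso (n := n) φ)
    (hφ : φ.target = Metric.ball 0 r) (hf : ∀ x, b ≤ ‖x‖ → f x = x) : M ≃ₜ M where
  toFun := extendMap φ f
  invFun := extendMap φ f.symm
  left_inv := extendMap_symm_extendMap hbr.le hφ hf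
  right_inv := extendMap_symm_extendMap (f := f.symm) hbr.le hφ (symm_fixed hf)
  continuous_toFun := (contMDiff_extendMap hfs.smooth hbr hφs hφ hf).continuous
  continuous_invFun :=
    (contMDiff_extendMap (f := f.symm) hfs.smooth_symm hbr hφs hφ (symm_fixed hf)).continuous

end Extension

section Linearization

variable {n : ℕ}

/-- A linear map that multiplies the inner product by a constant has a similarity as inverse. -/
theorem exists_similarity_leftInverse {D : E n →L[ℝ] E n} {d : ℝ} (hd : 0 < d)
    (hD : ∀ a b, inner ℝ (D a) (D b) = d * inner ℝ a b) :
    ∃ c > (0 : ℝ), ∃ A : E n ≃ₗᵢ[ℝ] E n, ∀ v, c • A (D v) = v := by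
  have hsd : √d ≠ 0 := (Real.sqrt_pos.2 hd).ne'
  let B : E n →ₗᵢ[ℝ] E n := LinearMap.isometryOfInner ((√d)⁻¹ • (D : E n →ₗ[ℝ] E n)) (by
    intro a b
    simp only [LinearMap.smul_apply, inner_smul_left, inner_smul_right, RCLike.conj_to_real]
    change (√d)⁻¹ * ((√d)⁻¹ * inner ℝ (D a) (D b)) = _
    rw [hD, ← mul_assoc, ← mul_assoc, ← mul_inv, Real.mul_self_sqrt hd.le, inv_mul_cancel₀ hd.ne',
      one_mul])
  let B' := B.toLinearIsometryEquiv rfl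
  refine ⟨(√d)⁻¹, by positivity, B'.symm, fun v => ?_⟩
  have : D v = √d • B' v := by
    change D v = √d • ((√d)⁻¹ • D v)
    rw [smul_inv_smul₀ hsd]
  rw [this, map_smul, LinearIsometryEquiv.symm_apply_apply, inv_smul_smul₀ hsd]

variable {M : Type*} [TopologicalSpace M] [ChartedSpace (E n) M] [T2Space M]

/-- A diffeomorphism of `M`, supported in the domain of `φ`, that turns the chart `e` into a chart
that differs from `φ` by a similarity on the ball of radius `a`. -/
theorem exists_linearizing_diffeo {φ e : OpenPartialHomeomorph M (E n)} {p : M} {a r : ℝ}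
    (ha : 0 < a) (har : a < r) (hφs : SmoothIso (n := n) φ) (hφ : φ.target = Metric.ball 0 r)
    (hp : p ∈ φ.source) (hφp : φ p = 0) (hes : SmoothIso (n := n) e) (hpe : p ∈ e.source)
    {d : ℝ} (hd : 0 < d)
    (hD : ∀ v w, inner ℝ (tderiv (n := n) e p v) (tderiv (n := n) e p w) =
      d * inner ℝ (tderiv (n := n) φ p v) (tderiv (n := n) φ p w)) :
    ∃ F : M ≃ₜ M, SmoothIso (n := n) F.toOpenPartialHomeomorph ∧
      (∀ x ∉ φ.source, F =ᶠ[𝓝 x] id) ∧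
      ∃ c > (0 : ℝ), ∃ A y₀, ∀ x ∈ φ.source, ‖φ x‖ < a →
        F x ∈ e.source ∧ φ x = simMap c A y₀ (e (F x)) := by
  have hφsym : φ.symm 0 = p := by rw [← hφp, φ.left_inv hp]
  have h0t : (0 : E n) ∈ φ.target := by rw [← hφp]; exact φ.map_source hp
  have htr : ∀ v, tderiv (n := n) φ p (tderiv (n := n) φ.symm 0 v) = v := by
    intro v
    have := hφs.tderiv_apply_symm hp v
    rwa [hφp] at this
  have hcomp : fderiv ℝ (fun y => e (φ.symm y)) 0 = tderiv e p ∘L tderiv φ.symm 0 := by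
    rw [← tderiv_eq_fderiv, tderiv_comp (h := e) (f := φ.symm), hφsym]
    · rw [hφsym]; exact hes.mdifferentiableAt hpe
    · exact hφs.symm.mdifferentiableAt h0t
  -- By hypothesis `e ∘ φ⁻¹` has a conformal derivative at the origin; the similarity inverting it
  -- turns the change of charts into the germ `k`, tangent to the identity.
  obtain ⟨c₁, hc₁, A, hA⟩ := exists_similarity_leftInverse (D := tderiv e p ∘L tderiv φ.symm 0) hd
    (by
      intro v w
      simp only [ContinuousLinearMap.comp_apply]
      rw [hD, htr, htr])
  set U : Set (E n) := φ.target ∩ φ.symm ⁻¹' e.source with hU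
  have hUo : IsOpen U := φ.isOpen_inter_preimage_symm e.open_source
  have h0U : (0 : E n) ∈ U := ⟨h0t, by rw [Set.mem_preimage, hφsym]; exact hpe⟩
  set k : E n → E n := fun y => simMap c₁ A (e p) (e (φ.symm y)) with hk
  have htrans : ∀ y ∈ U, ContDiffAt ℝ ∞ (fun y => e (φ.symm y)) y := by
    intro y hy
    rw [← contMDiffAt_iff_contDiffAt]
    exact ContMDiffAt.comp y (g := e) (hes.contMDiffAt hy.2) (hφs.symm.contMDiffAt hy.1)
  have hks : ContDiffOn ℝ ∞ k U := fun y hy =>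
    ((contDiff_simMap c₁ A (e p)).contDiffAt.comp y (htrans y hy)).contDiffWithinAt
  have hk0 : k 0 = 0 := by simp [hk, simMap, hφsym]
  have hdk : fderiv ℝ k 0 = ContinuousLinearMap.id ℝ (E n) := by
    have h1 := ((htrans 0 h0U).differentiableAt (by simp)).hasFDerivAt
    have h2 : HasFDerivAt k (c₁ • ((A : E n →L[ℝ] E n) ∘L
        fderiv ℝ (fun y => e (φ.symm y)) 0)) 0 :=
      ((A : E n →L[ℝ] E n).hasFDerivAt.comp 0 (h1.sub_const (e p))).const_smul c₁
    rw [h2.fderiv, hcomp]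
    ext1 v
    exact hA v
  -- The collar between `b` and `r` leaves room for extending by the identity.
  obtain ⟨b, hab, hbr⟩ := exists_between har
  obtain ⟨c, hc, f, hf, hfb, hfa⟩ := exists_isDiffeo_linearizing hUo h0U hks hk0 hdk ha hab
  refine ⟨extendDiffeo φ hf hbr hφs hφ hfb, ⟨?_, ?_⟩, ?_, c * c₁, by positivity, A, e p, ?_⟩
  · exact (contMDiff_extendMap hf.smooth hbr hφs hφ hfb).contMDiffOn
  · exact (contMDiff_extendMap (f := f.symm) hf.smooth_symm hbr hφs hφ
      (symm_fixed hfb)).contMDiffOn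
  · exact fun x hx => extendMap_eventuallyEq hbr hφ hfb hx
  · intro x hx hxa
    obtain ⟨h1, h2⟩ := hfa _ hxa
    change extendMap φ f x ∈ _ ∧ _ = simMap _ _ _ (e (extendMap φ f x))
    rw [extendMap_of_mem hx]
    refine ⟨h1.2, h2.trans ?_⟩
    simp only [hk, simMap, smul_smul]

end Linearization

/-! ### Transport of orientation, conformality and Möbius relations through an inclusion -/

section Transfer

variable {n : ℕ} {X M : Type*} [TopologicalSpace X] [ChartedSpace (E n) X]
  [TopologicalSpace M] [ChartedSpace (E n) M] {i : OpenPartialHomeomorph M X}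

theorem tderiv_of_eventuallyEq_comp (hi : SmoothIso (n := n) i) {k : OpenPartialHomeomorph X (E n)}
    (hk : SmoothIso (n := n) k) {f : M → E n} {x : M} (hx : x ∈ i.source) (hxk : i x ∈ k.source)
    (h : ∀ᶠ z in 𝓝 x, k (i z) = f z) :
    tderiv (n := n) f x = tderiv k (i x) ∘L tderiv i x := by
  rw [← tderiv_comp (hk.mdifferentiableAt hxk) (hi.mdifferentiableAt hx)]
  exact tderiv_congr (h.mono fun z hz => hz.symm)

/-- Both Jacobians change by the same factor `det (di)`, hence their product by its square, whether
or not `i` preserves an orientation. -/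
theorem det_mul_det_pos_of_comp (hi : SmoothIso (n := n) i)
    {k k' : OpenPartialHomeomorph X (E n)} (hk : SmoothIso (n := n) k)
    (hk' : SmoothIso (n := n) k') {f f' : M → E n} {x : M} (hx : x ∈ i.source)
    (hxk : i x ∈ k.source) (hxk' : i x ∈ k'.source)
    (h : ∀ᶠ z in 𝓝 x, k (i z) = f z) (h' : ∀ᶠ z in 𝓝 x, k' (i z) = f' z)
    (hpos : 0 < (tderiv (n := n) f x).det * (tderiv (n := n) f' x).det) :
    0 < (tderiv (n := n) k (i x)).det * (tderiv (n := n) k' (i x)).det := by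
  rw [tderiv_of_eventuallyEq_comp hi hk hx hxk h, tderiv_of_eventuallyEq_comp hi hk' hx hxk' h',
    det_comp, det_comp] at hpos
  have h2 : 0 < (tderiv (n := n) i x).det ^ 2 := by
    have := hi.det_ne_zero hx
    positivity
  refine pos_of_mul_pos_left (b := (tderiv (n := n) i x).det ^ 2) ?_ h2.le
  linarith

/-- Every tangent vector at `i x` is the image of one at `x`, so both the comparison of the forms
and that of the charts can be evaluated on `M`; the conformal factors multiply. -/
theorem conformalAt_of_comp (hi : SmoothIso (n := n) i) {k : OpenPartialHomeomorph X (E n)}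
    (hk : SmoothIso (n := n) k) {f : M → E n} {x : M} (hx : x ∈ i.source) (hxk : i x ∈ k.source)
    (h : ∀ᶠ z in 𝓝 x, k (i z) = f z) {G : FormField n X} {G' : FormField n M} {c : ℝ} (hc : 0 < c)
    (hG : ∀ v w, G (i x) (tderiv i x v) (tderiv i x w) = c * G' x v w)
    (hf : ConformalAt G' f x) : ConformalAt G k (i x) := by
  obtain ⟨d, hd, hf⟩ := hf
  refine ⟨c * d, by positivity, fun v w => ?_⟩
  have h1 := hG (tderiv i.symm (i x) v) (tderiv i.symm (i x) w)
  rw [hf, tderiv_of_eventuallyEq_comp hi hk hx hxk h] at h1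
  simp only [ContinuousLinearMap.comp_apply, hi.tderiv_apply_symm hx] at h1
  rw [h1, mul_assoc]

end Transfer

section MobiusTransfer

variable {n : ℕ} {X M : Type*} [TopologicalSpace X] [TopologicalSpace M]
  {i : OpenPartialHomeomorph M X}

theorem mobiusAt_of_comp {k k' : X → E n} {f f' : M → E n} {x : M} (hx : x ∈ i.source)
    (h : ∀ᶠ z in 𝓝 x, k (i z) = f z) (h' : ∀ᶠ z in 𝓝 x, k' (i z) = f' z)
    (hm : MobiusAt f f' x) : MobiusAt k k' (i x) := by
  have h1 : MobiusAt (fun z => k (i z)) (fun z => k' (i z)) x := hm.congr h h'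
  have h2 : MobiusAt (fun z => k (i z)) (fun z => k' (i z)) (i.symm (i x)) := by
    rwa [i.left_inv hx]
  have h3 : ∀ᶠ z in 𝓝 (i x), i (i.symm z) = z := by
    filter_upwards [i.open_target.mem_nhds (i.map_source hx)] with z hz using i.right_inv hz
  refine (h2.comp (i.continuousAt_symm (i.map_source hx))).congr ?_ ?_
  · filter_upwards [h3] with z hz
    rw [hz]
  · filter_upwards [h3] with z hz
    rw [hz]

end MobiusTransfer

section RescaledCharts

variable {n : ℕ} {M : Type*} [TopologicalSpace M]
  {φ : OpenPartialHomeomorph M (E n)} {ε : ℝ}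

theorem mobiusAt_outerChart (hε : 0 < ε) {x : M} (hx : x ∈ φ.source) :
    MobiusAt φ (outerChart φ hε) x := by
  have h := mobiusAt_simMap (inv_pos.2 hε) (LinearIsometryEquiv.refl ℝ (E n)) 0 (φ x)
  refine (h.comp (φ.continuousAt hx)).congr .rfl (.of_forall fun z => ?_)
  simp [simMap, outerChart_apply]

theorem mobiusAt_innerChart (hε : 0 < ε) {x : M} (hx : x ∈ (innerChart φ hε).source) :
    MobiusAt φ (innerChart φ hε) x := by
  rw [innerChart, OpenPartialHomeomorph.trans_source] at hx
  have h1 := mobiusAt_outerChart (φ := φ) hε (by rw [← outerChart_source φ hε]; exact hx.1)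
  refine h1.trans ?_
  exact (mobiusAt_invIso hx.2).comp ((outerChart φ hε).continuousAt hx.1)

variable [ChartedSpace (E n) M]

theorem conformalAt_outerChart {G : FormField n M} (hφ : SmoothIso (n := n) φ) (hε : 0 < ε)
    {x : M} (hx : x ∈ φ.source) (h : ConformalAt G φ x) : ConformalAt G (outerChart φ hε) x := by
  have h1 := h.comp (conformalMapAt_simMap (inv_pos.2 hε) (LinearIsometryEquiv.refl ℝ (E n)) 0 (φ x))
    ((contDiff_simMap _ _ _).contDiffAt.differentiableAt (by simp)) (hφ.mdifferentiableAt hx)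
  refine h1.congr (.of_forall fun z => ?_)
  simp [simMap, outerChart_apply]

theorem conformalAt_innerChart {G : FormField n M} (hφ : SmoothIso (n := n) φ) (hε : 0 < ε)
    {x : M} (hx : x ∈ (innerChart φ hε).source) (h : ConformalAt G φ x) :
    ConformalAt G (innerChart φ hε) x := by
  rw [innerChart, OpenPartialHomeomorph.trans_source] at hx
  have h1 := conformalAt_outerChart hφ hε (by rw [← outerChart_source φ hε]; exact hx.1) h
  have h2 := h1.comp (T := invIso n) (conformalMapAt_invIso hx.2) (differentiableAt_invIso hx.2)
    ((smoothIso_outerChart hε hφ).mdifferentiableAt hx.1)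
  exact h2.congr (.of_forall fun z => rfl)

theorem tderiv_outerChart (hφ : SmoothIso (n := n) φ) (hε : 0 < ε) {x : M} (hx : x ∈ φ.source) :
    tderiv (n := n) (outerChart φ hε) x = ε⁻¹ • tderiv φ x := by
  have h1 : HasFDerivAt (fun y : E n => ε⁻¹ • y) (ε⁻¹ • ContinuousLinearMap.id ℝ (E n)) (φ x) :=
    (hasFDerivAt_id (φ x)).const_smul ε⁻¹
  have h2 := tderiv_comp (n := n) (h := fun y : E n => ε⁻¹ • y) (f := φ) (x := x)
    h1.differentiableAt.mdifferentiableAt (hφ.mdifferentiableAt hx)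
  rw [tderiv_eq_fderiv, h1.fderiv] at h2
  refine Eq.trans ?_ (h2.trans ?_)
  · rfl
  · ext1 v
    simp

theorem det_outerChart (hφ : SmoothIso (n := n) φ) (hε : 0 < ε) {x : M} (hx : x ∈ φ.source) :
    ∃ c > (0 : ℝ), (tderiv (n := n) (outerChart φ hε) x).det = c * (tderiv (n := n) φ x).det := by
  refine ⟨ε⁻¹ ^ Module.finrank ℝ (E n), by positivity, ?_⟩
  rw [tderiv_outerChart hφ hε hx, ContinuousLinearMap.det, ContinuousLinearMap.toLinearMap_smul,
    LinearMap.det_smul]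

/-- Rescaling multiplies the Jacobian by a positive number and the inversion by a negative one. -/
theorem det_innerChart (hφ : SmoothIso (n := n) φ) (hε : 0 < ε) {x : M}
    (hx : x ∈ (innerChart φ hε).source) :
    ∃ c < (0 : ℝ), (tderiv (n := n) (innerChart φ hε) x).det = c * (tderiv (n := n) φ x).det := by
  rw [innerChart, OpenPartialHomeomorph.trans_source] at hx
  obtain ⟨c, hc, h⟩ := det_outerChart hφ hε (by rw [← outerChart_source φ hε]; exact hx.1)
  refine ⟨(fderiv ℝ (invIso n) (outerChart φ hε x)).det * c,
    mul_neg_of_neg_of_pos (det_fderiv_invIso hx.2) hc, ?_⟩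
  have h2 := tderiv_comp (n := n) (h := invIso n) (f := outerChart φ hε) (x := x)
    (smoothIso_invIso.mdifferentiableAt hx.2)
    ((smoothIso_outerChart hε hφ).mdifferentiableAt hx.1)
  rw [mul_assoc, ← h, ← tderiv_eq_fderiv, ← det_comp, ← h2]
  rfl

end RescaledCharts

/-! ### Deforming a metric so that an exponential chart becomes conformal on a ball -/

section Pullback

variable {n : ℕ} {X M : Type*} [TopologicalSpace X] [ChartedSpace (E n) X]
  [TopologicalSpace M] [ChartedSpace (E n) M]

theorem pullForm_apply (f : X → M) (G : FormField n M) (x : X) (v w : E n) :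
    pullForm f G x v w = G (f x) (tderiv f x v) (tderiv f x w) := rfl

variable [IsManifold 𝓘(ℝ, E n) ∞ X] [IsManifold 𝓘(ℝ, E n) ∞ M]

/-- The pullback of a Riemannian metric by a diffeomorphism. -/
noncomputable def pullbackMetric (g : RMetric n M) (F : X ≃ₜ M)
    (hF : SmoothIso (n := n) F.toOpenPartialHomeomorph) : RMetric n X :=
  metricOfForm (pullForm F (metricForm g)) (fun _ _ _ => metricForm_symm g _ _ _)
    (fun x _ hv => metricForm_pos g _ (hF.tderiv_ne_zero (Set.mem_univ x) hv))
    (fun x => (smoothFormAt_metricForm g (F x)).pullForm (hF.contMDiffAt (Set.mem_univ x)))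

theorem metricForm_pullbackMetric (g : RMetric n M) (F : X ≃ₜ M)
    (hF : SmoothIso (n := n) F.toOpenPartialHomeomorph) :
    metricForm (pullbackMetric g F hF) = pullForm F (metricForm g) := rfl

theorem isConformalChart_pullback {g : RMetric n M} {F : X ≃ₜ M}
    (hF : SmoothIso (n := n) F.toOpenPartialHomeomorph) {e : OpenPartialHomeomorph M (E n)}
    (he : IsConformalChart g e) :
    IsConformalChart (pullbackMetric g F hF) (F.toOpenPartialHomeomorph ≫ₕ e) := by
  rw [isConformalChart_iff] at he ⊢
  refine ⟨hF.trans he.1, fun x hx => ?_⟩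
  rw [OpenPartialHomeomorph.trans_source] at hx
  rw [metricForm_pullbackMetric]
  exact conformalAt_pullForm (he.1.mdifferentiableAt hx.2) (hF.mdifferentiableAt hx.1)
    (he.2 _ hx.2)

end Pullback

section Deformation

variable {n : ℕ} {M : Type*} [TopologicalSpace M] [ChartedSpace (E n) M]
  [IsManifold 𝓘(ℝ, E n) ∞ M]

/-- At the centre, the derivatives of `φ` and of any conformal chart both express the metric through
the Euclidean product, so they differ by a similarity. This is the first-order agreement needed for
the linearization. -/
theorem IsExpChart.inner_center {g : RMetric n M} {p : M} {r : ℝ}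
    {φ : OpenPartialHomeomorph M (E n)} (hφ : IsExpChart g p r φ) (v w : E n) :
    metricForm g p v w = inner ℝ (tderiv (n := n) φ p v) (tderiv (n := n) φ p w) := by
  have hs := mem_smoothCharts_iff.1 hφ.mem_smoothCharts
  rw [← hφ.isometry_zero]
  change _ = metricForm g (φ.symm 0) (tderiv φ.symm 0 (tderiv φ p v)) (tderiv φ.symm 0 (tderiv φ p w))
  rw [← hφ.map_center, hs.tderiv_symm_apply hφ.mem_source, hs.tderiv_symm_apply hφ.mem_source,
    φ.left_inv hφ.mem_source]

/-- A deformation of the metric inside the domain of an exponential chart `φ` for which `φ` becomes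
conformal, and Möbius compatible with the deformed charts, on a smaller ball. -/
theorem exists_conformal_deformation [T2Space M] {g : RMetric n M} {p : M} {r a : ℝ}
    (ha : 0 < a) (har : a < r) {φ e : OpenPartialHomeomorph M (E n)} (hφ : IsExpChart g p r φ) (he : IsConformalChart g e)
    (hp : p ∈ e.source) :
    ∃ (F : M ≃ₜ M) (hF : SmoothIso (n := n) F.toOpenPartialHomeomorph),
      (∀ x ∉ φ.source, F =ᶠ[𝓝 x] id) ∧
      ∀ x ∈ φ.source, ‖φ x‖ < a → F x ∈ e.source ∧ MobiusAt (fun z => e (F z)) φ x ∧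
        ConformalAt (metricForm (pullbackMetric g F hF)) φ x := by
  have hs := mem_smoothCharts_iff.1 hφ.mem_smoothCharts
  have hec := he
  rw [isConformalChart_iff] at he
  obtain ⟨d, hd, hdd⟩ := he.2 p hp
  -- At `p` the metric is `d` times the Euclidean product read in `e`, and exactly that product read
  -- in `φ`; hence the ratio `d⁻¹`.
  obtain ⟨F, hF, hFid, c, hc, A, y₀, hFe⟩ := exists_linearizing_diffeo ha har hs hφ.target_eq
    hφ.mem_source hφ.map_center he.1 hp (inv_pos.2 hd) (fun v w => by
      rw [← hφ.inner_center, hdd, inv_mul_cancel_left₀ hd.ne'])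
  refine ⟨F, hF, hFid, fun x hx hxa => ?_⟩
  have hFx := (hFe x hx hxa).1
  have hev : ∀ᶠ z in 𝓝 x, φ z = simMap c A y₀ (e (F z)) := by
    filter_upwards [(isOpen_chartBall φ a).mem_nhds ⟨hx, hxa⟩] with z hz
    exact (hFe z hz.1 hz.2).2
  refine ⟨hFx, ?_, ?_⟩
  · have h1 : ContinuousAt (fun z => e (F z)) x :=
      ContinuousAt.comp (f := F) (e.continuousAt hFx) F.continuous.continuousAt
    exact (MobiusAt.comp (f := fun z => e (F z)) (mobiusAt_simMap hc A y₀ (e (F x))) h1).congr .rfl hev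
  -- `F` is an isometry from the pulled back metric to `g`, so `e ∘ F` is conformal for the former,
  -- and `φ` differs from it by a similarity.
  · have h1 := isConformalChart_iff.1 (isConformalChart_pullback hF hec)
    have hxs : x ∈ (F.toOpenPartialHomeomorph ≫ₕ e).source := by
      rw [OpenPartialHomeomorph.trans_source]; exact ⟨Set.mem_univ _, hFx⟩
    have h2 := (h1.2 x hxs).comp (conformalMapAt_simMap hc A y₀ _)
      ((contDiff_simMap c A y₀).contDiffAt.differentiableAt (by simp))
      (h1.1.mdifferentiableAt hxs)
    exact h2.congr hev

end Deformation

/-! ### Domains and overlaps of arbitrary gluing maps -/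

section Gluing

variable {n : ℕ} {M N : Type*} [TopologicalSpace M] [TopologicalSpace N]
  [ChartedSpace (E n) M] [ChartedSpace (E n) N]
  {φ : OpenPartialHomeomorph M (E n)} {ψ : OpenPartialHomeomorph N (E n)} {ε : ℝ}
  [ChartedSpace (E n) (ConnSum φ ψ ε)] (j : GluingMaps φ ψ ε)

theorem GluingMaps.smoothIso_inM : SmoothIso (n := n) j.inM := ⟨j.inM_smooth, j.inM_symm_smooth⟩

theorem GluingMaps.smoothIso_inN : SmoothIso (n := n) j.inN := ⟨j.inN_smooth, j.inN_symm_smooth⟩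

theorem GluingMaps.smoothIso_glue [IsManifold 𝓘(ℝ, E n) ∞ (ConnSum φ ψ ε)] :
    SmoothIso (n := n) j.glue := mem_smoothCharts_iff.1 j.glue_mem

theorem GluingMaps.notMem_chartClosedBall_left {x : M} (hx : x ∈ j.inM.source) :
    x ∉ chartClosedBall φ ε := by
  rwa [j.inM_source] at hx

theorem GluingMaps.notMem_chartClosedBall_right {y : N} (hy : y ∈ j.inN.source) :
    y ∉ chartClosedBall ψ ε := by
  rwa [j.inN_source] at hy

theorem GluingMaps.inM_eq {x : M} (hx : x ∈ j.inM.source) : j.inM x =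
    proj φ ψ ε (Sum.inl ⟨x, notMem_chartBall_of_notMem_closed
      (j.notMem_chartClosedBall_left hx)⟩) :=
  j.inM_apply ⟨x, _⟩ hx

theorem GluingMaps.inN_eq {y : N} (hy : y ∈ j.inN.source) : j.inN y =
    proj φ ψ ε (Sum.inr ⟨y, notMem_chartBall_of_notMem_closed
      (j.notMem_chartClosedBall_right hy)⟩) :=
  j.inN_apply ⟨y, _⟩ hy

/-- The values of the inclusion on its source determine its target. All overlaps of the gluing maps
can therefore be decided by `height`, however the maps were constructed. -/
theorem GluingMaps.mem_inM_target (hε : 0 < ε) {z : ConnSum φ ψ ε} :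
    z ∈ j.inM.target ↔ 0 < height φ ψ ε z := by
  constructor
  · intro hz
    have hx := j.inM.map_target hz
    rw [← j.inM.right_inv hz, j.inM_eq hx]
    exact (height_inl_pos_iff hε _).2 (j.notMem_chartClosedBall_left hx)
  · intro hz
    obtain ⟨x | y, rfl⟩ := proj_surjective z
    · have hx : x.1 ∈ j.inM.source := by
        rw [j.inM_source]
        exact (height_inl_pos_iff hε x).1 hz
      rw [← j.inM_apply x hx]
      exact j.inM.map_source hx
    · exact absurd hz (height_inr_nonpos hε y).not_gt

theorem GluingMaps.mem_inN_target (hε : 0 < ε) {z : ConnSum φ ψ ε} :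
    z ∈ j.inN.target ↔ height φ ψ ε z < 0 := by
  constructor
  · intro hz
    have hx := j.inN.map_target hz
    rw [← j.inN.right_inv hz, j.inN_eq hx]
    exact (height_inr_neg_iff hε _).2 (j.notMem_chartClosedBall_right hx)
  · intro hz
    obtain ⟨x | y, rfl⟩ := proj_surjective z
    · exact absurd hz (height_inl_nonneg hε x).not_gt
    · have hy : y.1 ∈ j.inN.source := by
        rw [j.inN_source]
        exact (height_inr_neg_iff hε y).1 hz
      rw [← j.inN_apply y hy]
      exact j.inN.map_source hy

theorem GluingMaps.mem_glue_source (hε : 0 < ε) {z : ConnSum φ ψ ε} :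
    z ∈ j.glue.source ↔ |height φ ψ ε z| < ε := by
  rw [j.glue_source, ← setOf_abs_height_lt hε]
  rfl

theorem GluingMaps.disjoint_target (hε : 0 < ε) {z : ConnSum φ ψ ε} (hz : z ∈ j.inM.target)
    (hz' : z ∈ j.inN.target) : False := by
  rw [j.mem_inM_target hε] at hz
  rw [j.mem_inN_target hε] at hz'
  linarith

theorem GluingMaps.inM_mem_glue_source (hε : 0 < ε) (hφ : φ.target = Metric.ball 0 (2 * ε)) {x : M}
    (hx : x ∈ j.inM.source) : j.inM x ∈ j.glue.source ↔ x ∈ φ.source := by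
  rw [j.mem_glue_source hε, j.inM_eq hx, ← chartBall_eq_source hφ]
  exact abs_preHeight_lt_iff hε (Sum.inl _)

theorem GluingMaps.inN_mem_glue_source (hε : 0 < ε) (hψ : ψ.target = Metric.ball 0 (2 * ε)) {y : N}
    (hy : y ∈ j.inN.source) : j.inN y ∈ j.glue.source ↔ y ∈ ψ.source := by
  rw [j.mem_glue_source hε, j.inN_eq hy, ← chartBall_eq_source hψ]
  exact abs_preHeight_lt_iff hε (Sum.inr _)

theorem GluingMaps.readsAs_left (hε : 0 < ε) (hφ : φ.target = Metric.ball 0 (2 * ε)) :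
    ReadsAs j.inM j.glue (outerChart φ hε) := fun x hx hk => by
  have hxs := (j.inM_mem_glue_source hε hφ hx).1 hk
  refine ⟨by rwa [outerChart_source], ?_⟩
  rw [j.inM_eq hx, j.glue_apply]
  · rfl
  · change x ∈ chartBall φ (2 * ε)
    rwa [chartBall_eq_source hφ]

theorem GluingMaps.readsAs_right (hε : 0 < ε) (hψ : ψ.target = Metric.ball 0 (2 * ε)) :
    ReadsAs j.inN j.glue (innerChart ψ hε) := fun y hy hk => by
  have hys := (j.inN_mem_glue_source hε hψ hy).1 hk
  refine ⟨(mem_innerChart_source ψ hε).2 ⟨hys, ne_zero_of_notMem_chartBall hε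
    (notMem_chartBall_of_notMem_closed (j.notMem_chartClosedBall_right hy)) hys⟩, ?_⟩
  rw [j.inN_eq hy, j.glue_apply]
  · exact (invIso_apply _).symm
  · change y ∈ chartBall ψ (2 * ε)
    rwa [chartBall_eq_source hψ]

theorem GluingMaps.trichotomy (hε : 0 < ε) (z : ConnSum φ ψ ε) :
    (∃ x ∈ j.inM.source, j.inM x = z) ∨ (∃ y ∈ j.inN.source, j.inN y = z) ∨
      (z ∈ j.glue.source ∧ z ∉ j.inM.target ∧ z ∉ j.inN.target) := by
  rcases lt_trichotomy (height φ ψ ε z) 0 with h | h | h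
  · rw [← j.mem_inN_target hε] at h
    exact .inr (.inl ⟨_, j.inN.map_target h, j.inN.right_inv h⟩)
  · refine .inr (.inr ⟨?_, ?_, ?_⟩)
    · rwa [j.mem_glue_source hε, h, abs_zero]
    · rw [j.mem_inM_target hε, h]
      exact lt_irrefl 0
    · rw [j.mem_inN_target hε, h]
      exact lt_irrefl 0
  · rw [← j.mem_inM_target hε] at h
    exact .inl ⟨_, j.inM.map_target h, j.inM.right_inv h⟩

end Gluing

/-! ### The glued oriented atlas -/

section GluedOrientation

variable {n : ℕ} {M N : Type*} [TopologicalSpace M] [TopologicalSpace N]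
  [ChartedSpace (E n) M] [ChartedSpace (E n) N]
  [IsManifold 𝓘(ℝ, E n) ∞ M] [IsManifold 𝓘(ℝ, E n) ∞ N]
  {φ : OpenPartialHomeomorph M (E n)} {ψ : OpenPartialHomeomorph N (E n)} {ε : ℝ}
  [ChartedSpace (E n) (ConnSum φ ψ ε)] [IsManifold 𝓘(ℝ, E n) ∞ (ConnSum φ ψ ε)]
  (j : GluingMaps φ ψ ε)

/-- On `M` the gluing chart is a positive rescaling of `φ`; on `N` the reversals by `ψ` and by the
inversion cancel. The signs are checked on the summands and transported. -/
theorem isOrientedAtlas_gluedAtlas (hε : 0 < ε) (hφ : φ.target = Metric.ball 0 (2 * ε))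
    (hψ : ψ.target = Metric.ball 0 (2 * ε)) (hφs : φ ∈ smoothCharts n M)
    (hψs : ψ ∈ smoothCharts n N) {A : Set (OpenPartialHomeomorph M (E n))}
    (hA : IsOrientedAtlas A) {B : Set (OpenPartialHomeomorph N (E n))} (hB : IsOrientedAtlas B)
    (hφo : PreservesOrientation A φ) (hψo : ReversesOrientation B ψ) :
    IsOrientedAtlas (gluedAtlas j A B) := by
  rw [mem_smoothCharts_iff] at hφs hψs
  have hAs : ∀ e ∈ A, SmoothIso (n := n) e := fun e he => mem_smoothCharts_iff.1 (hA.subset he)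
  have hBs : ∀ e ∈ B, SmoothIso (n := n) e := fun e he => mem_smoothCharts_iff.1 (hB.subset he)
  have hAj : ∀ e ∈ A, SmoothIso (n := n) (j.inM.symm ≫ₕ e) := fun e he =>
    j.smoothIso_inM.symm.trans (hAs e he)
  have hBj : ∀ e ∈ B, SmoothIso (n := n) (j.inN.symm ≫ₕ e) := fun e he =>
    j.smoothIso_inN.symm.trans (hBs e he)
  have hsub : ∀ k ∈ gluedAtlas j A B, SmoothIso (n := n) k := by
    rintro k ((⟨e, he, rfl⟩ | ⟨e, he, rfl⟩) | rfl)
    · exact hAj e he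
    · exact hBj e he
    · exact j.smoothIso_glue
  have hAA : ∀ e ∈ A, ∀ e' ∈ A, ∀ x ∈ e.source, x ∈ e'.source →
      0 < (tderiv (n := n) e x).det * (tderiv (n := n) e' x).det := by
    intro e he e' he' x hx hx'
    rw [← det_fderiv_transition_pos_iff (hAs e he) (hAs e' he') hx hx']
    exact forall_mem_transition_source.1 (hA.jacobian_pos e he e' he') x hx hx'
  have hBB : ∀ e ∈ B, ∀ e' ∈ B, ∀ x ∈ e.source, x ∈ e'.source →
      0 < (tderiv (n := n) e x).det * (tderiv (n := n) e' x).det := by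
    intro e he e' he' x hx hx'
    rw [← det_fderiv_transition_pos_iff (hBs e he) (hBs e' he') hx hx']
    exact forall_mem_transition_source.1 (hB.jacobian_pos e he e' he') x hx hx'
  have hAφ : ∀ e ∈ A, ∀ x ∈ e.source, x ∈ (outerChart φ hε).source →
      0 < (tderiv (n := n) e x).det * (tderiv (n := n) (outerChart φ hε) x).det := by
    intro e he x hx hx'
    rw [outerChart_source] at hx'
    obtain ⟨c, hc, h⟩ := det_outerChart hφs hε hx'
    have h1 := (det_fderiv_transition_pos_iff (hAs e he) hφs hx hx').1
      (forall_mem_transition_source.1 (hφo e he) x hx hx')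
    rw [h, mul_left_comm]
    positivity
  have hBψ : ∀ e ∈ B, ∀ x ∈ e.source, x ∈ (innerChart ψ hε).source →
      0 < (tderiv (n := n) e x).det * (tderiv (n := n) (innerChart ψ hε) x).det := by
    intro e he x hx hx'
    have hx'' := ((mem_innerChart_source ψ hε).1 hx').1
    obtain ⟨c, hc, h⟩ := det_innerChart hψs hε hx'
    have h1 := (det_fderiv_transition_neg_iff (hBs e he) hψs hx hx'').1
      (forall_mem_transition_source.1 (hψo e he) x hx hx'')
    rw [h, mul_left_comm]
    exact mul_pos_of_neg_of_neg hc h1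
  have hL := j.readsAs_left hε hφ
  have hR := j.readsAs_right hε hψ
  refine ⟨fun k hk => mem_smoothCharts_iff.2 (hsub k hk), fun z => ?_, fun k hk k' hk' => ?_⟩
  · rcases j.trichotomy hε z with ⟨x, hx, rfl⟩ | ⟨y, hy, rfl⟩ | ⟨hz, -, -⟩
    · obtain ⟨e, he, hxe⟩ := hA.cover x
      exact ⟨_, .inl (.inl ⟨e, he, rfl⟩), (mem_symm_trans_source hx).2 hxe⟩
    · obtain ⟨e, he, hye⟩ := hB.cover y
      exact ⟨_, .inl (.inr ⟨e, he, rfl⟩), (mem_symm_trans_source hy).2 hye⟩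
    · exact ⟨_, .inr rfl, hz⟩
  · rw [forall_mem_transition_source]
    intro z hz hz'
    rw [det_fderiv_transition_pos_iff (hsub k hk) (hsub k' hk') hz hz']
    rcases hk with (⟨e, he, rfl⟩ | ⟨e, he, rfl⟩) | rfl <;>
      rcases hk' with (⟨e', he', rfl⟩ | ⟨e', he', rfl⟩) | rfl
    · obtain ⟨x, hi, hx, rfl⟩ := exists_of_mem_symm_trans_source hz
      exact det_mul_det_pos_of_comp j.smoothIso_inM (hAj e he) (hAj e' he') hi hz hz'
        (symm_trans_eventuallyEq hi) (symm_trans_eventuallyEq hi)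
        (hAA e he e' he' x hx ((mem_symm_trans_source hi).1 hz'))
    · exact (j.disjoint_target hε hz.1 hz'.1).elim
    · obtain ⟨x, hi, hx, rfl⟩ := exists_of_mem_symm_trans_source hz
      exact det_mul_det_pos_of_comp j.smoothIso_inM (hAj e he) j.smoothIso_glue hi hz hz'
        (symm_trans_eventuallyEq hi) (hL.eventuallyEq hi hz') (hAφ e he x hx (hL x hi hz').1)
    · exact (j.disjoint_target hε hz'.1 hz.1).elim
    · obtain ⟨x, hi, hx, rfl⟩ := exists_of_mem_symm_trans_source hz
      exact det_mul_det_pos_of_comp j.smoothIso_inN (hBj e he) (hBj e' he') hi hz hz'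
        (symm_trans_eventuallyEq hi) (symm_trans_eventuallyEq hi)
        (hBB e he e' he' x hx ((mem_symm_trans_source hi).1 hz'))
    · obtain ⟨x, hi, hx, rfl⟩ := exists_of_mem_symm_trans_source hz
      exact det_mul_det_pos_of_comp j.smoothIso_inN (hBj e he) j.smoothIso_glue hi hz hz'
        (symm_trans_eventuallyEq hi) (hR.eventuallyEq hi hz') (hBψ e he x hx (hR x hi hz').1)
    · obtain ⟨x, hi, hx, rfl⟩ := exists_of_mem_symm_trans_source hz'
      rw [mul_comm]
      exact det_mul_det_pos_of_comp j.smoothIso_inM (hAj e' he') j.smoothIso_glue hi hz' hz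
        (symm_trans_eventuallyEq hi) (hL.eventuallyEq hi hz) (hAφ e' he' x hx (hL x hi hz).1)
    · obtain ⟨x, hi, hx, rfl⟩ := exists_of_mem_symm_trans_source hz'
      rw [mul_comm]
      exact det_mul_det_pos_of_comp j.smoothIso_inN (hBj e' he') j.smoothIso_glue hi hz' hz
        (symm_trans_eventuallyEq hi) (hR.eventuallyEq hi hz) (hBψ e' he' x hx (hR x hi hz).1)
    · have := j.smoothIso_glue.det_ne_zero hz
      exact mul_self_pos.2 this

end GluedOrientation

/-! ### Glued Möbius atlases -/

section GluedMobius

variable {n : ℕ} {M N : Type*} [TopologicalSpace M] [TopologicalSpace N]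
  [ChartedSpace (E n) M] [ChartedSpace (E n) N]
  [IsManifold 𝓘(ℝ, E n) ∞ M] [IsManifold 𝓘(ℝ, E n) ∞ N]
  {φ : OpenPartialHomeomorph M (E n)} {ψ : OpenPartialHomeomorph N (E n)} {ε : ℝ}
  [ChartedSpace (E n) (ConnSum φ ψ ε)] [IsManifold 𝓘(ℝ, E n) ∞ (ConnSum φ ψ ε)]
  (j : GluingMaps φ ψ ε)

/-- The charts of `M ♯ N` obtained from those of `A` on `M`, those of `B` on `N`, and the chart
`k`. -/
def gluedAtlasWith (A : Set (OpenPartialHomeomorph M (E n)))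
    (B : Set (OpenPartialHomeomorph N (E n))) (k : OpenPartialHomeomorph (ConnSum φ ψ ε) (E n)) :
    Set (OpenPartialHomeomorph (ConnSum φ ψ ε) (E n)) :=
  (fun e => j.inM.symm ≫ₕ e) '' A ∪ (fun e => j.inN.symm ≫ₕ e) '' B ∪ {k}

/-- The chart `k` is left general so that the gluing chart can also be used on a thinner neck, where
alone it is compatible with the deformed charts. It only has to cover the neck sphere and to be
Möbius related, on each summand, to the atlas there. -/
theorem isMobiusAtlas_gluedAtlasWith (hε : 0 < ε)
    {A : Set (OpenPartialHomeomorph M (E n))} (hA : IsMobiusAtlas A)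
    {B : Set (OpenPartialHomeomorph N (E n))} (hB : IsMobiusAtlas B)
    {k : OpenPartialHomeomorph (ConnSum φ ψ ε) (E n)} (hks : SmoothIso (n := n) k)
    (hk : ∀ z, z ∉ j.inM.target → z ∉ j.inN.target → z ∈ k.source)
    {f : OpenPartialHomeomorph M (E n)} {h : OpenPartialHomeomorph N (E n)}
    (hL : ReadsAs j.inM k f) (hR : ReadsAs j.inN k h)
    (hAf : ∀ e ∈ A, ∀ x ∈ j.inM.source, x ∈ e.source → j.inM x ∈ k.source → MobiusAt e f x)
    (hBh : ∀ e ∈ B, ∀ x ∈ j.inN.source, x ∈ e.source → j.inN x ∈ k.source → MobiusAt e h x) :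
    IsMobiusAtlas (gluedAtlasWith j A B k) := by
  have hAA : ∀ e ∈ A, ∀ e' ∈ A, ∀ x ∈ e.source, x ∈ e'.source → MobiusAt e e' x :=
    fun e he e' he' => mobiusCompatible_iff.1 (hA.compatible e he e' he')
  have hBB : ∀ e ∈ B, ∀ e' ∈ B, ∀ x ∈ e.source, x ∈ e'.source → MobiusAt e e' x :=
    fun e he e' he' => mobiusCompatible_iff.1 (hB.compatible e he e' he')
  refine ⟨?_, fun z => ?_, fun c hc c' hc' => ?_⟩
  · rintro c ((⟨e, he, rfl⟩ | ⟨e, he, rfl⟩) | rfl)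
    · exact mem_smoothCharts_iff.2
        (j.smoothIso_inM.symm.trans (mem_smoothCharts_iff.1 (hA.subset he)))
    · exact mem_smoothCharts_iff.2
        (j.smoothIso_inN.symm.trans (mem_smoothCharts_iff.1 (hB.subset he)))
    · exact mem_smoothCharts_iff.2 hks
  · rcases j.trichotomy hε z with ⟨x, hx, rfl⟩ | ⟨y, hy, rfl⟩ | ⟨-, hz, hz'⟩
    · obtain ⟨e, he, hxe⟩ := hA.cover x
      exact ⟨_, .inl (.inl ⟨e, he, rfl⟩), (mem_symm_trans_source hx).2 hxe⟩
    · obtain ⟨e, he, hye⟩ := hB.cover y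
      exact ⟨_, .inl (.inr ⟨e, he, rfl⟩), (mem_symm_trans_source hy).2 hye⟩
    · exact ⟨_, .inr rfl, hk z hz hz'⟩
  · rw [mobiusCompatible_iff]
    intro z hz hz'
    rcases hc with (⟨e, he, rfl⟩ | ⟨e, he, rfl⟩) | rfl <;>
      rcases hc' with (⟨e', he', rfl⟩ | ⟨e', he', rfl⟩) | rfl
    · obtain ⟨x, hi, hx, rfl⟩ := exists_of_mem_symm_trans_source hz
      exact mobiusAt_of_comp hi (symm_trans_eventuallyEq hi) (symm_trans_eventuallyEq hi)
        (hAA e he e' he' x hx ((mem_symm_trans_source hi).1 hz'))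
    · exact (j.disjoint_target hε hz.1 hz'.1).elim
    · obtain ⟨x, hi, hx, rfl⟩ := exists_of_mem_symm_trans_source hz
      exact mobiusAt_of_comp hi (symm_trans_eventuallyEq hi) (hL.eventuallyEq hi hz')
        (hAf e he x hi hx hz')
    · exact (j.disjoint_target hε hz'.1 hz.1).elim
    · obtain ⟨x, hi, hx, rfl⟩ := exists_of_mem_symm_trans_source hz
      exact mobiusAt_of_comp hi (symm_trans_eventuallyEq hi) (symm_trans_eventuallyEq hi)
        (hBB e he e' he' x hx ((mem_symm_trans_source hi).1 hz'))
    · obtain ⟨x, hi, hx, rfl⟩ := exists_of_mem_symm_trans_source hz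
      exact mobiusAt_of_comp hi (symm_trans_eventuallyEq hi) (hR.eventuallyEq hi hz')
        (hBh e he x hi hx hz')
    · obtain ⟨x, hi, hx, rfl⟩ := exists_of_mem_symm_trans_source hz'
      exact (mobiusAt_of_comp hi (symm_trans_eventuallyEq hi) (hL.eventuallyEq hi hz)
        (hAf e' he' x hi hx hz)).symm
    · obtain ⟨x, hi, hx, rfl⟩ := exists_of_mem_symm_trans_source hz'
      exact (mobiusAt_of_comp hi (symm_trans_eventuallyEq hi) (hR.eventuallyEq hi hz)
        (hBh e' he' x hi hx hz)).symm
    · exact MobiusAt.refl _ _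

/-- Möbius gluing charts complete Möbius atlases of the summands to one of the connected sum. -/
theorem isMobiusAtlas_gluedAtlas (hε : 0 < ε) (hφ : φ.target = Metric.ball 0 (2 * ε))
    (hψ : ψ.target = Metric.ball 0 (2 * ε))
    {A : Set (OpenPartialHomeomorph M (E n))} (hA : IsMobiusAtlas A)
    {B : Set (OpenPartialHomeomorph N (E n))} (hB : IsMobiusAtlas B)
    (hAφ : ∀ e ∈ A, MobiusCompatible e φ) (hBψ : ∀ e ∈ B, MobiusCompatible e ψ) :
    IsMobiusAtlas (gluedAtlas j A B) := by
  have hL := j.readsAs_left hε hφ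
  have hR := j.readsAs_right hε hψ
  refine isMobiusAtlas_gluedAtlasWith j hε hA hB j.smoothIso_glue (fun z hz hz' => ?_) hL hR ?_ ?_
  · rcases j.trichotomy hε z with ⟨x, hx, rfl⟩ | ⟨y, hy, rfl⟩ | ⟨h, -, -⟩
    · exact (hz (j.inM.map_source hx)).elim
    · exact (hz' (j.inN.map_source hy)).elim
    · exact h
  · intro e he x hi hx hk
    have hxφ := (j.inM_mem_glue_source hε hφ hi).1 hk
    exact (mobiusCompatible_iff.1 (hAφ e he) x hx hxφ).trans (mobiusAt_outerChart hε hxφ)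
  · intro e he x hi hx hk
    have hxψ := (j.inN_mem_glue_source hε hψ hi).1 hk
    exact (mobiusCompatible_iff.1 (hBψ e he) x hx hxψ).trans
      (mobiusAt_innerChart hε (hR x hi hk).1)

end GluedMobius

/-! ### Cutoff functions and glued metrics -/

section Cutoff

variable {n : ℕ} {M N : Type*} [TopologicalSpace M] [TopologicalSpace N]
  [ChartedSpace (E n) M] [ChartedSpace (E n) N]
  {φ : OpenPartialHomeomorph M (E n)} {ψ : OpenPartialHomeomorph N (E n)} {ε : ℝ}
  [ChartedSpace (E n) (ConnSum φ ψ ε)] {j : GluingMaps φ ψ ε} {χ₁ χ₀ χ₂ : ConnSum φ ψ ε → ℝ}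

theorem IsCutoff.eq_zero_left (hχ : IsCutoff j χ₁ χ₀ χ₂) {z : ConnSum φ ψ ε}
    (hz : z ∉ j.inM.target) : χ₁ z = 0 :=
  image_eq_zero_of_notMem_tsupport fun h => hz (hχ.support₁ h)

theorem IsCutoff.eq_zero_middle (hχ : IsCutoff j χ₁ χ₀ χ₂) {z : ConnSum φ ψ ε}
    (hz : z ∉ j.glue.source) : χ₀ z = 0 :=
  image_eq_zero_of_notMem_tsupport fun h => hz (hχ.support₀ h)

theorem IsCutoff.eq_zero_right (hχ : IsCutoff j χ₁ χ₀ χ₂) {z : ConnSum φ ψ ε}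
    (hz : z ∉ j.inN.target) : χ₂ z = 0 :=
  image_eq_zero_of_notMem_tsupport fun h => hz (hχ.support₂ h)

/-- Cutoff functions exist, the middle one being supported in a given neighbourhood of the neck. -/
theorem exists_isCutoff [IsManifold 𝓘(ℝ, E n) ∞ (ConnSum φ ψ ε)]
    [T2Space (ConnSum φ ψ ε)] [SecondCountableTopology (ConnSum φ ψ ε)]
    (j : GluingMaps φ ψ ε) {W : Set (ConnSum φ ψ ε)} (hWo : IsOpen W) (hW : W ⊆ j.glue.source)
    (hcover : ∀ z, z ∉ j.inM.target → z ∉ j.inN.target → z ∈ W) :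
    ∃ χ₁ χ₀ χ₂ : ConnSum φ ψ ε → ℝ, IsCutoff j χ₁ χ₀ χ₂ ∧ tsupport χ₀ ⊆ W := by
  have : LocallyCompactSpace (ConnSum φ ψ ε) := Manifold.locallyCompact_of_finiteDimensional
    𝓘(ℝ, E n)
  let U : Fin 3 → Set (ConnSum φ ψ ε) := ![j.inM.target, W, j.inN.target]
  obtain ⟨f, hf⟩ := SmoothPartitionOfUnity.exists_isSubordinate 𝓘(ℝ, E n)
    (s := (Set.univ : Set (ConnSum φ ψ ε))) isClosed_univ U (by
      intro i
      fin_cases i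
      · exact j.inM.open_target
      · exact hWo
      · exact j.inN.open_target) (by
      intro z _
      rw [Set.mem_iUnion]
      by_cases h1 : z ∈ j.inM.target
      · exact ⟨0, h1⟩
      by_cases h2 : z ∈ j.inN.target
      · exact ⟨2, h2⟩
      · exact ⟨1, hcover z h1 h2⟩)
  refine ⟨f 0, f 1, f 2, ⟨(f 0).contMDiff, (f 1).contMDiff, (f 2).contMDiff, fun z =>
    ⟨f.nonneg 0 z, f.nonneg 1 z, f.nonneg 2 z⟩, fun z => ?_, hf 0, (hf 1).trans hW, hf 2⟩, hf 1⟩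
  have h := f.sum_eq_one (Set.mem_univ z)
  rwa [finsum_eq_sum_of_fintype, Fin.sum_univ_three] at h

end Cutoff

section GluedMetric

variable {n : ℕ} {M N : Type*} [TopologicalSpace M] [TopologicalSpace N]
  [ChartedSpace (E n) M] [ChartedSpace (E n) N]
  [IsManifold 𝓘(ℝ, E n) ∞ M] [IsManifold 𝓘(ℝ, E n) ∞ N]
  {φ : OpenPartialHomeomorph M (E n)} {ψ : OpenPartialHomeomorph N (E n)} {ε : ℝ}
  [ChartedSpace (E n) (ConnSum φ ψ ε)] [IsManifold 𝓘(ℝ, E n) ∞ (ConnSum φ ψ ε)]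
  {j : GluingMaps φ ψ ε} {gM : RMetric n M} {gN : RMetric n N}
  {χ₁ χ₀ χ₂ : ConnSum φ ψ ε → ℝ} {g : RMetric n (ConnSum φ ψ ε)}

theorem IsGluedMetric.metricForm_eq (hg : IsGluedMetric gM gN j χ₁ χ₀ χ₂ g) (z : ConnSum φ ψ ε)
    (v w : E n) : metricForm g z v w =
      χ₁ z * metricForm gM (j.inM.symm z) (tderiv j.inM.symm z v) (tderiv j.inM.symm z w)
      + χ₀ z * inner ℝ (tderiv (n := n) j.glue z v) (tderiv (n := n) j.glue z w)
      + χ₂ z * metricForm gN (j.inN.symm z) (tderiv j.inN.symm z v) (tderiv j.inN.symm z w) :=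
  hg z v w

theorem IsGluedMetric.left (hε : 0 < ε) (hg : IsGluedMetric gM gN j χ₁ χ₀ χ₂ g)
    (hχ : IsCutoff j χ₁ χ₀ χ₂) {x : M} (hx : x ∈ j.inM.source) (v w : E n) :
    metricForm g (j.inM x) (tderiv j.inM x v) (tderiv j.inM x w) =
      χ₁ (j.inM x) * metricForm gM x v w + χ₀ (j.inM x) *
        inner ℝ (tderiv (n := n) j.glue (j.inM x) (tderiv j.inM x v))
          (tderiv (n := n) j.glue (j.inM x) (tderiv j.inM x w)) := by
  rw [hg.metricForm_eq, hχ.eq_zero_right (fun h => j.disjoint_target hε (j.inM.map_source hx) h),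
    j.smoothIso_inM.tderiv_symm_apply hx, j.smoothIso_inM.tderiv_symm_apply hx,
    j.inM.left_inv hx, zero_mul, add_zero]

theorem IsGluedMetric.right (hε : 0 < ε) (hg : IsGluedMetric gM gN j χ₁ χ₀ χ₂ g)
    (hχ : IsCutoff j χ₁ χ₀ χ₂) {y : N} (hy : y ∈ j.inN.source) (v w : E n) :
    metricForm g (j.inN y) (tderiv j.inN y v) (tderiv j.inN y w) =
      χ₂ (j.inN y) * metricForm gN y v w + χ₀ (j.inN y) *
        inner ℝ (tderiv (n := n) j.glue (j.inN y) (tderiv j.inN y v))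
          (tderiv (n := n) j.glue (j.inN y) (tderiv j.inN y w)) := by
  rw [hg.metricForm_eq, hχ.eq_zero_left (fun h => j.disjoint_target hε h (j.inN.map_source hy)),
    j.smoothIso_inN.tderiv_symm_apply hy, j.smoothIso_inN.tderiv_symm_apply hy,
    j.inN.left_inv hy, zero_mul, zero_add, add_comm]

/-- Any cutoff functions glue the metrics of the summands. -/
theorem exists_isGluedMetric (gM : RMetric n M) (gN : RMetric n N)
    (hχ : IsCutoff j χ₁ χ₀ χ₂) : ∃ g, IsGluedMetric gM gN j χ₁ χ₀ χ₂ g := by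
  let G : FormField n (ConnSum φ ψ ε) := fun z =>
    χ₁ z • pullForm j.inM.symm (metricForm gM) z +
      χ₀ z • pullForm j.glue (fun _ => innerSL ℝ) z +
      χ₂ z • pullForm j.inN.symm (metricForm gN) z
  have hG : ∀ z v w, G z v w =
      χ₁ z * metricForm gM (j.inM.symm z) (tderiv j.inM.symm z v) (tderiv j.inM.symm z w)
      + χ₀ z * inner ℝ (tderiv (n := n) j.glue z v) (tderiv (n := n) j.glue z w)
      + χ₂ z * metricForm gN (j.inN.symm z) (tderiv j.inN.symm z v) (tderiv j.inN.symm z w) :=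
    fun z v w => rfl
  -- All three terms are nonnegative, even where an inverse inclusion has meaningless values. Strict
  -- positivity comes from a cutoff function that does not vanish at `z`: the corresponding map is a
  -- local diffeomorphism there.
  have hnonneg : ∀ z (u : E n), 0 ≤ metricForm gM (j.inM.symm z) u u := fun z u => by
    by_cases hu : u = 0
    · simp [hu]
    · exact (metricForm_pos gM _ hu).le
  have hnonneg' : ∀ z (u : E n), 0 ≤ metricForm gN (j.inN.symm z) u u := fun z u => by
    by_cases hu : u = 0
    · simp [hu]
    · exact (metricForm_pos gN _ hu).le
  refine ⟨metricOfForm G (fun z v w => ?_) (fun z v hv => ?_) (fun z => ?_), fun z v w => ?_⟩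
  · rw [hG, hG, metricForm_symm gM, metricForm_symm gN, real_inner_comm]
  · rw [hG]
    obtain ⟨h1, h0, h2⟩ := hχ.nonneg z
    have t1 := mul_nonneg h1 (hnonneg z (tderiv j.inM.symm z v))
    have t0 := mul_nonneg h0 (real_inner_self_nonneg (x := tderiv (n := n) j.glue z v))
    have t2 := mul_nonneg h2 (hnonneg' z (tderiv j.inN.symm z v))
    have hsum := hχ.sum_eq_one z
    by_cases hz1 : χ₁ z = 0
    · by_cases hz0 : χ₀ z = 0
      · have hz2 : χ₂ z ≠ 0 := fun h => by rw [hz1, hz0, h] at hsum; norm_num at hsum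
        have hz : z ∈ j.inN.target := by
          by_contra h
          exact hz2 (hχ.eq_zero_right h)
        have := mul_pos (lt_of_le_of_ne h2 hz2.symm)
          (metricForm_pos gN (j.inN.symm z) (j.smoothIso_inN.symm.tderiv_ne_zero hz hv))
        linarith
      · have hz : z ∈ j.glue.source := by
          by_contra h
          exact hz0 (hχ.eq_zero_middle h)
        have := mul_pos (lt_of_le_of_ne h0 (Ne.symm hz0))
          (real_inner_self_pos.2 (j.smoothIso_glue.tderiv_ne_zero hz hv))
        linarith
    · have hz : z ∈ j.inM.target := by
        by_contra h
        exact hz1 (hχ.eq_zero_left h)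
      have := mul_pos (lt_of_le_of_ne h1 (Ne.symm hz1))
        (metricForm_pos gM (j.inM.symm z) (j.smoothIso_inM.symm.tderiv_ne_zero hz hv))
      linarith
  · refine SmoothFormAt.add (SmoothFormAt.add ?_ ?_) ?_
    · exact SmoothFormAt.cutoff (U := j.inM.target) (fun x hx =>
        (smoothFormAt_metricForm gM _).pullForm (j.smoothIso_inM.symm.contMDiffAt hx))
        hχ.smooth₁ hχ.support₁ z
    · exact SmoothFormAt.cutoff (U := j.glue.source) (fun x hx =>
        (smoothFormAt_const _ _).pullForm (j.smoothIso_glue.contMDiffAt hx))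
        hχ.smooth₀ hχ.support₀ z
    · exact SmoothFormAt.cutoff (U := j.inN.target) (fun x hx =>
        (smoothFormAt_metricForm gN _).pullForm (j.smoothIso_inN.symm.contMDiffAt hx))
        hχ.smooth₂ hχ.support₂ z
  · exact hG z v w

theorem agreesOutside_iff : AgreesOutside gM gN j g ↔
    (∀ x : M, x ∉ φ.source → ∀ v w : E n,
      metricForm g (j.inM x) (tderiv j.inM x v) (tderiv j.inM x w) = metricForm gM x v w) ∧
    (∀ y : N, y ∉ ψ.source → ∀ v w : E n,
      metricForm g (j.inN y) (tderiv j.inN y v) (tderiv j.inN y w) = metricForm gN y v w) :=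
  Iff.rfl

/-- A point of `M` outside the domain of `φ` lies neither in the gluing region nor in the part of
`N`, so `χ₁ = 1` there; likewise on `N`. -/
theorem IsGluedMetric.agreesOutside (hε : 0 < ε) (hφ : φ.target = Metric.ball 0 (2 * ε))
    (hψ : ψ.target = Metric.ball 0 (2 * ε)) (hg : IsGluedMetric gM gN j χ₁ χ₀ χ₂ g)
    (hχ : IsCutoff j χ₁ χ₀ χ₂) : AgreesOutside gM gN j g := by
  rw [agreesOutside_iff]
  refine ⟨fun x hx v w => ?_, fun y hy v w => ?_⟩
  · have hi : x ∈ j.inM.source := by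
      rw [j.inM_source]
      exact fun h => hx h.1
    have h0 := hχ.eq_zero_middle (mt (j.inM_mem_glue_source hε hφ hi).1 hx)
    have h2 := hχ.eq_zero_right (fun h => j.disjoint_target hε (j.inM.map_source hi) h)
    have h1 := hχ.sum_eq_one (j.inM x)
    rw [h0, h2, add_zero, add_zero] at h1
    rw [hg.left hε hχ hi, h0, h1, one_mul, zero_mul, add_zero]
  · have hi : y ∈ j.inN.source := by
      rw [j.inN_source]
      exact fun h => hy h.1
    have h0 := hχ.eq_zero_middle (mt (j.inN_mem_glue_source hε hψ hi).1 hy)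
    have h2 := hχ.eq_zero_left (fun h => j.disjoint_target hε h (j.inN.map_source hi))
    have h1 := hχ.sum_eq_one (j.inN y)
    rw [h0, h2, add_zero, zero_add] at h1
    rw [hg.right hε hχ hi, h0, h1, one_mul, zero_mul, add_zero]

/-- A convex combination of a metric and of the Euclidean metric of a conformal chart is a multiple
of the metric. -/
theorem exists_pos_mul_of_conformalAt {X M : Type*} [TopologicalSpace X] [ChartedSpace (E n) X]
    [TopologicalSpace M] [ChartedSpace (E n) M] {i : OpenPartialHomeomorph M X}
    (hi : SmoothIso (n := n) i) {k : OpenPartialHomeomorph X (E n)} (hk : SmoothIso (n := n) k)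
    {f : OpenPartialHomeomorph M (E n)} (hr : ReadsAs i k f) {x : M} (hx : x ∈ i.source)
    {G : FormField n X} {G' : FormField n M} {s t : ℝ} (hs : 0 ≤ s) (ht : 0 ≤ t) (hst : s + t = 1)
    (hG : ∀ v w, G (i x) (tderiv i x v) (tderiv i x w) = s * G' x v w + t *
        inner ℝ (tderiv (n := n) k (i x) (tderiv i x v))
          (tderiv (n := n) k (i x) (tderiv i x w)))
    (hc : t ≠ 0 → i x ∈ k.source ∧ ConformalAt G' f x) :
    ∃ c > (0 : ℝ), ∀ v w, G (i x) (tderiv i x v) (tderiv i x w) = c * G' x v w := by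
  by_cases h : t = 0
  · refine ⟨1, one_pos, fun v w => ?_⟩
    have : s = 1 := by linarith
    rw [hG, h, this, zero_mul, add_zero]
  · obtain ⟨hxk, c, hc0, hcf⟩ := hc h
    have ht0 : 0 < t := lt_of_le_of_ne ht (Ne.symm h)
    -- Since `G'` is `c` times the Euclidean form read in `f`, that form is `c⁻¹` times `G'`.
    refine ⟨s + t * c⁻¹, by positivity, fun v w => ?_⟩
    rw [hG, hcf, tderiv_of_eventuallyEq_comp hi hk hx hxk (hr.eventuallyEq hx hxk)]
    simp only [ContinuousLinearMap.comp_apply]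
    field_simp

theorem ReadsAs.restr {X M : Type*} [TopologicalSpace X] [TopologicalSpace M]
    {i : OpenPartialHomeomorph M X} {k : OpenPartialHomeomorph X (E n)}
    {f : OpenPartialHomeomorph M (E n)} (h : ReadsAs i k f) (W : Set X) :
    ReadsAs i (k.restr W) f := fun x hx hk => h x hx (by
  rw [k.restr_source] at hk
  exact hk.1)

/-- The glued metric is conformal to the metrics of the summands, and conformal in the gluing
chart on the open set `W`, as soon as the gluing charts are conformal there and `W` contains the
support of the middle cutoff function. -/
theorem IsGluedMetric.isConformalChart (hε : 0 < ε) (hφ : φ.target = Metric.ball 0 (2 * ε))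
    (hψ : ψ.target = Metric.ball 0 (2 * ε)) (hφs : SmoothIso (n := n) φ)
    (hψs : SmoothIso (n := n) ψ) (hg : IsGluedMetric gM gN j χ₁ χ₀ χ₂ g)
    (hχ : IsCutoff j χ₁ χ₀ χ₂) {W : Set (ConnSum φ ψ ε)} (hWo : IsOpen W) (hχW : tsupport χ₀ ⊆ W)
    (hM : ∀ x ∈ j.inM.source, x ∈ φ.source → j.inM x ∈ W → ConformalAt (metricForm gM) φ x)
    (hN : ∀ y ∈ j.inN.source, y ∈ ψ.source → j.inN y ∈ W → ConformalAt (metricForm gN) ψ y) :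
    (∀ e, IsConformalChart gM e → IsConformalChart g (j.inM.symm ≫ₕ e)) ∧
    (∀ e, IsConformalChart gN e → IsConformalChart g (j.inN.symm ≫ₕ e)) ∧
    IsConformalChart g (j.glue.restr W) := by
  have hL := j.readsAs_left hε hφ
  have hR := j.readsAs_right hε hψ
  have hMo : ∀ x ∈ j.inM.source, j.inM x ∈ j.glue.source → j.inM x ∈ W →
      ConformalAt (metricForm gM) (outerChart φ hε) x := by
    intro x hx hxg hxW
    have hxs := (j.inM_mem_glue_source hε hφ hx).1 hxg
    exact conformalAt_outerChart hφs hε hxs (hM x hx hxs hxW)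
  have hNo : ∀ y ∈ j.inN.source, j.inN y ∈ j.glue.source → j.inN y ∈ W →
      ConformalAt (metricForm gN) (innerChart ψ hε) y := by
    intro y hy hyg hyW
    have hys := (j.inN_mem_glue_source hε hψ hy).1 hyg
    exact conformalAt_innerChart hψs hε (hR y hy hyg).1 (hN y hy hys hyW)
  -- The factor exists on the whole part of `M`: where `χ₀` vanishes the metrics coincide, and
  -- elsewhere the point lies in `W`, where the gluing chart is conformal.
  have hcM : ∀ x ∈ j.inM.source, ∃ c > (0 : ℝ), ∀ v w,
      metricForm g (j.inM x) (tderiv j.inM x v) (tderiv j.inM x w) = c * metricForm gM x v w := by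
    intro x hx
    have h2 := hχ.eq_zero_right (fun h => j.disjoint_target hε (j.inM.map_source hx) h)
    have h1 := hχ.sum_eq_one (j.inM x)
    rw [h2, add_zero] at h1
    refine exists_pos_mul_of_conformalAt j.smoothIso_inM j.smoothIso_glue hL hx
      (hχ.nonneg (j.inM x)).1 (hχ.nonneg (j.inM x)).2.1 h1 (hg.left hε hχ hx) fun h => ?_
    have hs : j.inM x ∈ tsupport χ₀ := subset_tsupport _ h
    exact ⟨hχ.support₀ hs, hMo x hx (hχ.support₀ hs) (hχW hs)⟩
  have hcN : ∀ y ∈ j.inN.source, ∃ c > (0 : ℝ), ∀ v w,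
      metricForm g (j.inN y) (tderiv j.inN y v) (tderiv j.inN y w) = c * metricForm gN y v w := by
    intro y hy
    have h2 := hχ.eq_zero_left (fun h => j.disjoint_target hε h (j.inN.map_source hy))
    have h1 := hχ.sum_eq_one (j.inN y)
    rw [h2, zero_add, add_comm] at h1
    refine exists_pos_mul_of_conformalAt j.smoothIso_inN j.smoothIso_glue hR hy
      (hχ.nonneg (j.inN y)).2.2 (hχ.nonneg (j.inN y)).2.1 h1 (hg.right hε hχ hy) fun h => ?_
    have hs : j.inN y ∈ tsupport χ₀ := subset_tsupport _ h
    exact ⟨hχ.support₀ hs, hNo y hy (hχ.support₀ hs) (hχW hs)⟩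
  refine ⟨fun e he => ?_, fun e he => ?_, ?_⟩
  · rw [isConformalChart_iff] at he ⊢
    have hs := j.smoothIso_inM.symm.trans he.1
    refine ⟨hs, fun z hz => ?_⟩
    obtain ⟨x, hi, hx, rfl⟩ := exists_of_mem_symm_trans_source hz
    obtain ⟨c, hc, hcc⟩ := hcM x hi
    exact conformalAt_of_comp j.smoothIso_inM hs hi hz (symm_trans_eventuallyEq hi) hc hcc
      (he.2 x hx)
  · rw [isConformalChart_iff] at he ⊢
    have hs := j.smoothIso_inN.symm.trans he.1
    refine ⟨hs, fun z hz => ?_⟩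
    obtain ⟨x, hi, hx, rfl⟩ := exists_of_mem_symm_trans_source hz
    obtain ⟨c, hc, hcc⟩ := hcN x hi
    exact conformalAt_of_comp j.smoothIso_inN hs hi hz (symm_trans_eventuallyEq hi) hc hcc
      (he.2 x hx)
  · rw [isConformalChart_iff]
    refine ⟨j.smoothIso_glue.restr W, fun z hz => ?_⟩
    rw [j.glue.restr_source, hWo.interior_eq] at hz
    change ConformalAt (metricForm g) j.glue z
    rcases j.trichotomy hε z with ⟨x, hx, rfl⟩ | ⟨y, hy, rfl⟩ | ⟨-, hz1, hz2⟩
    · obtain ⟨c, hc, hcc⟩ := hcM x hx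
      exact conformalAt_of_comp j.smoothIso_inM j.smoothIso_glue hx hz.1
        (hL.eventuallyEq hx hz.1) hc hcc (hMo x hx hz.1 hz.2)
    · obtain ⟨c, hc, hcc⟩ := hcN y hy
      exact conformalAt_of_comp j.smoothIso_inN j.smoothIso_glue hy hz.1
        (hR.eventuallyEq hy hz.1) hc hcc (hNo y hy hz.1 hz.2)
    -- On the neck sphere only the middle term survives, and `g` is the Euclidean metric of the
    -- gluing chart.
    · have h1 := hχ.sum_eq_one z
      rw [hχ.eq_zero_left hz1, hχ.eq_zero_right hz2, zero_add, add_zero] at h1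
      refine ⟨1, one_pos, fun v w => ?_⟩
      rw [hg.metricForm_eq, hχ.eq_zero_left hz1, hχ.eq_zero_right hz2, h1]
      ring

end GluedMetric

/-! ### Gluing the deformed metrics and atlases near the neck -/

section Neck

variable {n : ℕ} {M N : Type*} [TopologicalSpace M] [TopologicalSpace N]
  {φ : OpenPartialHomeomorph M (E n)} {ψ : OpenPartialHomeomorph N (E n)} {ε : ℝ}

/-- The points of the connected sum at signed distance less than `s` from the neck. -/
def neck (φ : OpenPartialHomeomorph M (E n)) (ψ : OpenPartialHomeomorph N (E n)) (ε s : ℝ) :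
    Set (ConnSum φ ψ ε) :=
  {z | |height φ ψ ε z| < s}

theorem isOpen_neck [T2Space M] [T2Space N] (hφ : φ.target = Metric.ball 0 (2 * ε))
    (hψ : ψ.target = Metric.ball 0 (2 * ε)) (s : ℝ) : IsOpen (neck φ ψ ε s) :=
  isOpen_lt (continuous_height hφ hψ).abs continuous_const

variable [ChartedSpace (E n) M] [ChartedSpace (E n) N]
  [ChartedSpace (E n) (ConnSum φ ψ ε)] (j : GluingMaps φ ψ ε)

theorem GluingMaps.neck_subset (hε : 0 < ε) {s : ℝ} (hs : s ≤ ε) :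
    neck φ ψ ε s ⊆ j.glue.source := fun _ hz =>
  (j.mem_glue_source hε).2 (lt_of_lt_of_le hz hs)

theorem GluingMaps.mem_neck (hε : 0 < ε) {s : ℝ} (hs : 0 < s) {z : ConnSum φ ψ ε}
    (hz : z ∉ j.inM.target) (hz' : z ∉ j.inN.target) : z ∈ neck φ ψ ε s := by
  rw [j.mem_inM_target hε, not_lt] at hz
  rw [j.mem_inN_target hε, not_lt] at hz'
  change |height φ ψ ε z| < s
  rwa [le_antisymm hz hz', abs_zero]

theorem GluingMaps.norm_lt_of_inM_mem_neck {s : ℝ} {x : M} (hx : x ∈ j.inM.source)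
    (hxφ : x ∈ φ.source) (h : j.inM x ∈ neck φ ψ ε s) : ‖φ x‖ < ε + s := by
  rw [j.inM_eq hx] at h
  change |chartNorm φ (2 * ε) x - ε| < s at h
  rw [chartNorm_of_mem hxφ] at h
  linarith [(abs_lt.1 h).2]

theorem GluingMaps.norm_lt_of_inN_mem_neck {s : ℝ} {y : N} (hy : y ∈ j.inN.source)
    (hyψ : y ∈ ψ.source) (h : j.inN y ∈ neck φ ψ ε s) : ‖ψ y‖ < ε + s := by
  rw [j.inN_eq hy] at h
  change |ε - chartNorm ψ (2 * ε) y| < s at h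
  rw [chartNorm_of_mem hyψ] at h
  linarith [(abs_lt.1 h).1]

end Neck

section Deformed

variable {n : ℕ} {M : Type*} [TopologicalSpace M] [ChartedSpace (E n) M]
  [IsManifold 𝓘(ℝ, E n) ∞ M]

theorem metricForm_pullbackMetric_of_eventuallyEq_id {g : RMetric n M} {F : M ≃ₜ M}
    {hF : SmoothIso (n := n) F.toOpenPartialHomeomorph} {x : M} (h : F =ᶠ[𝓝 x] id) :
    metricForm (pullbackMetric g F hF) x = metricForm g x := by
  have h1 : tderiv (n := n) F x = ContinuousLinearMap.id ℝ (E n) :=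
    (tderiv_congr h).trans (tderiv_id x)
  ext v w
  rw [metricForm_pullbackMetric, pullForm_apply, h1, h.eq_of_nhds]
  rfl

theorem isMobiusAtlas_image_homeomorph {A : Set (OpenPartialHomeomorph M (E n))}
    (hA : IsMobiusAtlas A) {F : M ≃ₜ M} (hF : SmoothIso (n := n) F.toOpenPartialHomeomorph) :
    IsMobiusAtlas ((fun e => F.toOpenPartialHomeomorph ≫ₕ e) '' A) := by
  refine ⟨?_, fun x => ?_, ?_⟩
  · rintro _ ⟨e, he, rfl⟩
    exact mem_smoothCharts_iff.2 (hF.trans (mem_smoothCharts_iff.1 (hA.subset he)))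
  · obtain ⟨e, he, hx⟩ := hA.cover (F x)
    exact ⟨_, ⟨e, he, rfl⟩, Set.mem_univ _, hx⟩
  · rintro _ ⟨e, he, rfl⟩ _ ⟨e', he', rfl⟩
    rw [mobiusCompatible_iff]
    intro x hx hx'
    exact (mobiusCompatible_iff.1 (hA.compatible e he e' he') (F x) hx.2 hx'.2).comp
      F.continuous.continuousAt

end Deformed

section Flat

variable {n : ℕ} {M N : Type*} [TopologicalSpace M] [TopologicalSpace N]
  [ChartedSpace (E n) M] [ChartedSpace (E n) N]
  {φ : OpenPartialHomeomorph M (E n)} {ψ : OpenPartialHomeomorph N (E n)} {ε : ℝ}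
  [ChartedSpace (E n) (ConnSum φ ψ ε)] [IsManifold 𝓘(ℝ, E n) ∞ (ConnSum φ ψ ε)]
  (j : GluingMaps φ ψ ε)

theorem isLocallyConformallyFlat_of_cover (hε : 0 < ε) {g : RMetric n (ConnSum φ ψ ε)}
    (hM : ∀ x ∈ j.inM.source, ∃ e, IsConformalChart g (j.inM.symm ≫ₕ e) ∧ x ∈ e.source)
    (hN : ∀ y ∈ j.inN.source, ∃ e, IsConformalChart g (j.inN.symm ≫ₕ e) ∧ y ∈ e.source)
    {k : OpenPartialHomeomorph (ConnSum φ ψ ε) (E n)} (hk : IsConformalChart g k)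
    (hks : ∀ z, z ∉ j.inM.target → z ∉ j.inN.target → z ∈ k.source) :
    IsLocallyConformallyFlat g := fun z => by
  rcases j.trichotomy hε z with ⟨x, hx, rfl⟩ | ⟨y, hy, rfl⟩ | ⟨-, hz, hz'⟩
  · obtain ⟨e, he, hxe⟩ := hM x hx
    exact ⟨_, he, (mem_symm_trans_source hx).2 hxe⟩
  · obtain ⟨e, he, hye⟩ := hN y hy
    exact ⟨_, he, (mem_symm_trans_source hy).2 hye⟩
  · exact ⟨k, hk, hks z hz hz'⟩

variable [IsManifold 𝓘(ℝ, E n) ∞ M] [IsManifold 𝓘(ℝ, E n) ∞ N]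
  {gM : RMetric n M} {gN : RMetric n N}

/-- Conformal gluing charts glue locally conformally flat metrics to such a metric. -/
theorem IsGluedMetric.isLocallyConformallyFlat {j : GluingMaps φ ψ ε}
    {χ₁ χ₀ χ₂ : ConnSum φ ψ ε → ℝ} {g : RMetric n (ConnSum φ ψ ε)} (hε : 0 < ε)
    (hφ : φ.target = Metric.ball 0 (2 * ε)) (hψ : ψ.target = Metric.ball 0 (2 * ε))
    (hg : IsGluedMetric gM gN j χ₁ χ₀ χ₂ g) (hχ : IsCutoff j χ₁ χ₀ χ₂)
    (hM : IsLocallyConformallyFlat gM) (hN : IsLocallyConformallyFlat gN)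
    (hφc : IsConformalChart gM φ) (hψc : IsConformalChart gN ψ) :
    IsLocallyConformallyFlat g := by
  rw [isConformalChart_iff] at hφc hψc
  obtain ⟨h1, h2, h3⟩ := hg.isConformalChart hε hφ hψ hφc.1 hψc.1 hχ j.glue.open_source
    hχ.support₀ (fun x _ hx _ => hφc.2 x hx) (fun y _ hy _ => hψc.2 y hy)
  refine isLocallyConformallyFlat_of_cover j hε (fun x _ => ?_) (fun y _ => ?_) h3 fun z hz hz' => ?_
  · obtain ⟨e, he, hx⟩ := hM x
    exact ⟨e, h1 e he, hx⟩
  · obtain ⟨e, he, hy⟩ := hN y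
    exact ⟨e, h2 e he, hy⟩
  · rw [j.glue.restr_source, j.glue.open_source.interior_eq, Set.inter_self]
    exact j.neck_subset hε le_rfl (j.mem_neck hε hε hz hz')

/-- After deforming the metrics inside the balls where they are glued, the gluing charts are
conformal near the neck. -/
theorem exists_conformal_gluing [T2Space M] [T2Space N] [T2Space (ConnSum φ ψ ε)]
    [SecondCountableTopology (ConnSum φ ψ ε)] (hε : 0 < ε) {p : M} {q : N}
    (hφ : IsExpChart gM p (2 * ε) φ) (hψ : IsExpChart gN q (2 * ε) ψ)
    {e : OpenPartialHomeomorph M (E n)} (he : IsConformalChart gM e) (hp : p ∈ e.source)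
    {f : OpenPartialHomeomorph N (E n)} (hf : IsConformalChart gN f) (hq : q ∈ f.source) :
    ∃ (F : M ≃ₜ M) (_ : SmoothIso (n := n) F.toOpenPartialHomeomorph)
      (H : N ≃ₜ N) (_ : SmoothIso (n := n) H.toOpenPartialHomeomorph)
      (W : Set (ConnSum φ ψ ε)) (g : RMetric n (ConnSum φ ψ ε)),
      (∀ x ∉ φ.source, F =ᶠ[𝓝 x] id) ∧ (∀ y ∉ ψ.source, H =ᶠ[𝓝 y] id) ∧
      (∀ x ∈ j.inM.source, x ∈ φ.source → j.inM x ∈ W →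
        F x ∈ e.source ∧ MobiusAt (fun z => e (F z)) φ x) ∧
      (∀ y ∈ j.inN.source, y ∈ ψ.source → j.inN y ∈ W →
        H y ∈ f.source ∧ MobiusAt (fun z => f (H z)) ψ y) ∧
      (∀ z, z ∉ j.inM.target → z ∉ j.inN.target → z ∈ (j.glue.restr W).source) ∧
      IsOpen W ∧
      (∀ k, IsConformalChart gM k →
        IsConformalChart g (j.inM.symm ≫ₕ (F.toOpenPartialHomeomorph ≫ₕ k))) ∧
      (∀ k, IsConformalChart gN k →
        IsConformalChart g (j.inN.symm ≫ₕ (H.toOpenPartialHomeomorph ≫ₕ k))) ∧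
      IsConformalChart g (j.glue.restr W) ∧ AgreesOutside gM gN j g := by
  -- Points of the neck of half-width `ε / 4` have coordinates of norm less than `ε + ε / 4`, inside
  -- the ball where the deformation makes the charts conformal; this radius is still less than `2 *
  -- ε`.
  have hε4 : 0 < ε / 4 := by positivity
  obtain ⟨F, hF, hFid, hFc⟩ := exists_conformal_deformation
    (a := ε + ε / 4) (by linarith) (by linarith) hφ he hp
  obtain ⟨H, hH, hHid, hHc⟩ := exists_conformal_deformation
    (a := ε + ε / 4) (by linarith) (by linarith) hψ hf hq
  have hWo := isOpen_neck (φ := φ) (ψ := ψ) hφ.target_eq hψ.target_eq (ε / 4)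
  have hW := j.neck_subset hε (by linarith : ε / 4 ≤ ε)
  obtain ⟨χ₁, χ₀, χ₂, hχ, hχW⟩ := exists_isCutoff j hWo hW fun z => j.mem_neck hε hε4
  obtain ⟨g, hg⟩ := exists_isGluedMetric (pullbackMetric gM F hF) (pullbackMetric gN H hH) hχ
  have hM := fun x hx hxφ (h : j.inM x ∈ neck φ ψ ε (ε / 4)) =>
    hFc x hxφ (j.norm_lt_of_inM_mem_neck hx hxφ h)
  have hN := fun y hy hyψ (h : j.inN y ∈ neck φ ψ ε (ε / 4)) =>
    hHc y hyψ (j.norm_lt_of_inN_mem_neck hy hyψ h)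
  obtain ⟨h1, h2, h3⟩ := hg.isConformalChart hε hφ.target_eq hψ.target_eq
    (mem_smoothCharts_iff.1 hφ.mem_smoothCharts) (mem_smoothCharts_iff.1 hψ.mem_smoothCharts)
    hχ hWo hχW (fun x hx hxφ h => (hM x hx hxφ h).2.2) (fun y hy hyψ h => (hN y hy hyψ h).2.2)
  refine ⟨F, hF, H, hH, neck φ ψ ε (ε / 4), g, hFid, hHid,
    fun x hx hxφ h => ⟨(hM x hx hxφ h).1, (hM x hx hxφ h).2.1⟩,
    fun y hy hyψ h => ⟨(hN y hy hyψ h).1, (hN y hy hyψ h).2.1⟩, fun z hz hz' => ?_, hWo,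
    fun k hk => h1 _ (isConformalChart_pullback hF hk),
    fun k hk => h2 _ (isConformalChart_pullback hH hk), h3, ?_⟩
  · rw [j.glue.restr_source, hWo.interior_eq]
    exact ⟨hW (j.mem_neck hε hε4 hz hz'), j.mem_neck hε hε4 hz hz'⟩
  -- The glued metric agrees with the deformed metrics outside the balls, and these agree with the
  -- original ones there because `F` and `H` are the identity near such points.
  · have h := hg.agreesOutside hε hφ.target_eq hψ.target_eq hχ
    rw [agreesOutside_iff] at h ⊢
    refine ⟨fun x hx v w => ?_, fun y hy v w => ?_⟩
    · rw [h.1 x hx, metricForm_pullbackMetric_of_eventuallyEq_id (hFid x hx)]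
    · rw [h.2 y hy, metricForm_pullbackMetric_of_eventuallyEq_id (hHid y hy)]

variable [T2Space M] [T2Space N] [T2Space (ConnSum φ ψ ε)]
  [SecondCountableTopology (ConnSum φ ψ ε)]

theorem exists_isLocallyConformallyFlat (hε : 0 < ε) {p : M} {q : N}
    (hφ : IsExpChart gM p (2 * ε) φ) (hψ : IsExpChart gN q (2 * ε) ψ)
    (hM : IsLocallyConformallyFlat gM) (hN : IsLocallyConformallyFlat gN) :
    ∃ g, IsLocallyConformallyFlat g ∧ AgreesOutside gM gN j g := by
  obtain ⟨e, he, hp⟩ := hM p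
  obtain ⟨f, hf, hq⟩ := hN q
  obtain ⟨F, -, H, -, W, g, -, -, -, -, hcov, -, h1, h2, h3, hg⟩ :=
    exists_conformal_gluing j hε hφ hψ he hp hf hq
  refine ⟨g, isLocallyConformallyFlat_of_cover j hε (fun x _ => ?_) (fun y _ => ?_) h3 hcov, hg⟩
  · obtain ⟨k, hk, hx⟩ := hM (F x)
    exact ⟨_, h1 k hk, Set.mem_univ _, hx⟩
  · obtain ⟨k, hk, hy⟩ := hN (H y)
    exact ⟨_, h2 k hk, Set.mem_univ _, hy⟩

/-- The atlas consists of the charts of `A` and `B` composed with `F` and `H`, and of the gluing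
chart on the thin neck `W`. Over `W`, a chart `k ∘ F` is Möbius related to `e ∘ F`, hence to `φ` and
to `φ / ε`; on `N` the inversion is one more Möbius step. Where a chart of `A` avoids the ball, `F`
is the identity and the gluing chart is absent, so only the compatibility of `A` with itself is
involved. -/
theorem exists_isMobiusAtlas (hε : 0 < ε) {p : M} {q : N}
    (hφ : IsExpChart gM p (2 * ε) φ) (hψ : IsExpChart gN q (2 * ε) ψ)
    {A : Set (OpenPartialHomeomorph M (E n))} {B : Set (OpenPartialHomeomorph N (E n))}
    (hA : IsMobiusAtlas A) (hAc : ∀ e ∈ A, IsConformalChart gM e)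
    (hB : IsMobiusAtlas B) (hBc : ∀ e ∈ B, IsConformalChart gN e) :
    ∃ (C : Set (OpenPartialHomeomorph (ConnSum φ ψ ε) (E n)))
      (g : RMetric n (ConnSum φ ψ ε)),
      IsMobiusAtlas C ∧ (∀ e ∈ C, IsConformalChart g e) ∧ AgreesOutside gM gN j g ∧
      (∀ e ∈ A, Disjoint e.source φ.source →
        ∀ c ∈ C, MobiusCompatible c (j.inM.symm ≫ₕ e)) ∧
      (∀ e ∈ B, Disjoint e.source ψ.source →
        ∀ c ∈ C, MobiusCompatible c (j.inN.symm ≫ₕ e)) := by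
  obtain ⟨e, he, hp⟩ := hA.cover p
  obtain ⟨f, hf, hq⟩ := hB.cover q
  obtain ⟨F, hF, H, hH, W, g, hFid, hHid, hFm, hHm, hcov, hWo, h1, h2, h3, hg⟩ :=
    exists_conformal_gluing j hε hφ hψ (hAc e he) hp (hBc f hf) hq
  have hL := (j.readsAs_left hε hφ.target_eq).restr W
  have hR := (j.readsAs_right hε hψ.target_eq).restr W
  have hmem : ∀ z, z ∈ (j.glue.restr W).source → z ∈ j.glue.source ∧ z ∈ W := fun z hz => by
    rwa [j.glue.restr_source, hWo.interior_eq] at hz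
  refine ⟨gluedAtlasWith j ((fun e => F.toOpenPartialHomeomorph ≫ₕ e) '' A)
    ((fun e => H.toOpenPartialHomeomorph ≫ₕ e) '' B) (j.glue.restr W), g,
    isMobiusAtlas_gluedAtlasWith j hε (isMobiusAtlas_image_homeomorph hA hF)
      (isMobiusAtlas_image_homeomorph hB hH) (j.smoothIso_glue.restr W) hcov hL hR ?_ ?_,
    ?_, hg, fun k hk hd c hc => ?_, fun k hk hd c hc => ?_⟩
  · rintro _ ⟨k, hk, rfl⟩ x hi hx hxW
    obtain ⟨hxg, hxW⟩ := hmem _ hxW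
    have hxφ := (j.inM_mem_glue_source hε hφ.target_eq hi).1 hxg
    obtain ⟨hFx, hm⟩ := hFm x hi hxφ hxW
    have h := (mobiusCompatible_iff.1 (hA.compatible k hk e he) (F x) hx.2 hFx).comp
      (F.continuous.continuousAt (x := x))
    exact (h.trans hm).trans (mobiusAt_outerChart hε hxφ)
  · rintro _ ⟨k, hk, rfl⟩ y hi hy hyW
    have hys := (hR y hi hyW).1
    obtain ⟨hyg, hyW⟩ := hmem _ hyW
    have hyψ := (j.inN_mem_glue_source hε hψ.target_eq hi).1 hyg
    obtain ⟨hHy, hm⟩ := hHm y hi hyψ hyW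
    have h := (mobiusCompatible_iff.1 (hB.compatible k hk f hf) (H y) hy.2 hHy).comp
      (H.continuous.continuousAt (x := y))
    exact (h.trans hm).trans (mobiusAt_innerChart hε hys)
  · rintro c ((⟨_, ⟨k, hk, rfl⟩, rfl⟩ | ⟨_, ⟨k, hk, rfl⟩, rfl⟩) | rfl)
    · exact h1 k (hAc k hk)
    · exact h2 k (hBc k hk)
    · exact h3
  · rw [mobiusCompatible_iff]
    intro z hz hz'
    obtain ⟨x, hi, hx, rfl⟩ := exists_of_mem_symm_trans_source hz'
    have hxφ : x ∉ φ.source := Set.disjoint_left.1 hd hx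
    rcases hc with (⟨_, ⟨l, hl, rfl⟩, rfl⟩ | ⟨_, ⟨l, hl, rfl⟩, rfl⟩) | rfl
    · refine mobiusAt_of_comp hi (symm_trans_eventuallyEq hi) (symm_trans_eventuallyEq hi) ?_
      have hxl := ((mem_symm_trans_source hi).1 hz).2
      change F x ∈ l.source at hxl
      rw [(hFid x hxφ).eq_of_nhds] at hxl
      exact (mobiusCompatible_iff.1 (hA.compatible l hl k hk) x hxl hx).congr
        ((hFid x hxφ).fun_comp l) .rfl
    · exact (j.disjoint_target hε hz'.1 hz.1).elim
    · exact (hxφ ((j.inM_mem_glue_source hε hφ.target_eq hi).1 (hmem _ hz).1)).elim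
  · rw [mobiusCompatible_iff]
    intro z hz hz'
    obtain ⟨y, hi, hy, rfl⟩ := exists_of_mem_symm_trans_source hz'
    have hyψ : y ∉ ψ.source := Set.disjoint_left.1 hd hy
    rcases hc with (⟨_, ⟨l, hl, rfl⟩, rfl⟩ | ⟨_, ⟨l, hl, rfl⟩, rfl⟩) | rfl
    · exact (j.disjoint_target hε hz.1 hz'.1).elim
    · refine mobiusAt_of_comp hi (symm_trans_eventuallyEq hi) (symm_trans_eventuallyEq hi) ?_
      have hyl := ((mem_symm_trans_source hi).1 hz).2
      change H y ∈ l.source at hyl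
      rw [(hHid y hyψ).eq_of_nhds] at hyl
      exact (mobiusCompatible_iff.1 (hB.compatible l hl k hk) y hyl hy).congr
        ((hHid y hyψ).fun_comp l) .rfl
    · exact (hyψ ((j.inN_mem_glue_source hε hψ.target_eq hi).1 (hmem _ hz).1)).elim

end Flat

end ConnectedSum

open ConnectedSum in
theorem mainTheorem5 {n : ℕ} (hn : 0 < n)
    {M : Type*} [TopologicalSpace M] [T2Space M] [SecondCountableTopology M]
    [ChartedSpace (E n) M] [IsManifold 𝓘(ℝ, E n) ∞ M]
    {N : Type*} [TopologicalSpace N] [T2Space N] [SecondCountableTopology N]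
    [ChartedSpace (E n) N] [IsManifold 𝓘(ℝ, E n) ∞ N]
    (gM : RMetric n M) (gN : RMetric n N)
    (oM : Set (OpenPartialHomeomorph M (E n))) (hoM : IsOrientedAtlas oM)
    (oN : Set (OpenPartialHomeomorph N (E n))) (hoN : IsOrientedAtlas oN)
    (p : M) (q : N) (ε : ℝ) (hε : 0 < ε)
    (φ : OpenPartialHomeomorph M (E n)) (hφ : IsExpChart gM p (2 * ε) φ)
    (hφo : PreservesOrientation oM φ)
    (ψ : OpenPartialHomeomorph N (E n)) (hψ : IsExpChart gN q (2 * ε) ψ)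
    (hψo : ReversesOrientation oN ψ) :
    -- `M ♯ N` is a smooth manifold, its charts being those of `M`, those of `N` and `Φ`
    ∃ (_ : ChartedSpace (E n) (ConnSum φ ψ ε))
      (_ : IsManifold 𝓘(ℝ, E n) ∞ (ConnSum φ ψ ε)) (j : GluingMaps φ ψ ε),
      T2Space (ConnSum φ ψ ε) ∧ SecondCountableTopology (ConnSum φ ψ ε) ∧
      (CompactSpace M → CompactSpace N → CompactSpace (ConnSum φ ψ ε)) ∧
      -- the charts of the orientations of `M` and `N` and the gluing chart orient `M ♯ N`
      IsOrientedAtlas (gluedAtlas j oM oN) ∧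
      -- cutoff functions exist, and any of them glue the metrics
      (∃ χ₁ χ₀ χ₂ : ConnSum φ ψ ε → ℝ, IsCutoff j χ₁ χ₀ χ₂) ∧
      (∀ χ₁ χ₀ χ₂ : ConnSum φ ψ ε → ℝ, IsCutoff j χ₁ χ₀ χ₂ →
        ∃ g : RMetric n (ConnSum φ ψ ε),
          IsGluedMetric gM gN j χ₁ χ₀ χ₂ g ∧ AgreesOutside gM gN j g ∧
          -- the glued metric is itself locally conformally flat if the charts are conformal
          (IsLocallyConformallyFlat gM → IsLocallyConformallyFlat gN →
            IsConformalChart gM φ → IsConformalChart gN ψ → IsLocallyConformallyFlat g)) ∧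
      -- local conformal flatness of `M ♯ N`
      (IsLocallyConformallyFlat gM → IsLocallyConformallyFlat gN →
        ∃ g : RMetric n (ConnSum φ ψ ε),
          IsLocallyConformallyFlat g ∧ AgreesOutside gM gN j g) ∧
      -- the same in terms of atlases whose changes of charts are Möbius transformations
      (∀ (A : Set (OpenPartialHomeomorph M (E n))) (B : Set (OpenPartialHomeomorph N (E n))),
        IsMobiusAtlas A → (∀ e ∈ A, IsConformalChart gM e) →
        IsMobiusAtlas B → (∀ e ∈ B, IsConformalChart gN e) →
          (∃ (C : Set (OpenPartialHomeomorph (ConnSum φ ψ ε) (E n)))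
            (g : RMetric n (ConnSum φ ψ ε)),
            IsMobiusAtlas C ∧ (∀ e ∈ C, IsConformalChart g e) ∧ AgreesOutside gM gN j g ∧
            (∀ e ∈ A, Disjoint e.source φ.source →
              ∀ c ∈ C, MobiusCompatible c (j.inM.symm ≫ₕ e)) ∧
            (∀ e ∈ B, Disjoint e.source ψ.source →
              ∀ c ∈ C, MobiusCompatible c (j.inN.symm ≫ₕ e))) ∧
          -- Möbius gluing charts complete the two atlases to a Möbius atlas of `M ♯ N`
          ((∀ e ∈ A, MobiusCompatible e φ) → (∀ e ∈ B, MobiusCompatible e ψ) →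
            IsMobiusAtlas (gluedAtlas j A B))) := by
  have hφt := hφ.target_eq
  have hψt := hψ.target_eq
  have : Nonempty (ConnSum φ ψ ε) := nonempty_connSum hn hε hφt
  have hT2 : T2Space (ConnSum φ ψ ε) := t2Space_connSum hε hφt hψt
  have hSC : SecondCountableTopology (ConnSum φ ψ ε) := secondCountableTopology_connSum hε hφt hψt
  obtain ⟨hC, hI, ⟨j⟩⟩ := exists_gluingMaps hε hφt hψt hφ.mem_smoothCharts hψ.mem_smoothCharts
  refine ⟨hC, hI, j, hT2, hSC, fun _ _ => compactSpace_connSum,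
    isOrientedAtlas_gluedAtlas j hε hφt hψt hφ.mem_smoothCharts hψ.mem_smoothCharts hoM hoN hφo hψo,
    ?_, fun χ₁ χ₀ χ₂ hχ => ?_, exists_isLocallyConformallyFlat j hε hφ hψ,
    fun A B hA hAc hB hBc => ⟨exists_isMobiusAtlas j hε hφ hψ hA hAc hB hBc,
      isMobiusAtlas_gluedAtlas j hε hφt hψt hA hB⟩⟩
  · obtain ⟨χ₁, χ₀, χ₂, hχ, -⟩ := exists_isCutoff j j.glue.open_source le_rfl
      fun z hz hz' => j.neck_subset hε le_rfl (j.mem_neck hε hε hz hz')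
    exact ⟨χ₁, χ₀, χ₂, hχ⟩
  · obtain ⟨g, hg⟩ := exists_isGluedMetric gM gN hχ
    exact ⟨g, hg, hg.agreesOutside hε hφt hψt hχ, hg.isLocallyConformallyFlat hε hφt hψt hχ⟩
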